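/- **Setting.** Let $R$ be an integral domain with field of fractions $\mathbb F$, and let $A_0\subseteq A_1\subseteq\cdots$ be a sequence of diagram algebras over $R$, i.e. an increasing sequence of unital cellular $R$-algebras (with non-empty tableau sets $\mathrm{Std}(\lambda)$, unital inclusions and consistent involutions $*$) such that: (D1) $A_0=R$; (D2) every cell module $\Delta_r(\lambda)$, $\lambda\in\widehat A_r$, is a cyclic right $A_r$-module; fix a generator $\delta_r(\lambda)$ and a lift $m_\lambda\in A_r^{\unrhd\lambda}$ of $\alpha_\lambda^{-1}(\delta_r(\lambda)^*\otimes\delta_r(\lambda))$, where $\alpha_\lambda:A_r^{\unrhd\lambda}/A_r^{\rhd\lambda}\to\Delta_r(\lambda)^*\otimes\Delta_r(\lambda)$, $c^\lambda_{st}\mapsto (c^\lambda_s)^*\otimes c^\lambda_t$; (D3) $m_\lambda=m_\lambda^*$, and $m_\varnothing=1$ for the unique element $\varnothing$ of $\widehat A_0$; (D4) $A_r^{\mathbb F}=A_r\otimes_R\mathbb F$ is split semisimple; (D5) each $\Delta_r(\mu)$, $r\ge1$, restricted to $A_{r-1}$ has a filtration $0=N_0\subseteq\cdots\subseteq N_n=\Delta_r(\mu)$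 by $A_{r-1}$-submodules with $N_i/N_{i-1}\cong\Delta_{r-1}(\lambda^{(i)})$ and $\lambda^{(1)}\rhd\cdots\rhd\lambda^{(n)}$; the $\lambda^{(i)}$ are the $\lambda$ with an edge $\lambda\to\mu$ in the branching diagram $\widehat A$. Let $d_{\lambda^{(i)}\to\mu}\in A_r$ be down-branching factors: $\delta_r(\mu)d_{\lambda^{(i)}\to\mu}\in N_i$, and its class corresponds to $\delta_{r-1}(\lambda^{(i)})$. (D6) There are $u_{\lambda\to\mu}\in A_r$ with $m_\mu d_{\lambda\to\mu}=u_{\lambda\to\mu}^*m_\lambda$ for every edge $\lambda\to\mu$. Let $\mathrm{Std}_r(\lambda)$ be the set of directed paths $t=(\varnothing=t(0)\to t(1)\to\cdots\to t(r)=\lambda)$ in $\widehat A$ and $\mathrm{Std}_r=\bigcup_\lambda\mathrm{Std}_r(\lambda)$. Put $d_t=d_{t(r-1)\to t(r)}\cdots d_{t(0)\to t(1)}$, $m^\lambda_{st}=d_s^*m_\lambda d_t$ and $m^\lambda_t=\delta_r(\lambda)d_t\in\Delta_r(\lambda)$. Let $z^\lambda_r\in A_r^{\mathbb F}$ be the minimal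 central idempotent acting as the identity on $\Delta_r^{\mathbb F}(\lambda)$; put $F_t=\prod_{0\le j\le r}z_j^{t(j)}$ (Gelfand–Zeitlin idempotents), $f^\lambda_t=m^\lambda_tF_t\in\Delta^{\mathbb F}_r(\lambda)$, $F^\lambda_{st}=F_sm^\lambda_{st}F_t$. Let $\langle\,,\rangle$ be the bilinear form on the cell module, given by $x\,\alpha_\lambda^{-1}(y^*\otimes z)=\langle x,y\rangle z$. Let $\pi:R\to S$ be a surjective homomorphism onto an integral domain with field of fractions $\mathbb K$, $A_r^S=A_r\otimes_RS$, $A_r^{\mathbb K}=A_r\otimes_R\mathbb K$. Let $(Q_r)_{r\ge0}$ be an increasing sequence of unital $\mathbb K$-algebras (with common identity), and $\phi=\phi_r:A_r^{\mathbb K}\to Q_r$ surjective homomorphisms compatible with the maps $A_r^{\mathbb K}\to A_{r+1}^{\mathbb K}$, $Q_r\subseteq Q_{r+1}$, satisfying: (Q1) there are subsets $\widehat A_{r,\mathrm{perm}}\subseteq\widehat A_r$ of permissible points; $\varnothing$ is permissible, each permissible $\mu\in\widehat A_r$ has a permissible $\nu\in\widehat A_{r+1}$ with $\mu\to\nu$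 and, if $r\ge1$, a permissible $\lambda\in\widehat A_{r-1}$ with $\lambda\to\mu$. A path is permissible if all its vertices are; $\mathrm{Std}_{r,\mathrm{perm}}(\lambda)$ is the set of permissible paths of shape $\lambda$. (Q2) If $\mu\in\widehat A_k$ is the first non-permissible vertex of some path, there are $b_\mu,b'_\mu\in A_k^S$ with $m_\mu=b_\mu-b'_\mu$, $b_\mu\in\ker\phi$, $b'_\mu\in m_\mu A_k^{\mathbb K}\cap(A_k^S)^{\rhd\mu}$. (Q3) $\dim_{\overline{\mathbb K}}(Q_r\otimes_{\mathbb K}\overline{\mathbb K})=\sum_{\lambda\in\widehat A_{r,\mathrm{perm}}}(\#\mathrm{Std}_{r,\mathrm{perm}}(\lambda))^2$. Assume moreover that every $Q_r$ is split semisimple. Assume that $(A_r)$ has additive (resp. multiplicative) Jucys–Murphy elements: $L_r\in A_r$ ($r\ge1$) with $L_r=L_r^*$, $L_r$ commuting with $A_{r-1}$, and $L_1+\cdots+L_r$ (resp. $L_1\cdots L_r$) acting on $\Delta_r(\lambda)$ as a scalar $d(\lambda)\in R$ (resp. $d(\lambda)\in R\setminus\{0\}$), with $d(\varnothing)=0$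 (resp. $1$). For an edge put $\kappa(\lambda\to\mu)=d(\mu)-d(\lambda)$ (resp. $d(\mu)d(\lambda)^{-1}$). Assume the separation condition: for distinct $s,t\in\mathrm{Std}_r$ there is $1\le i\le r$ with $\kappa(s(i-1)\to s(i))\neq\kappa(t(i-1)\to t(i))$. Let $\mathfrak p=\ker\pi$; elements of $R_{\mathfrak p}\subseteq\mathbb F$ and of $A_r^{R_{\mathfrak p}}\subseteq A_r^{\mathbb F}$ are called evaluable, and $\pi$ also denotes the evaluations $R_{\mathfrak p}\to\mathbb K$, $A_r^{R_{\mathfrak p}}\to A_r^{\mathbb K}$ (and $A_r\to A_r^{\mathbb K}$). Assume (SN): $F_t$ is evaluable for every permissible path $t$. For permissible $\lambda\in\widehat A_r$ let $Q_r^{\rhd\lambda}=\phi((A_r^{\mathbb K})^{\rhd\lambda})$ and let the cell module $\Delta_{Q_r}(\lambda)$ be the $\mathbb K$-span of the classes $\phi(m_\lambda d_t)+Q_r^{\rhd\lambda}$, $t\in\mathrm{Std}_{r,\mathrm{perm}}(\lambda)$, in the right $Q_r$-module $Q_r/Q_r^{\rhd\lambda}$. For permissible $s,t$ put $\bar F_t=\phi(\pi(F_t))$,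 $\bar F^\lambda_{st}=\phi(\pi(F^\lambda_{st}))$ and $\bar f^\lambda_t=\phi(m_\lambda d_t\,\pi(F_t))+Q_r^{\rhd\lambda}$. **Theorem.** Let $\lambda,\mu$ be permissible points of $\widehat A_r$, $s,t\in\mathrm{Std}_{r,\mathrm{perm}}(\lambda)$, $u,v\in\mathrm{Std}_{r,\mathrm{perm}}(\mu)$. Then $F^\lambda_{st}$ and $\langle f^\lambda_s,f^\lambda_t\rangle$ are evaluable, and: 1. The $\bar F_t$ ($t$ permissible) are the Gelfand–Zeitlin idempotents of the tower $(Q_r)$. Precisely: for each permissible $\lambda\in\widehat A_r$ there is a unique minimal central idempotent $\bar z_r^\lambda$ of $Q_r$ acting as the identity on $\Delta_{Q_r}(\lambda)$; $\lambda\mapsto\bar z^\lambda_r$ is a bijection from $\widehat A_{r,\mathrm{perm}}$ to the minimal central idempotents of $Q_r$; for permissible $\lambda\in\widehat A_r$, $\nu\in\widehat A_{r+1}$ one has $\lambda\to\nu$ if and only if $\bar z_r^\lambda\bar z_{r+1}^\nu\ne0$; and $\bar F_t=\prod_{0\le j\le r}\bar z_j^{t(j)}$ for every permissible path $t$ of length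 $r$. 2. $\bar f^\lambda_t\bar F^\mu_{uv}=\delta_{\lambda\mu}\delta_{tu}\,\pi(\langle f^\lambda_t,f^\lambda_t\rangle)\bar f^\lambda_v$ and $\bar F^\lambda_{st}\bar F^\mu_{uv}=\delta_{\lambda\mu}\delta_{tu}\,\pi(\langle f^\lambda_t,f^\lambda_t\rangle)\bar F^\lambda_{sv}$. 3. $\pi(\langle f^\lambda_t,f^\lambda_s\rangle)\neq0$ if and only if $t=s$. 4. $\pi(\langle f^\lambda_t,f^\lambda_t\rangle)^{-1}\bar F^\lambda_{tt}=\bar F_t$. 5. The elements $\bar E^\lambda_{st}=\pi(\langle f^\lambda_s,f^\lambda_s\rangle)^{-1}\bar F^\lambda_{st}$, for all permissible $\lambda\in\widehat A_r$ and $s,t\in\mathrm{Std}_{r,\mathrm{perm}}(\lambda)$, are a complete family of matrix units of $Q_r$: they are a $\mathbb K$-basis of $Q_r$, $\bar E^\lambda_{st}\bar E^\mu_{uv}=\delta_{\lambda\mu}\delta_{tu}\bar E^\lambda_{sv}$, $\sum_{\lambda,s}\bar E^\lambda_{ss}=1$, and $\bar E^\lambda_{ss}=\bar F_s$. 6. $\{\bar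 f^\lambda_t : t\in\mathrm{Std}_{r,\mathrm{perm}}(\lambda)\}$ is a $\mathbb K$-basis of $\Delta_{Q_r}(\lambda)$. If $a\in A_r$ has matrix coefficients $a(s,t)\in\mathbb F$, i.e. $f^\lambda_ta=\sum_{s\in\mathrm{Std}_r(\lambda)}a(s,t)f^\lambda_s$ for all $t\in\mathrm{Std}_r(\lambda)$, then $a(s,t)$ is evaluable for permissible $s,t$, and for $t$ permissible $\bar f^\lambda_t\,\phi(\pi(a))=\sum_{s\in\mathrm{Std}_{r,\mathrm{perm}}(\lambda)}\pi(a(s,t))\,\bar f^\lambda_s$. -/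

import Mathlib

open scoped TensorProduct

universe u v w u₁ u₂ u₃ u₄

/-! ### Cellular algebras -/

/-- A cell datum for the unital `R`-algebra `A`. The strict order `l < m` on `Λ` is the relation
`m ▷ l`; the index sets `Tab l` are the finite sets usually called `Std(l)`. -/
structure CellDatum (R : Type u) (A : Type v) [CommRing R] [Ring A] [Algebra R A] where
  /-- the involution `*` -/
  inv : A →ₗ[R] A
  inv_mul : ∀ x y, inv (x * y) = inv y * inv x
  inv_inv : ∀ x, inv (inv x) = x
  /-- the finite poset -/
  Λ : Type w
  [finΛ : Fintype Λ]
  [ordΛ : PartialOrder Λ]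
  Tab : Λ → Type w
  [finTab : ∀ l, Fintype (Tab l)]
  [nonemptyTab : ∀ l, Nonempty (Tab l)]
  /-- the cellular basis `c^l_{st}` -/
  basis : Module.Basis (Σ l : Λ, Tab l × Tab l) R A
  /-- `c^l_{st} a ≡ ∑ᵥ r(a; t, v) c^l_{sv}` modulo `A^{▷ l}`, with coefficients independent of `s` -/
  mul_cell : ∀ (l : Λ) (t : Tab l) (a : A), ∃ r : Tab l → R, ∀ s : Tab l,
    basis ⟨l, s, t⟩ * a - ∑ v, r v • basis ⟨l, s, v⟩ ∈
      Submodule.span R {x | ∃ (m : Λ) (p q : Tab m), l < m ∧ x = basis ⟨m, p, q⟩}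
  /-- `(c^l_{st})^* ≡ c^l_{ts}` modulo `A^{▷ l}` -/
  inv_cell : ∀ (l : Λ) (s t : Tab l), inv (basis ⟨l, s, t⟩) - basis ⟨l, t, s⟩ ∈
      Submodule.span R {x | ∃ (m : Λ) (p q : Tab m), l < m ∧ x = basis ⟨m, p, q⟩}

namespace CellDatum

attribute [instance] CellDatum.finΛ CellDatum.ordΛ CellDatum.finTab CellDatum.nonemptyTab

section

variable {R : Type u} {A : Type v} [CommRing R] [Ring A] [Algebra R A]
  (C : CellDatum.{u, v, w} R A)

/-- `A^{▷ l}`, the span of the `c^m_{pq}` with `m ▷ l`. -/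
def above (l : C.Λ) : Submodule R A :=
  Submodule.span R {x | ∃ (m : C.Λ) (p q : C.Tab m), l < m ∧ x = C.basis ⟨m, p, q⟩}

theorem above_mono {l m : C.Λ} (h : l < m) : C.above m ≤ C.above l := by
  refine Submodule.span_mono ?_
  rintro x ⟨k, p, q, hk, rfl⟩
  exact ⟨k, p, q, h.trans hk, rfl⟩

/-- `A^{▷ l}` is a right ideal. -/
theorem above_mul_mem {l : C.Λ} {x : A} (hx : x ∈ C.above l) (a : A) : x * a ∈ C.above l := by
  induction hx using Submodule.span_induction with
  | mem x hx =>
    obtain ⟨m, p, q, hm, rfl⟩ := hx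
    obtain ⟨r, hr⟩ := C.mul_cell m q a
    have h1 := C.above_mono hm (hr p)
    have h2 : ∑ v, r v • C.basis ⟨m, p, v⟩ ∈ C.above l :=
      Submodule.sum_mem _ fun v _ =>
        Submodule.smul_mem _ _ (Submodule.subset_span ⟨m, p, v, hm, rfl⟩)
    have h3 := Submodule.add_mem _ h1 h2
    rwa [sub_add_cancel] at h3
  | zero => rw [zero_mul]; exact Submodule.zero_mem _
  | add x y _ _ h1 h2 => rw [add_mul]; exact Submodule.add_mem _ h1 h2
  | smul b x _ h => rw [smul_mul_assoc]; exact Submodule.smul_mem _ _ h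

/-- The (unique) coefficients `r(a; t, v)`. -/
noncomputable def coeff {l : C.Λ} (a : A) (t v : C.Tab l) : R := (C.mul_cell l t a).choose v

/-- The cell module `Δ(l)`, free with basis `(c^l_t)` indexed by `Tab l`. -/
abbrev Cell (l : C.Λ) : Type (max u w) := C.Tab l → R

/-- The right action of `A` on the cell module: `c_t a = ∑ᵥ r(a; t, v) cᵥ`. -/
noncomputable def act {l : C.Λ} (x : C.Cell l) (a : A) : C.Cell l :=
  fun v => ∑ t, x t * C.coeff a t v

/-- The representative `∑ y_s z_t c_{st}` of `α_l⁻¹(y^* ⊗ z)`, where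
`α_l : A^{⊵ l} / A^{▷ l} → Δ(l)^* ⊗ Δ(l)` is the bimodule isomorphism
`c_{st} + A^{▷ l} ↦ c_s^* ⊗ c_t`. -/
noncomputable def alphaInv {l : C.Λ} (y z : C.Cell l) : A :=
  ∑ s, ∑ t, (y s * z t) • C.basis ⟨l, s, t⟩

/-- The bilinear form on the cell module: the unique scalar `⟨x, y⟩` such that
`x α_l⁻¹(y^* ⊗ z) = ⟨x, y⟩ z` for all `z`. -/
noncomputable def form {l : C.Λ} (x y : C.Cell l) : R :=
  Classical.epsilon fun b : R => ∀ z : C.Cell l, C.act x (C.alphaInv y z) = b • z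

end

section

variable {R : Type u} {A : Type v} [CommRing R] [Ring A] [Algebra R A]

theorem tmul_mem_span (C : CellDatum.{u, v, w} R A) (B : Type u₁) [CommRing B] [Algebra R B]
    (l : C.Λ) (b : B) {x : A} (hx : x ∈ C.above l) :
    b ⊗ₜ[R] x ∈ Submodule.span B {x | ∃ (m : C.Λ) (p q : C.Tab m), l < m ∧
      x = (Algebra.TensorProduct.basis B C.basis) ⟨m, p, q⟩} := by
  induction hx using Submodule.span_induction with
  | mem x hx =>
    obtain ⟨m, p, q, hm, rfl⟩ := hx
    have h : b ⊗ₜ[R] C.basis ⟨m, p, q⟩ =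
        b • (Algebra.TensorProduct.basis B C.basis) ⟨m, p, q⟩ := by
      rw [Algebra.TensorProduct.basis_apply, TensorProduct.smul_tmul', smul_eq_mul, mul_one]
    rw [h]
    exact Submodule.smul_mem _ _ (Submodule.subset_span ⟨m, p, q, hm, rfl⟩)
  | zero => rw [TensorProduct.tmul_zero]; exact Submodule.zero_mem _
  | add x y _ _ h1 h2 => rw [TensorProduct.tmul_add]; exact Submodule.add_mem _ h1 h2
  | smul r x _ h =>
    rw [TensorProduct.tmul_smul, ← algebraMap_smul B r]
    exact Submodule.smul_mem _ _ h

/-- The cell datum of the specialization `A^B = B ⊗ A`, with cellular basis `1 ⊗ c^l_{st}`. -/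
noncomputable abbrev baseChange (C : CellDatum.{u, v, w} R A) (B : Type u₁) [CommRing B]
    [Algebra R B] : CellDatum.{u₁, max u₁ v, w} B (B ⊗[R] A) where
  inv := C.inv.baseChange B
  inv_mul := by
    intro x y
    induction x using TensorProduct.induction_on with
    | zero => simp
    | add x x' h h' => rw [add_mul, map_add, h, h', map_add, mul_add]
    | tmul b a =>
      induction y using TensorProduct.induction_on with
      | zero => simp
      | add y y' h h' => rw [mul_add, map_add, h, h', map_add, add_mul]
      | tmul b' a' => simp [C.inv_mul, mul_comm]
  inv_inv := by
    intro x
    induction x using TensorProduct.induction_on with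
    | zero => simp
    | add x x' h h' => rw [map_add, map_add, h, h']
    | tmul b a => simp [C.inv_inv]
  Λ := C.Λ
  Tab := C.Tab
  basis := Algebra.TensorProduct.basis B C.basis
  mul_cell := by
    intro l t a
    induction a using TensorProduct.induction_on with
    | zero => exact ⟨0, fun s => by simp⟩
    | add x y h h' =>
      obtain ⟨r, hr⟩ := h
      obtain ⟨r', hr'⟩ := h'
      refine ⟨r + r', fun s => ?_⟩
      have := Submodule.add_mem _ (hr s) (hr' s)
      convert this using 1
      simp only [Pi.add_apply, add_smul, Finset.sum_add_distrib, mul_add]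
      abel
    | tmul b a =>
      obtain ⟨r, hr⟩ := C.mul_cell l t a
      refine ⟨fun v => b * algebraMap R B (r v), fun s => ?_⟩
      convert C.tmul_mem_span B l b (hr s) using 1
      simp only [Algebra.TensorProduct.basis_apply, Algebra.TensorProduct.tmul_mul_tmul, one_mul,
        TensorProduct.tmul_sub, TensorProduct.tmul_sum, TensorProduct.smul_tmul', smul_eq_mul,
        mul_one, TensorProduct.tmul_smul]
      simp [Algebra.smul_def, mul_comm]
  inv_cell := by
    intro l s t
    convert C.tmul_mem_span B l 1 (C.inv_cell l s t) using 1
    simp [TensorProduct.tmul_sub]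

end

end CellDatum

/-! ### Semisimplicity and central idempotents -/

/-- A split semisimple algebra: a finite product of matrix algebras over the ground field. -/
def IsSplitSemisimple (k : Type u) (A : Type v) [Field k] [Ring A] [Algebra k A] : Prop :=
  ∃ (n : ℕ) (d : Fin n → ℕ), (∀ i, d i ≠ 0) ∧
    Nonempty (A ≃ₐ[k] (∀ i, Matrix (Fin (d i)) (Fin (d i)) k))

/-- A minimal central idempotent of a ring. -/
def IsMinimalCentralIdempotent {A : Type v} [Ring A] (e : A) : Prop :=
  e ∈ Set.center A ∧ e * e = e ∧ e ≠ 0 ∧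
    ∀ e' : A, e' ∈ Set.center A → e' * e' = e' → e' * e = e' → e' = 0 ∨ e' = e

/-- The ordered product `z_{t(0)} z_{t(1)} ⋯ z_{t(r)}` in the `r`-th ring of a tower. -/
def towerProd {Λ : ℕ → Type u} {B : ℕ → Type v} [∀ r, Ring (B r)] (ι : ∀ r, B r →+* B (r + 1))
    (z : ∀ r, Λ r → B r) : ∀ r : ℕ, (∀ k : Fin (r + 1), Λ k) → B r
  | 0, t => z 0 (t 0)
  | r + 1, t => ι r (towerProd ι z r fun k => t k.castSucc) * z (r + 1) (t (Fin.last (r + 1)))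

/-! ### Cell filtrations -/

/-- An order preserving cell filtration `0 = N 0 ⊆ N 1 ⊆ ⋯ ⊆ N n = Δ_B(m)` of the restriction to
`A` of the cell module `Δ_B(m)`, along the unital homomorphism `ι : A → B`. The isomorphism of right
`A`-modules `N (i+1) / N i ≅ Δ_A(label i)` is given as a surjection `N (i+1) → Δ_A(label i)` of right
`A`-modules with kernel `N i`. -/
structure CellFiltration {R : Type u} {A B : Type v} [CommRing R] [Ring A] [Algebra R A] [Ring B]
    [Algebra R B] (CA : CellDatum.{u, v, w} R A) (CB : CellDatum.{u, v, w} R B) (ι : A →ₐ[R] B)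
    (m : CB.Λ) where
  n : ℕ
  N : Fin (n + 1) → Submodule R (CB.Cell m)
  N_zero : N 0 = ⊥
  N_last : N (Fin.last n) = ⊤
  N_le : ∀ i : Fin n, N i.castSucc ≤ N i.succ
  N_act : ∀ (i : Fin (n + 1)) (x : CB.Cell m) (a : A), x ∈ N i → CB.act x (ι a) ∈ N i
  label : Fin n → CA.Λ
  label_anti : StrictAnti label
  proj : ∀ i : Fin n, N i.succ →ₗ[R] CA.Cell (label i)
  proj_surjective : ∀ i, Function.Surjective (proj i)
  proj_eq_zero : ∀ (i : Fin n) (x : N i.succ), proj i x = 0 ↔ (x : CB.Cell m) ∈ N i.castSucc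
  proj_act : ∀ (i : Fin n) (x : N i.succ) (a : A),
    proj i ⟨CB.act x (ι a), N_act i.succ x a x.2⟩ = CA.act (proj i x) a

/-! ### Sequences of diagram algebras -/

/-- A sequence of diagram algebras `(A_r)_{r ≥ 0}` over the integral domain `R` with field of
fractions `F`. -/
structure DiagramTower (R : Type u) (F : Type u₁) [CommRing R] [IsDomain R] [Field F] [Algebra R F]
    [IsFractionRing R F] where
  A : ℕ → Type v
  [ring : ∀ r, Ring (A r)]
  [algebra : ∀ r, Algebra R (A r)]
  ι : ∀ r, A r →ₐ[R] A (r + 1)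
  ι_injective : ∀ r, Function.Injective (ι r)
  C : ∀ r, CellDatum.{u, v, w} R (A r)
  /-- the involutions are consistent -/
  ι_inv : ∀ r a, ι r ((C r).inv a) = (C (r + 1)).inv (ι r a)
  /-- `A_0 = R` -/
  zero_bijective : Function.Bijective (algebraMap R (A 0))
  /-- a generator of each cell module; the algebras are cyclic cellular -/
  δ : ∀ r (l : (C r).Λ), (C r).Cell l
  δ_generates : ∀ r l (x : (C r).Cell l), ∃ a, (C r).act (δ r l) a = x
  /-- the cell generators `m_l`, lifts of `α_l⁻¹(δ^* ⊗ δ)` -/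
  M : ∀ r, (C r).Λ → A r
  M_lift : ∀ r l, M r l - (C r).alphaInv (δ r l) (δ r l) ∈ (C r).above l
  M_inv : ∀ r l, (C r).inv (M r l) = M r l
  M_zero : ∀ l, M 0 l = 1
  /-- generic split semisimplicity -/
  semisimple : ∀ r, IsSplitSemisimple F (F ⊗[R] A r)
  /-- restriction coherence -/
  filtration : ∀ r (m : (C (r + 1)).Λ), CellFiltration (C r) (C (r + 1)) (ι r) m
  /-- down-branching factors `d_{l → m}` (values off the edges of the branching diagram are
  irrelevant): `δ(m) d_{l → m}` lies in the layer of the filtration belonging to `l` and represents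
  the generator `δ(l)` there -/
  d : ∀ r, (C r).Λ → (C (r + 1)).Λ → A (r + 1)
  d_spec : ∀ r m (i : Fin (filtration r m).n),
    ∃ h : (C (r + 1)).act (δ (r + 1) m) (d r ((filtration r m).label i) m) ∈
        (filtration r m).N i.succ,
      (filtration r m).proj i ⟨_, h⟩ = δ r ((filtration r m).label i)
  /-- up-branching factors `u_{l → m}` with `m_m d_{l → m} = (u_{l → m})^* m_l` on the edges -/
  u : ∀ r, (C r).Λ → (C (r + 1)).Λ → A (r + 1)
  u_compat : ∀ r m (i : Fin (filtration r m).n),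
    M (r + 1) m * d r ((filtration r m).label i) m =
      (C (r + 1)).inv (u r ((filtration r m).label i) m) * ι r (M r ((filtration r m).label i))

namespace DiagramTower

attribute [instance] DiagramTower.ring DiagramTower.algebra

variable {R : Type u} {F : Type u₁} [CommRing R] [IsDomain R] [Field F] [Algebra R F]
  [IsFractionRing R F] (T : DiagramTower.{u, v, w, u₁} R F)

/-- The vertices of the branching diagram at level `r`. -/
abbrev Λ (r : ℕ) : Type w := (T.C r).Λ

/-- The edges `l → m` of the branching diagram. -/
def Edge (r : ℕ) (l : T.Λ r) (m : T.Λ (r + 1)) : Prop := ∃ i, (T.filtration r m).label i = l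

/-- `Std_r`: the paths `t(0) → t(1) → ⋯ → t(r)` on the branching diagram. -/
def Path (r : ℕ) : Type w :=
  {t : ∀ k : Fin (r + 1), T.Λ k // ∀ k : Fin r, T.Edge k (t k.castSucc) (t k.succ)}

/-- `Std_r(l)`: the paths of shape `l`, that is, ending in `l` at level `r`. -/
def Std (r : ℕ) (l : T.Λ r) : Type w := {t : T.Path r // t.1 (Fin.last r) = l}

noncomputable instance (r : ℕ) : Fintype (T.Path r) := by
  classical
  unfold Path
  exact Fintype.ofFinite _

noncomputable instance (r : ℕ) (l : T.Λ r) : Fintype (T.Std r l) := by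
  classical
  unfold Std
  exact Fintype.ofFinite _

/-- `d_t = d_{t(r-1) → t(r)} d_{t(r-2) → t(r-1)} ⋯ d_{t(0) → t(1)}`. -/
def dSeq : ∀ r : ℕ, (∀ k : Fin (r + 1), T.Λ k) → T.A r
  | 0, _ => 1
  | r + 1, t => T.d r (t (Fin.last r).castSucc) (t (Fin.last (r + 1))) *
      T.ι r (dSeq r fun k => t k.castSucc)

/-- `d_t` for a path `t` of shape `l`. -/
def dPath {r : ℕ} {l : T.Λ r} (t : T.Std r l) : T.A r := T.dSeq r t.1.1

/-- The Murphy basis element `m^l_{st} = d_s^* m_l d_t` of `A_r`. -/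
def murphy {r : ℕ} {l : T.Λ r} (s t : T.Std r l) : T.A r :=
  (T.C r).inv (T.dPath s) * T.M r l * T.dPath t

/-- The Murphy basis element `m^l_t = δ(l) d_t` of the cell module `Δ_r(l)`. It corresponds to
`m_l d_t + A_r^{▷ l}` under the identification of `Δ_r(l)` with
`(m_l A_r + A_r^{▷ l}) / A_r^{▷ l}`, `δ(l) a ↔ m_l a + A_r^{▷ l}`. -/
noncomputable def murphyCell {r : ℕ} {l : T.Λ r} (t : T.Std r l) : (T.C r).Cell l :=
  (T.C r).act (T.δ r l) (T.dPath t)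

/-- The cell datum of `A_r^F`. -/
noncomputable abbrev CF (r : ℕ) : CellDatum F (F ⊗[R] T.A r) := (T.C r).baseChange F

/-- The inclusion `A_r^B → A_{r+1}^B` of specializations. -/
noncomputable abbrev ιBase (B : Type u₂) [CommRing B] [Algebra R B] (r : ℕ) :
    B ⊗[R] T.A r →ₐ[B] B ⊗[R] T.A (r + 1) :=
  Algebra.TensorProduct.map (AlgHom.id B B) (T.ι r)

/-- The minimal central idempotent of `A_r^F` labelled by `l`: the one acting as the identity on the
simple module `Δ_r^F(l)`. -/
noncomputable def z (r : ℕ) (l : T.Λ r) : F ⊗[R] T.A r :=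
  Classical.epsilon fun e : F ⊗[R] T.A r =>
    IsMinimalCentralIdempotent e ∧ ∀ x : (T.CF r).Cell l, (T.CF r).act x e = x

/-- The Gelfand-Zeitlin idempotent `F_t` of `A_r^F`. -/
noncomputable def gz {r : ℕ} {l : T.Λ r} (t : T.Std r l) : F ⊗[R] T.A r :=
  towerProd (fun r => (T.ιBase F r).toRingHom) T.z r t.1.1

/-- `F^l_{st} = F_s m^l_{st} F_t` in `A_r^F`. -/
noncomputable def gzUnit {r : ℕ} {l : T.Λ r} (s t : T.Std r l) : F ⊗[R] T.A r :=
  T.gz s * (1 ⊗ₜ[R] T.murphy s t) * T.gz t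

/-- The seminormal basis element `f^l_t = m^l_t F_t` of `Δ_r^F(l)`. -/
noncomputable def seminormal {r : ℕ} {l : T.Λ r} (t : T.Std r l) : (T.CF r).Cell l :=
  (T.CF r).act (l := l) (fun v => algebraMap R F (T.murphyCell t v)) (T.gz t)

/-! ### Jucys-Murphy elements -/

/-- `L_1 + ⋯ + L_r`, where `L i` stands for `L_{i+1} ∈ A_{i+1}`. -/
def sumJM (L : ∀ r, T.A (r + 1)) : ∀ r : ℕ, T.A r
  | 0 => 0
  | r + 1 => T.ι r (sumJM L r) + L r

/-- `L_1 ⋯ L_r`, where `L i` stands for `L_{i+1} ∈ A_{i+1}`. -/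
def prodJM (L : ∀ r, T.A (r + 1)) : ∀ r : ℕ, T.A r
  | 0 => 1
  | r + 1 => T.ι r (prodJM L r) * L r

/-- The tower has additive Jucys-Murphy elements, with `L_1 + ⋯ + L_r` acting as `d(l)` on
`Δ_r(l)`, whose contents `d(m) - d(l)` (along edges `l → m`) separate the paths of each length. -/
def HasSeparatingAdditiveJM : Prop :=
  ∃ (L : ∀ r, T.A (r + 1)) (d : ∀ r, T.Λ r → R),
    (∀ r, (T.C (r + 1)).inv (L r) = L r) ∧
    (∀ r (a : T.A r), L r * T.ι r a = T.ι r a * L r) ∧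
    (∀ r l (x : (T.C r).Cell l), (T.C r).act x (T.sumJM L r) = d r l • x) ∧
    (∀ r (s t : T.Path r), s ≠ t → ∃ i : Fin r,
      d (i + 1) (s.1 i.succ) - d i (s.1 i.castSucc) ≠ d (i + 1) (t.1 i.succ) - d i (t.1 i.castSucc))

/-- The tower has multiplicative Jucys-Murphy elements, with `L_1 ⋯ L_r` acting as `d(l)` on
`Δ_r(l)`, whose contents `d(m) d(l)⁻¹` (along edges `l → m`) separate the paths of each length.
Usually the `L_i` are invertible, so that the `d(l)` are units; only `d(l) ≠ 0` is required here. -/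
def HasSeparatingMultiplicativeJM : Prop :=
  ∃ (L : ∀ r, T.A (r + 1)) (d : ∀ r, T.Λ r → R),
    (∀ r, (T.C (r + 1)).inv (L r) = L r) ∧
    (∀ r (a : T.A r), L r * T.ι r a = T.ι r a * L r) ∧
    (∀ r l (x : (T.C r).Cell l), (T.C r).act x (T.prodJM L r) = d r l • x) ∧
    (∀ r l, d r l ≠ 0) ∧
    (∀ r (s t : T.Path r), s ≠ t → ∃ i : Fin r,
      algebraMap R F (d (i + 1) (s.1 i.succ)) / algebraMap R F (d i (s.1 i.castSucc)) ≠
        algebraMap R F (d (i + 1) (t.1 i.succ)) / algebraMap R F (d i (t.1 i.castSucc)))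

end DiagramTower

/-! ### Evaluable elements -/

section Evaluable

variable (R : Type u) (F : Type u₁) (S : Type u₂) (K : Type u₃) [CommRing R] [IsDomain R] [Field F]
  [Algebra R F] [IsFractionRing R F] [CommRing S] [IsDomain S] [Algebra R S] [Field K] [Algebra S K]
  [IsFractionRing S K] [Algebra R K] [IsScalarTower R S K]

/-- The kernel `𝔭` of the structure map `π : R → S`. -/
abbrev kerPrime : Ideal R := RingHom.ker (algebraMap R S)

instance : (kerPrime R S).IsPrime := RingHom.ker_isPrime _

/-- The localization `R_𝔭`. -/
abbrev LocalR : Type u := Localization.AtPrime (kerPrime R S)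

/-- The embedding of `R_𝔭` in `F`. -/
noncomputable def localToFrac : LocalR R S →ₐ[R] F :=
  IsLocalization.liftAlgHom (M := (kerPrime R S).primeCompl) (f := Algebra.ofId R F) (by
    intro y
    refine IsUnit.mk0 _ fun h => y.2 ?_
    have h0 : (y : R) = 0 := (IsFractionRing.injective R F) (by simpa using h)
    rw [h0]
    exact Ideal.zero_mem _)

/-- The evaluation `π : R_𝔭 → K` extending `R → S ⊆ K`. -/
noncomputable def localToResidue : LocalR R S →ₐ[R] K :=
  IsLocalization.liftAlgHom (M := (kerPrime R S).primeCompl) (f := Algebra.ofId R K) (by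
    intro y
    refine IsUnit.mk0 _ fun h => y.2 ?_
    have h1 : algebraMap R K (y : R) = 0 := h
    rw [IsScalarTower.algebraMap_apply R S K] at h1
    exact (IsFractionRing.injective S K) (by simpa using h1))

/-- An element of `F` is evaluable if it lies in `R_𝔭`. -/
def EvaluableScalar (x : F) : Prop := ∃ y : LocalR R S, localToFrac R F S y = x

open Classical in
/-- The evaluation `π(x) ∈ K` of an evaluable scalar `x` (and `0` if `x` is not evaluable). -/
noncomputable def evalScalar (x : F) : K :=
  if h : EvaluableScalar R F S x then localToResidue R S K h.choose else 0

variable (A : Type v) [Ring A] [Algebra R A]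

/-- An element of `A^F` is evaluable if it comes from `A^{R_𝔭}`. -/
def Evaluable (x : F ⊗[R] A) : Prop :=
  ∃ y : LocalR R S ⊗[R] A,
    Algebra.TensorProduct.map (localToFrac R F S) (AlgHom.id R A) y = x

open Classical in
/-- The evaluation `π(x) ∈ A^K` of an evaluable element `x` of `A^F` (and `0` if `x` is not
evaluable). -/
noncomputable def evalAlg (x : F ⊗[R] A) : K ⊗[R] A :=
  if h : Evaluable R F S A x then
    Algebra.TensorProduct.map (localToResidue R S K) (AlgHom.id R A) h.choose
  else 0

end Evaluable

/-! ### Quotient towers -/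

/-- A quotient tower of the tower `T` of diagram algebras along `R → S ⊆ K`: surjective
homomorphisms `φ_r` from `A_r^K` onto an increasing sequence of `K`-algebras `Q_r`, compatible with
the inclusions, with a notion of permissible points satisfying the three axioms. -/
structure QuotientTower {R : Type u} {F : Type u₁} [CommRing R] [IsDomain R] [Field F] [Algebra R F]
    [IsFractionRing R F] (T : DiagramTower.{u, v, w, u₁} R F) (S : Type u₂) (K : Type u₃)
    [CommRing S] [IsDomain S] [Algebra R S] [Field K] [Algebra S K] [IsFractionRing S K]
    [Algebra R K] [IsScalarTower R S K] where
  Q : ℕ → Type u₄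
  [ring : ∀ r, Ring (Q r)]
  [algebra : ∀ r, Algebra K (Q r)]
  ι : ∀ r, Q r →ₐ[K] Q (r + 1)
  ι_injective : ∀ r, Function.Injective (ι r)
  φ : ∀ r, K ⊗[R] T.A r →ₐ[K] Q r
  φ_surjective : ∀ r, Function.Surjective (φ r)
  φ_ι : ∀ r a, φ (r + 1) (T.ιBase K r a) = ι r (φ r a)
  /-- the permissible points -/
  perm : ∀ r, Set (T.Λ r)
  perm_zero : ∀ l : T.Λ 0, l ∈ perm 0
  perm_succ : ∀ r, ∀ l ∈ perm r, ∃ m ∈ perm (r + 1), T.Edge r l m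
  perm_pred : ∀ r, ∀ m ∈ perm (r + 1), ∃ l ∈ perm r, T.Edge r l m
  /-- for every `m` that is the first non-permissible point on some path, there are
  `b, b' ∈ A_k^S` with `m_m = b - b'`, `b ∈ ker φ` and `b' ∈ m_m A_k^K ∩ (A_k^S)^{▷ m}` -/
  marginal : ∀ k (m : T.Λ k), m ∉ perm k →
    (∃ t : T.Std k m, ∀ j : Fin (k + 1), j ≠ Fin.last k → t.1.1 j ∈ perm j) →
    ∃ b b' : S ⊗[R] T.A k,
      1 ⊗ₜ[R] T.M k m = b - b' ∧
      φ k (Algebra.TensorProduct.map (IsScalarTower.toAlgHom R S K) (AlgHom.id R (T.A k)) b) = 0 ∧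
      b' ∈ ((T.C k).baseChange S).above m ∧
      ∃ x : K ⊗[R] T.A k,
        Algebra.TensorProduct.map (IsScalarTower.toAlgHom R S K) (AlgHom.id R (T.A k)) b' =
          (1 ⊗ₜ[R] T.M k m) * x
  /-- `dim Q_r^{K̄} = ∑ (♯ Std_{r, perm}(l))²`, the sum over permissible `l`, where `K̄` is the
  algebraic closure of `K` -/
  dim_eq : ∀ r, Module.finrank (AlgebraicClosure K) (AlgebraicClosure K ⊗[K] Q r) =
    ∑ᶠ l ∈ perm r, Nat.card {t : T.Std r l // ∀ k : Fin (r + 1), t.1.1 k ∈ perm k} ^ 2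

namespace QuotientTower

attribute [instance] QuotientTower.ring QuotientTower.algebra

variable {R : Type u} {F : Type u₁} [CommRing R] [IsDomain R] [Field F] [Algebra R F]
  [IsFractionRing R F] {T : DiagramTower.{u, v, w, u₁} R F} {S : Type u₂} {K : Type u₃}
  [CommRing S] [IsDomain S] [Algebra R S] [Field K] [Algebra S K] [IsFractionRing S K]
  [Algebra R K] [IsScalarTower R S K] (X : QuotientTower.{u, v, w, u₁, u₂, u₃, u₄} T S K)

/-- `Std_{r, perm}(l)`: the permissible paths of shape `l`. -/
def PermStd (r : ℕ) (l : T.Λ r) : Type w := {t : T.Std r l // ∀ k : Fin (r + 1), t.1.1 k ∈ X.perm k}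

noncomputable instance (r : ℕ) (l : T.Λ r) : Fintype (X.PermStd r l) := by
  classical
  unfold PermStd
  exact Fintype.ofFinite _

/-- `F̄_t = φ(π(F_t))`. -/
noncomputable def gzBar {r : ℕ} {l : T.Λ r} (t : X.PermStd r l) : X.Q r :=
  X.φ r (evalAlg R F S K (T.A r) (T.gz t.1))

/-- `F̄^l_{st} = φ(π(F^l_{st}))`. -/
noncomputable def gzUnitBar {r : ℕ} {l : T.Λ r} (s t : X.PermStd r l) : X.Q r :=
  X.φ r (evalAlg R F S K (T.A r) (T.gzUnit s.1 t.1))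

/-- `Q_r^{▷ l} = φ((A_r^K)^{▷ l})`, as a right ideal of `Q_r`. -/
def above (r : ℕ) (l : T.Λ r) : Submodule (X.Q r)ᵐᵒᵖ (X.Q r) where
  carrier := X.φ r '' (((T.C r).baseChange K).above l : Set (K ⊗[R] T.A r))
  zero_mem' := ⟨0, Submodule.zero_mem _, map_zero _⟩
  add_mem' := by
    rintro _ _ ⟨x, hx, rfl⟩ ⟨y, hy, rfl⟩
    exact ⟨x + y, Submodule.add_mem _ hx hy, map_add _ _ _⟩
  smul_mem' := by
    rintro c _ ⟨x, hx, rfl⟩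
    obtain ⟨a, ha⟩ := X.φ_surjective r c.unop
    refine ⟨x * a, CellDatum.above_mul_mem _ hx a, ?_⟩
    rw [map_mul, ha, ← MulOpposite.smul_eq_mul_unop]

/-- The class in the right `Q_r`-module `Q_r / Q_r^{▷ l}`. -/
def toQuot {r : ℕ} (l : T.Λ r) (x : X.Q r) : X.Q r ⧸ X.above r l := Submodule.Quotient.mk x

/-- The cell module `Δ_{Q_r}(l)` of `Q_r`, the span in the right `Q_r`-module `Q_r / Q_r^{▷ l}` of
the classes of `φ(m_l d_t)` for `t` a permissible path of shape `l`. -/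
def cellQ (r : ℕ) (l : T.Λ r) : Submodule K (X.Q r ⧸ X.above r l) :=
  Submodule.span K (Set.range fun t : X.PermStd r l =>
    X.toQuot l (X.φ r (1 ⊗ₜ[R] (T.M r l * T.dPath t.1))))

/-- `f̄^l_t`, the class of `φ(m_l d_t π(F_t))`: the image of `m^l_t π(F_t)` under the map of cell
modules `Δ_{A_r}^K(l) → Δ_{Q_r}(l)` induced by `φ`. -/
noncomputable def seminormalBar {r : ℕ} {l : T.Λ r} (t : X.PermStd r l) : X.Q r ⧸ X.above r l :=
  X.toQuot l (X.φ r ((1 ⊗ₜ[R] (T.M r l * T.dPath t.1)) * evalAlg R F S K (T.A r) (T.gz t.1)))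

/-- The minimal central idempotent of `Q_r` labelled by the permissible point `l`: the one acting as
the identity on the simple module `Δ_{Q_r}(l)`. -/
noncomputable def z (r : ℕ) (l : T.Λ r) : X.Q r :=
  Classical.epsilon fun e : X.Q r =>
    IsMinimalCentralIdempotent e ∧ ∀ x ∈ X.cellQ r l, MulOpposite.op e • x = x

/-- The Gelfand-Zeitlin idempotent of the tower `(Q_r)` attached to a permissible path. -/
noncomputable def gzQ {r : ℕ} {l : T.Λ r} (t : X.PermStd r l) : X.Q r :=
  towerProd (fun r => (X.ι r).toRingHom) X.z r t.1.1.1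

/-- `π(⟨f^l_s, f^l_t⟩)`. -/
noncomputable def formBar {r : ℕ} {l : T.Λ r} (s t : X.PermStd r l) : K :=
  evalScalar R F S K ((T.CF r).form (l := l) (T.seminormal s.1) (T.seminormal t.1))

/-- `Ē^l_{st} = π(⟨f^l_s, f^l_s⟩)⁻¹ F̄^l_{st}`. -/
noncomputable def matrixUnit {r : ℕ} {l : T.Λ r} (s t : X.PermStd r l) : X.Q r :=
  (X.formBar s s)⁻¹ • X.gzUnitBar s t

end QuotientTower

/-! The argument transports seminormal theory from `F` to `K` by unitriangularity, and then lets a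
dimension count turn `Q_r` into a product of matrix algebras.

Over `F`, the coherent cell filtrations make the `m_t` a basis of each cell module, and `f_t = m_t
F_t` equals `m_t` plus a combination of the `m_s` with `s` preceding `t`
(`seminormal_sub_mem_higher`). The `F_t` are orthogonal, `*`-invariant idempotents, and `F_t`
projects `Δ_r^F(l)` onto the line of `f_t`. Since the coefficient of `m_t` in `f_t` is 1, a scalar
in a relation `f_s a = c f_t` is a Murphy coordinate of `f_s a`. It is therefore evaluable whenever
`F_s` and `a` are. So relations between permissible seminormal vectors pass to `K`, and so does
unitriangularity.

For a non-permissible path, split `m_μ = b - b'` at its first non-permissible vertex `μ`. The term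
`b` dies under `φ`. Writing `b' = m_μ β`, membership in `A^{▷ μ}` forces `δ(μ) β = 0`. The relation
moves up along the path through the branching factors, because `m_m d_{l → m} = u^* m_l`, and
rewrites `φ(m_l d_t)` by preceding terms (`exists_reduction`). By well-founded induction the
permissible `f̄_t` span `Δ_{Q_r}(l)`, whose dimension is thus at most the number of permissible
paths to `l`.

A semisimple `Q_r` acts faithfully on its cell modules (`eq_zero_of_op_smul_eq_zero`): the
annihilator is generated by an idempotent that pushes every cell strictly upwards, hence vanishes.
As `dim Q_r` is the sum of the squares of the numbers of permissible paths, every inequality is an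
equality. The `f̄_t` are bases, and `Q_r` is the product of the full matrix algebras in these bases
(`exists_matrixEquiv`). The evaluated relations then say which matrices `F̄_t` and `F̄_{st}` are.

Two points remain. The norm of `f̄_t` is nonzero (`formBar_self_ne_zero`): a right identity of
`φ(A^{⊵ l})` keeps the evaluated vector out of the radical of the form, and the self-adjoint
projection `F_t` then rules out isotropy. The `F̄_t` are Gelfand-Zeitlin idempotents because `z̄_l`
is the sum of the `F̄_t` of shape `l`, while products of `F̄`'s at consecutive levels vanish unless
one path truncates to the other. -/

namespace CellDatum

/-! ### Cell ideals, cell representations and the bilinear form -/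

section Basics

variable {R : Type u} {A : Type v} [CommRing R] [Ring A] [Algebra R A]
  (C : CellDatum.{u, v, w} R A)

theorem repr_eq_zero_of_mem_above {l : C.Λ} {x : A} (hx : x ∈ C.above l) (s t : C.Tab l) :
    C.basis.repr x ⟨l, s, t⟩ = 0 := by
  classical
  induction hx using Submodule.span_induction with
  | mem x hx =>
    obtain ⟨m, p, q, hm, rfl⟩ := hx
    rw [Module.Basis.repr_self, Finsupp.single_apply, if_neg]
    intro h
    obtain rfl := (Sigma.mk.inj_iff.1 h).1
    exact lt_irrefl _ hm
  | zero => simp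
  | add x y _ _ h1 h2 => simp [h1, h2]
  | smul b x _ h => simp [h]

theorem basis_mem_above {l m : C.Λ} (h : l < m) (s t : C.Tab m) :
    C.basis ⟨m, s, t⟩ ∈ C.above l := Submodule.subset_span ⟨m, s, t, h, rfl⟩

theorem inv_mem_above {l : C.Λ} {x : A} (hx : x ∈ C.above l) : C.inv x ∈ C.above l := by
  induction hx using Submodule.span_induction with
  | mem x hx =>
    obtain ⟨m, p, q, hm, rfl⟩ := hx
    have h := Submodule.add_mem _ (C.above_mono hm (C.inv_cell m p q)) (C.basis_mem_above hm q p)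
    rwa [sub_add_cancel] at h
  | zero => simp
  | add x y _ _ h1 h2 => rw [map_add]; exact Submodule.add_mem _ h1 h2
  | smul b x _ h => rw [map_smul]; exact Submodule.smul_mem _ _ h

/-- The involution preserves `A^{▷ l}` and exchanges left and right multiplication, so the right
ideal is two-sided. -/
theorem mul_mem_above {l : C.Λ} {x : A} (a : A) (hx : x ∈ C.above l) : a * x ∈ C.above l := by
  have h := C.inv_mem_above (C.above_mul_mem (C.inv_mem_above hx) (C.inv a))
  rwa [C.inv_mul, C.inv_inv, C.inv_inv] at h

theorem mkQ_eq {l : C.Λ} {x y : A} :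
    (C.above l).mkQ x = (C.above l).mkQ y ↔ x - y ∈ C.above l := Submodule.Quotient.eq _

theorem mkQ_mul_right {l : C.Λ} {x y : A} (h : (C.above l).mkQ x = (C.above l).mkQ y) (a : A) :
    (C.above l).mkQ (x * a) = (C.above l).mkQ (y * a) := by
  rw [mkQ_eq] at h ⊢
  rw [← sub_mul]
  exact C.above_mul_mem h a

theorem mkQ_mul_left {l : C.Λ} {x y : A} (h : (C.above l).mkQ x = (C.above l).mkQ y) (a : A) :
    (C.above l).mkQ (a * x) = (C.above l).mkQ (a * y) := by
  rw [mkQ_eq] at h ⊢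
  rw [← mul_sub]
  exact C.mul_mem_above a h

theorem mkQ_inv {l : C.Λ} {x y : A} (h : (C.above l).mkQ x = (C.above l).mkQ y) :
    (C.above l).mkQ (C.inv x) = (C.above l).mkQ (C.inv y) := by
  rw [mkQ_eq] at h ⊢
  rw [← map_sub]
  exact C.inv_mem_above h

theorem mkQ_inv_basis {l : C.Λ} (s t : C.Tab l) :
    (C.above l).mkQ (C.inv (C.basis ⟨l, s, t⟩)) = (C.above l).mkQ (C.basis ⟨l, t, s⟩) :=
  C.mkQ_eq.2 (C.inv_cell l s t)

theorem mkQ_basis_mul {l : C.Λ} (s t : C.Tab l) (a : A) :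
    (C.above l).mkQ (C.basis ⟨l, s, t⟩ * a) =
      ∑ v, C.coeff a t v • (C.above l).mkQ (C.basis ⟨l, s, v⟩) := by
  have h := C.mkQ_eq.2 ((C.mul_cell l t a).choose_spec s)
  rw [map_sum] at h
  simp only [map_smul] at h
  exact h

/-- The classes of the `c^l_{st}` are linearly independent modulo `A^{▷ l}`. -/
theorem linearIndependent_mkQ (l : C.Λ) :
    LinearIndependent R fun p : C.Tab l × C.Tab l => (C.above l).mkQ (C.basis ⟨l, p⟩) := by
  classical
  rw [Fintype.linearIndependent_iff]
  intro g hg p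
  simp only [← map_smul, ← map_sum] at hg
  have h := C.repr_eq_zero_of_mem_above ((Submodule.Quotient.mk_eq_zero _).1 hg) p.1 p.2
  simpa [Finsupp.single_apply] using h

theorem eq_of_sum_smul_mkQ {l : C.Λ} (s : C.Tab l) {g g' : C.Tab l → R}
    (h : ∑ v, g v • (C.above l).mkQ (C.basis ⟨l, s, v⟩) =
      ∑ v, g' v • (C.above l).mkQ (C.basis ⟨l, s, v⟩)) : g = g' := by
  have hli : LinearIndependent R fun v : C.Tab l => (C.above l).mkQ (C.basis ⟨l, s, v⟩) :=
    (C.linearIndependent_mkQ l).comp (fun v => (s, v)) fun v v' hv => (Prod.mk.inj hv).2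
  rw [Fintype.linearIndependent_iff] at hli
  funext v
  rw [← sub_eq_zero]
  refine hli (fun v => g v - g' v) ?_ v
  simp only [sub_smul, Finset.sum_sub_distrib, h, sub_self]

/-- `coeff` is an arbitrary choice from `mul_cell`. Independence modulo `A^{▷ l}` makes it
canonical, and the row `s` used for testing is immaterial. The algebraic rules for `coeff` are
verified through this criterion. -/
theorem coeff_unique {l : C.Λ} (s t : C.Tab l) (a : A) {g : C.Tab l → R}
    (h : (C.above l).mkQ (C.basis ⟨l, s, t⟩ * a) =
      ∑ v, g v • (C.above l).mkQ (C.basis ⟨l, s, v⟩)) (v : C.Tab l) : C.coeff a t v = g v :=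
  congrFun (C.eq_of_sum_smul_mkQ s ((C.mkQ_basis_mul s t a).symm.trans h)) v

theorem coeff_add {l : C.Λ} (a b : A) (t v : C.Tab l) :
    C.coeff (a + b) t v = C.coeff a t v + C.coeff b t v := by
  refine C.coeff_unique t t (a + b) (g := fun v => C.coeff a t v + C.coeff b t v) ?_ v
  simp only [mul_add, map_add, mkQ_basis_mul, add_smul, Finset.sum_add_distrib]

theorem coeff_smul {l : C.Λ} (r : R) (a : A) (t v : C.Tab l) :
    C.coeff (r • a) t v = r * C.coeff a t v := by
  refine C.coeff_unique t t (r • a) (g := fun v => r * C.coeff a t v) ?_ v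
  simp only [mul_smul_comm, map_smul, mkQ_basis_mul, mul_smul, Finset.smul_sum]

theorem coeff_one {l : C.Λ} (t v : C.Tab l) [DecidableEq (C.Tab l)] :
    C.coeff (1 : A) t v = if t = v then 1 else 0 := by
  refine C.coeff_unique t t 1 (g := fun v => if t = v then 1 else 0) ?_ v
  simp

theorem coeff_mul {l : C.Λ} (a b : A) (t v : C.Tab l) :
    C.coeff (a * b) t v = ∑ w, C.coeff a t w * C.coeff b w v := by
  refine C.coeff_unique t t (a * b) (g := fun v => ∑ w, C.coeff a t w * C.coeff b w v) ?_ v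
  have h : (C.above l).mkQ (C.basis ⟨l, t, t⟩ * a) =
      (C.above l).mkQ (∑ w, C.coeff a t w • C.basis ⟨l, t, w⟩) := by
    rw [mkQ_basis_mul, map_sum]; simp only [map_smul]
  rw [← mul_assoc, C.mkQ_mul_right h b, Finset.sum_mul, map_sum]
  simp only [smul_mul_assoc, map_smul, mkQ_basis_mul, Finset.smul_sum, Finset.sum_smul, mul_smul]
  exact Finset.sum_comm

open Classical in
/-- The matrix representation of `A` on the cell module `Δ(l)`, acting on row vectors. -/
noncomputable def rep (l : C.Λ) : A →ₐ[R] Matrix (C.Tab l) (C.Tab l) R :=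
  AlgHom.ofLinearMap
    { toFun := fun a => Matrix.of fun t v => C.coeff a t v
      map_add' := fun a b => by ext; simp [coeff_add]
      map_smul' := fun r a => by ext; simp [coeff_smul] }
    (by ext t v; simp [coeff_one, Matrix.one_apply])
    (fun a b => by ext t v; simp [coeff_mul, Matrix.mul_apply])

theorem rep_apply {l : C.Λ} (a : A) (t v : C.Tab l) : C.rep l a t v = C.coeff a t v := rfl

open Matrix in
theorem act_eq_vecMul {l : C.Λ} (x : C.Cell l) (a : A) : C.act x a = x ᵥ* C.rep l a := rfl

section

variable {l : C.Λ}

theorem act_mul (x : C.Cell l) (a b : A) : C.act x (a * b) = C.act (C.act x a) b := by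
  classical
  simp only [act_eq_vecMul, map_mul, Matrix.vecMul_vecMul]

theorem act_one (x : C.Cell l) : C.act x (1 : A) = x := by
  classical
  simp only [act_eq_vecMul, map_one, Matrix.vecMul_one]

theorem act_add (x : C.Cell l) (a b : A) : C.act x (a + b) = C.act x a + C.act x b := by
  simp only [act_eq_vecMul, map_add, Matrix.vecMul_add]

theorem act_sub (x : C.Cell l) (a b : A) : C.act x (a - b) = C.act x a - C.act x b := by
  simp only [act_eq_vecMul, map_sub, Matrix.vecMul_sub]

theorem act_zero (x : C.Cell l) : C.act x (0 : A) = 0 := by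
  simp only [act_eq_vecMul, map_zero, Matrix.vecMul_zero]

theorem act_smul (x : C.Cell l) (r : R) (a : A) : C.act x (r • a) = r • C.act x a := by
  funext v
  simp only [act, coeff_smul, Pi.smul_apply, smul_eq_mul, Finset.mul_sum, mul_left_comm]

theorem act_sum (x : C.Cell l) {ι : Type*} (s : Finset ι) (a : ι → A) :
    C.act x (∑ i ∈ s, a i) = ∑ i ∈ s, C.act x (a i) := by
  classical
  induction s using Finset.induction_on with
  | empty => simp [act_zero]
  | insert i s hi ih => rw [Finset.sum_insert hi, Finset.sum_insert hi, act_add, ih]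

theorem add_act (x y : C.Cell l) (a : A) : C.act (x + y) a = C.act x a + C.act y a := by
  simp only [act_eq_vecMul, Matrix.add_vecMul]

theorem smul_act (r : R) (x : C.Cell l) (a : A) : C.act (r • x) a = r • C.act x a := by
  simp only [act_eq_vecMul, Matrix.smul_vecMul]

/-- The action of an element of `A` on a cell module as a linear map. -/
noncomputable def actₗ (l : C.Λ) (a : A) : C.Cell l →ₗ[R] C.Cell l where
  toFun x := C.act x a
  map_add' x y := C.add_act x y a
  map_smul' r x := C.smul_act r x a

@[simp] theorem actₗ_apply (a : A) (x : C.Cell l) : C.actₗ l a x = C.act x a := rfl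

theorem mkQ_alphaInv_mul (y z : C.Cell l) (a : A) :
    (C.above l).mkQ (C.alphaInv y z * a) = (C.above l).mkQ (C.alphaInv y (C.act z a)) := by
  simp only [alphaInv, act, Finset.sum_mul, smul_mul_assoc, map_sum, map_smul, mkQ_basis_mul,
    Finset.smul_sum, Finset.mul_sum, Finset.sum_smul, smul_smul]
  refine Finset.sum_congr rfl fun s _ => ?_
  rw [Finset.sum_comm]
  simp only [mul_assoc]

theorem mkQ_mul_basis (s t : C.Tab l) (a : A) :
    (C.above l).mkQ (a * C.basis ⟨l, s, t⟩) =
      ∑ w, C.coeff (C.inv a) s w • (C.above l).mkQ (C.basis ⟨l, w, t⟩) := by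
  have h1 := C.mkQ_mul_left (C.mkQ_inv_basis t s).symm a
  rw [h1]
  have h2 : (C.above l).mkQ (C.basis ⟨l, t, s⟩ * C.inv a) =
      (C.above l).mkQ (∑ w, C.coeff (C.inv a) s w • C.basis ⟨l, t, w⟩) := by
    rw [mkQ_basis_mul, map_sum]; simp only [map_smul]
  have h3 := C.mkQ_inv h2
  rw [C.inv_mul, C.inv_inv, map_sum, map_sum] at h3
  simpa only [map_smul, mkQ_inv_basis] using h3

theorem mkQ_mul_alphaInv (y z : C.Cell l) (a : A) :
    (C.above l).mkQ (a * C.alphaInv y z) =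
      (C.above l).mkQ (C.alphaInv (C.act y (C.inv a)) z) := by
  simp only [alphaInv, act, Finset.mul_sum, mul_smul_comm, map_sum, map_smul, mkQ_mul_basis,
    Finset.smul_sum, Finset.sum_mul, Finset.sum_smul, smul_smul]
  rw [Finset.sum_comm]
  conv_rhs => rw [Finset.sum_comm]
  refine Finset.sum_congr rfl fun t _ => ?_
  rw [Finset.sum_comm]
  refine Finset.sum_congr rfl fun w _ => Finset.sum_congr rfl fun s _ => ?_
  congr 1
  ring

/-- Expand `c_{vt} c_{su}` modulo `A^{▷ l}` in two ways. The right action gives only terms `c_{vq}`,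
the left action only terms `c_{wu}`, so nothing but `c_{vu}` can survive. -/
theorem coeff_basis_ne {s t u v : C.Tab l} (h : u ≠ v) :
    C.coeff (C.basis ⟨l, s, u⟩) t v = 0 := by
  classical
  refine C.coeff_unique v t (C.basis ⟨l, s, u⟩)
    (g := fun v => if u = v then C.coeff (C.basis ⟨l, s, u⟩) t v else 0) ?_ v |>.trans (if_neg h)
  have h1 := (C.mkQ_basis_mul v t (C.basis ⟨l, s, u⟩)).symm.trans
    (C.mkQ_mul_basis s u (C.basis ⟨l, v, t⟩))
  rw [mkQ_basis_mul]
  refine Finset.sum_congr rfl fun q _ => ?_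
  by_cases hq : u = q
  · rw [if_pos hq]
  · rw [if_neg hq]
    have h2 := Fintype.linearIndependent_iff.1 (C.linearIndependent_mkQ l)
      (fun p => (if p.1 = v then C.coeff (C.basis ⟨l, s, u⟩) t p.2 else 0) -
        (if p.2 = u then C.coeff (C.inv (C.basis ⟨l, v, t⟩)) s p.1 else 0))
      (by
        simp only [sub_smul, Finset.sum_sub_distrib, Fintype.sum_prod_type, ite_smul, zero_smul,
          Finset.sum_ite_irrel, Finset.sum_ite_eq', Finset.sum_const_zero, Finset.mem_univ, if_true]
        rw [h1, sub_self]) (v, q)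
    have hq' : ¬ q = u := fun h => hq h.symm
    simp only [if_true, if_neg hq', sub_zero] at h2
    rw [h2]

/-- The surviving coefficient in the double expansion of `c_{pt} c_{su}`. The left side does not
involve `p` and the right side does not involve `u`, so the common value depends on `s` and `t`
alone: it is a Gram entry. -/
theorem coeff_basis_self (s t u : C.Tab l) (p : C.Tab l) :
    C.coeff (C.basis ⟨l, s, u⟩) t u = C.coeff (C.inv (C.basis ⟨l, p, t⟩)) s p := by
  classical
  have h1 := (C.mkQ_basis_mul p t (C.basis ⟨l, s, u⟩)).symm.trans
    (C.mkQ_mul_basis s u (C.basis ⟨l, p, t⟩))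
  have h2 := Fintype.linearIndependent_iff.1 (C.linearIndependent_mkQ l)
      (fun x => (if x.1 = p then C.coeff (C.basis ⟨l, s, u⟩) t x.2 else 0) -
        (if x.2 = u then C.coeff (C.inv (C.basis ⟨l, p, t⟩)) s x.1 else 0))
      (by
        simp only [sub_smul, Finset.sum_sub_distrib, Fintype.sum_prod_type, ite_smul, zero_smul,
          Finset.sum_ite_irrel, Finset.sum_ite_eq', Finset.sum_const_zero, Finset.mem_univ, if_true]
        rw [h1, sub_self]) (p, u)
  simpa [sub_eq_zero] using h2

/-- The Gram matrix of the bilinear form on `Δ(l)`. -/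
noncomputable def gram (l : C.Λ) (t s : C.Tab l) : R := C.coeff (C.basis ⟨l, s, s⟩) t s

theorem coeff_basis [DecidableEq (C.Tab l)] (s t u v : C.Tab l) :
    C.coeff (C.basis ⟨l, s, u⟩) t v = if u = v then C.gram l t s else 0 := by
  split_ifs with h
  · subst h
    rw [gram, C.coeff_basis_self s t u u, C.coeff_basis_self s t s u]
  · exact C.coeff_basis_ne h

/-- The bilinear form with Gram matrix `gram`. -/
noncomputable def bilin (x y : C.Cell l) : R := ∑ t, ∑ s, x t * y s * C.gram l t s

theorem act_alphaInv (x y z : C.Cell l) : C.act x (C.alphaInv y z) = C.bilin x y • z := by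
  classical
  funext v
  simp only [alphaInv, act_sum, act_smul, Finset.sum_apply, Pi.smul_apply, smul_eq_mul, bilin]
  simp only [act, coeff_basis, mul_ite, mul_zero, Finset.sum_ite_irrel, Finset.sum_const_zero,
    Finset.sum_ite_eq', Finset.mem_univ, if_true, Finset.mul_sum, Finset.sum_mul]
  rw [Finset.sum_comm]
  refine Finset.sum_congr rfl fun t _ => Finset.sum_congr rfl fun s _ => ?_
  ring

/-- `act_alphaInv` supplies a scalar with the defining property. It is unique because the constant
vector 1 has a coordinate to read it from, tableau sets being non-empty. -/
theorem form_eq_bilin [Nontrivial R] [NoZeroDivisors R] (x y : C.Cell l) :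
    C.form x y = C.bilin x y := by
  have h := Classical.epsilon_spec (p := fun b : R => ∀ z : C.Cell l,
    C.act x (C.alphaInv y z) = b • z) ⟨_, C.act_alphaInv x y⟩
  obtain ⟨t⟩ := C.nonemptyTab l
  have h1 := congrFun ((C.act_alphaInv x y fun _ => 1).symm.trans (h fun _ => 1)) t
  simpa [form] using h1.symm

theorem bilin_smul_right (r : R) (x y : C.Cell l) : C.bilin x (r • y) = r * C.bilin x y := by
  simp only [bilin, Pi.smul_apply, smul_eq_mul, Finset.mul_sum]
  refine Finset.sum_congr rfl fun t _ => Finset.sum_congr rfl fun s _ => ?_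
  ring

theorem bilin_zero_right (x : C.Cell l) : C.bilin x 0 = 0 := by simp [bilin]

/-- The action of `A^{▷ l}` on `Δ(l)` is zero. -/
theorem act_of_mem_above (x : C.Cell l) {a : A} (ha : a ∈ C.above l) : C.act x a = 0 := by
  have hc : ∀ t v, C.coeff a t v = (0 : C.Tab l → R) v := fun t v =>
    C.coeff_unique t t a (by
      simpa using C.mul_mem_above (C.basis ⟨l, t, t⟩) ha) v
  funext v
  simp [act, hc]

theorem act_congr (x : C.Cell l) {a b : A} (h : (C.above l).mkQ a = (C.above l).mkQ b) :
    C.act x a = C.act x b := by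
  rw [← sub_eq_zero, ← act_sub]
  exact C.act_of_mem_above x (C.mkQ_eq.1 h)

/-- Associativity: let `x` act by `a α⁻¹(y^* ⊗ z) ≡ α⁻¹((y a^*)^* ⊗ z)` and compare the two scalars.
-/
theorem bilin_act_left (x y : C.Cell l) (a : A) :
    C.bilin (C.act x a) y = C.bilin x (C.act y (C.inv a)) := by
  obtain ⟨t⟩ := C.nonemptyTab l
  have h1 := C.act_alphaInv (C.act x a) y fun _ => 1
  rw [← act_mul, C.act_congr x (C.mkQ_mul_alphaInv y _ a), act_alphaInv] at h1
  simpa using (congrFun h1 t).symm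

theorem alphaInv_mem_above_iff (y z : C.Cell l) :
    C.alphaInv y z ∈ C.above l ↔ ∀ s t, y s * z t = 0 := by
  constructor
  · intro h s t
    have h1 := (Submodule.Quotient.mk_eq_zero _).2 h
    rw [← Submodule.mkQ_apply, alphaInv, map_sum] at h1
    simp only [map_sum, map_smul] at h1
    exact Fintype.linearIndependent_iff.1 (C.linearIndependent_mkQ l) (fun p => y p.1 * z p.2)
      (by simpa only [Fintype.sum_prod_type] using h1) (s, t)
  · intro h
    simp [alphaInv, h]

end

/-- `A^{⊵ l}`, the span of the `c^m_{pq}` with `m ⊵ l`. -/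
def aboveEq (l : C.Λ) : Submodule R A :=
  Submodule.span R {x | ∃ (m : C.Λ) (p q : C.Tab m), l ≤ m ∧ x = C.basis ⟨m, p, q⟩}

theorem above_le_aboveEq (l : C.Λ) : C.above l ≤ C.aboveEq l := by
  refine Submodule.span_mono ?_
  rintro x ⟨k, p, q, hk, rfl⟩
  exact ⟨k, p, q, hk.le, rfl⟩

theorem above_le_aboveEq_of_le {l m : C.Λ} (h : l ≤ m) : C.above m ≤ C.aboveEq l := by
  refine Submodule.span_mono ?_
  rintro x ⟨k, p, q, hk, rfl⟩
  exact ⟨k, p, q, h.trans hk.le, rfl⟩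

theorem basis_mem_aboveEq {l m : C.Λ} (h : l ≤ m) (s t : C.Tab m) :
    C.basis ⟨m, s, t⟩ ∈ C.aboveEq l := Submodule.subset_span ⟨m, s, t, h, rfl⟩

theorem mul_mem_aboveEq {l : C.Λ} {x : A} (a : A) (hx : x ∈ C.aboveEq l) :
    a * x ∈ C.aboveEq l := by
  induction hx using Submodule.span_induction with
  | mem x hx =>
    obtain ⟨m, p, q, hm, rfl⟩ := hx
    have h := C.mkQ_mul_basis p q a
    simp only [← map_smul, ← map_sum] at h
    have h1 := C.above_le_aboveEq_of_le hm (C.mkQ_eq.1 h)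
    have h2 := Submodule.add_mem _ h1 (Submodule.sum_mem (t := Finset.univ) (C.aboveEq l) fun w _ =>
      Submodule.smul_mem _ (C.coeff (C.inv a) p w) (C.basis_mem_aboveEq hm w q))
    rwa [sub_add_cancel] at h2
  | zero => rw [mul_zero]; exact Submodule.zero_mem _
  | add x y _ _ h1 h2 => rw [mul_add]; exact Submodule.add_mem _ h1 h2
  | smul b x _ h => rw [mul_smul_comm]; exact Submodule.smul_mem _ _ h

theorem mem_aboveEq_of_mkQ_eq {l : C.Λ} {x y : A} (h : (C.above l).mkQ x = (C.above l).mkQ y)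
    (hy : y ∈ C.aboveEq l) : x ∈ C.aboveEq l := by
  have h1 := Submodule.add_mem _ (C.above_le_aboveEq l (C.mkQ_eq.1 h)) hy
  rwa [sub_add_cancel] at h1

theorem alphaInv_mem_aboveEq {l : C.Λ} (y z : C.Cell l) : C.alphaInv y z ∈ C.aboveEq l :=
  Submodule.sum_mem _ fun _ _ => Submodule.sum_mem _ fun _ _ =>
    Submodule.smul_mem _ _ (C.basis_mem_aboveEq le_rfl _ _)

/-- On `Δ(l)`, basis elements of shape `l` act through the form and those of larger shape act by
zero. A vector in the radical is therefore killed by all of `A^{⊵ l}`. -/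
theorem exists_bilin_ne_zero_of_act_ne_zero {l : C.Λ} {x : C.Cell l} {a : A}
    (ha : a ∈ C.aboveEq l) (h : C.act x a ≠ 0) : ∃ y, C.bilin x y ≠ 0 := by
  classical
  by_contra! hx
  apply h
  induction ha using Submodule.span_induction with
  | mem b hb =>
    obtain ⟨m, p, q, hm, rfl⟩ := hb
    obtain rfl | hlt := eq_or_lt_of_le hm
    · have h1 := C.act_alphaInv x (Pi.single p 1) (Pi.single q 1)
      have h2 : C.alphaInv (Pi.single p 1) (Pi.single q 1) = C.basis ⟨l, p, q⟩ := by
        simp [alphaInv, Pi.single_apply, ite_smul]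
      rw [← h2, h1, hx, zero_smul]
    · exact C.act_of_mem_above x (C.basis_mem_above hlt p q)
  | zero => exact C.act_zero x
  | add b c _ _ h1 h2 =>
    rw [act_add]
    by_cases hb : C.act x b = 0
    · by_cases hc : C.act x c = 0
      · rw [hb, hc, add_zero]
      · exact (hc (h2 hc)).elim
    · exact (hb (h1 hb)).elim
  | smul r b _ h1 =>
    rw [act_smul]
    by_cases hb : C.act x b = 0
    · rw [hb, smul_zero]
    · exact (hb (h1 hb)).elim

end Basics

end CellDatum

namespace CellDatum

/-! ### Specialization of cellular algebras and cell modules -/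

section BaseChange

variable {R : Type u} {A : Type v} [CommRing R] [Ring A] [Algebra R A]
  (C : CellDatum.{u, v, w} R A) (B : Type u₁) [CommRing B] [Algebra R B]

theorem tmul_mem_above {l : C.Λ} (b : B) {x : A} (hx : x ∈ C.above l) :
    b ⊗ₜ[R] x ∈ (C.baseChange B).above l := C.tmul_mem_span B l b hx

/-- Extension of scalars of a vector of a cell module. -/
def extend {l : C.Λ} (x : C.Cell l) : (C.baseChange B).Cell l := fun v => algebraMap R B (x v)

theorem extend_apply {l : C.Λ} (x : C.Cell l) (v : C.Tab l) :
    C.extend B x v = algebraMap R B (x v) := rfl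

theorem extend_add {l : C.Λ} (x y : C.Cell l) :
    C.extend B (x + y) = C.extend B x + C.extend B y := by
  funext v; exact map_add _ _ _

theorem extend_smul {l : C.Λ} (r : R) (x : C.Cell l) :
    C.extend B (r • x) = algebraMap R B r • C.extend B x := by
  funext v; exact map_mul _ _ _

theorem extend_zero {l : C.Λ} : C.extend B (0 : C.Cell l) = 0 := by
  funext v; exact map_zero _

theorem extend_sub {l : C.Λ} (x y : C.Cell l) :
    C.extend B (x - y) = C.extend B x - C.extend B y := by
  funext v; exact map_sub _ _ _

theorem extend_sum {l : C.Λ} {ι : Type*} (s : Finset ι) (x : ι → C.Cell l) :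
    C.extend B (∑ i ∈ s, x i) = ∑ i ∈ s, C.extend B (x i) := by
  funext v
  simp [extend_apply]

theorem coeff_tmul {l : C.Λ} (b : B) (a : A) (t v : C.Tab l) :
    (C.baseChange B).coeff (l := l) (b ⊗ₜ[R] a) t v = b * algebraMap R B (C.coeff a t v) := by
  refine (C.baseChange B).coeff_unique (l := l) t t (b ⊗ₜ[R] a)
    (g := fun v => b * algebraMap R B (C.coeff a t v)) ?_ v
  have h := C.mkQ_basis_mul t t a
  simp only [← map_smul, ← map_sum] at h
  have h1 := C.tmul_mem_above B b (C.mkQ_eq.1 h)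
  simp only [← map_smul, ← map_sum]
  refine (C.baseChange B).mkQ_eq.2 ?_
  convert h1 using 1
  simp only [Algebra.TensorProduct.basis_apply, Algebra.TensorProduct.tmul_mul_tmul, one_mul,
    TensorProduct.tmul_sub, TensorProduct.tmul_sum, TensorProduct.smul_tmul', smul_eq_mul,
    mul_one, TensorProduct.tmul_smul]
  simp [Algebra.smul_def, mul_comm]

theorem act_extend_tmul {l : C.Λ} (x : C.Cell l) (a : A) :
    (C.baseChange B).act (C.extend B x) (1 ⊗ₜ[R] a) = C.extend B (C.act x a) := by
  funext v
  simp only [act, coeff_tmul, extend_apply, one_mul, map_sum, map_mul]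

theorem gram_baseChange (l : C.Λ) (t s : C.Tab l) :
    (C.baseChange B).gram l t s = algebraMap R B (C.gram l t s) := by
  have h := C.coeff_tmul B (1 : B) (C.basis ⟨l, s, s⟩) t s
  rw [one_mul] at h
  rw [gram, gram, ← h, Algebra.TensorProduct.basis_apply]

theorem alphaInv_extend {l : C.Λ} (y z : C.Cell l) :
    (C.baseChange B).alphaInv (C.extend B y) (C.extend B z) = 1 ⊗ₜ[R] C.alphaInv y z := by
  simp only [alphaInv, TensorProduct.tmul_sum, TensorProduct.tmul_smul, extend_apply,
    Algebra.TensorProduct.basis_apply, ← map_mul, algebraMap_smul]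

theorem extend_single_span {l : C.Λ} (x : (C.baseChange B).Cell l) [DecidableEq (C.Tab l)] :
    x = ∑ t : C.Tab l, x t • C.extend B (Pi.single t 1) := by
  funext v
  simp [extend_apply, Pi.single_apply]

theorem exists_act_extend {l : C.Λ} {d : C.Cell l} (hd : ∀ x : C.Cell l, ∃ a, C.act d a = x)
    (x : (C.baseChange B).Cell l) : ∃ a, (C.baseChange B).act (C.extend B d) a = x := by
  classical
  choose f hf using hd
  refine ⟨∑ t : C.Tab l, x t • (1 : B) ⊗ₜ[R] f (Pi.single t 1), ?_⟩
  rw [act_sum]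
  conv_rhs => rw [C.extend_single_span B x]
  refine Finset.sum_congr rfl fun t _ => ?_
  rw [act_smul, act_extend_tmul, hf]

variable {B} {B' : Type u₂} [CommRing B'] [Algebra R B'] (g : B →ₐ[R] B')

/-- The map of specializations of `A` induced by a homomorphism of coefficient rings. -/
noncomputable abbrev _root_.specialize (A : Type v) [Ring A] [Algebra R A] :
    B ⊗[R] A →ₐ[R] B' ⊗[R] A := Algebra.TensorProduct.map g (AlgHom.id R A)

/-- The map of cell modules induced by a homomorphism of coefficient rings. -/
def specializeCell {l : C.Λ} (x : (C.baseChange B).Cell l) : (C.baseChange B').Cell l :=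
  fun v => g (x v)

theorem specializeCell_apply {l : C.Λ} (x : (C.baseChange B).Cell l) (v : C.Tab l) :
    C.specializeCell g x v = g (x v) := rfl

theorem specializeCell_extend {l : C.Λ} (x : C.Cell l) :
    C.specializeCell g (C.extend B x) = C.extend B' x := by
  funext v
  exact g.commutes _

theorem specializeCell_smul {l : C.Λ} (b : B) (x : (C.baseChange B).Cell l) :
    C.specializeCell g (b • x) = g b • C.specializeCell g x := by
  funext v; exact map_mul _ _ _

theorem specializeCell_sum {l : C.Λ} {ι : Type*} (s : Finset ι)
    (x : ι → (C.baseChange B).Cell l) :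
    C.specializeCell g (∑ i ∈ s, x i) = ∑ i ∈ s, C.specializeCell g (x i) := by
  funext v
  simp [specializeCell_apply]

theorem specializeCell_injective (hg : Function.Injective g) {l : C.Λ} :
    Function.Injective (C.specializeCell g (l := l)) := fun _ _ h =>
  funext fun v => hg (congrFun h v)

theorem coeff_specialize {l : C.Λ} (a : B ⊗[R] A) (t v : C.Tab l) :
    (C.baseChange B').coeff (l := l) (specialize g A a) t v =
      g ((C.baseChange B).coeff (l := l) a t v) := by
  induction a using TensorProduct.induction_on with
  | zero =>
    have h1 := (C.baseChange B).coeff_smul (l := l) 0 0 t v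
    have h2 := (C.baseChange B').coeff_smul (l := l) 0 0 t v
    rw [zero_smul, zero_mul] at h1 h2
    rw [map_zero, h1, h2, map_zero]
  | add x y h h' => rw [map_add, coeff_add, coeff_add, map_add, h, h']
  | tmul b a =>
    rw [Algebra.TensorProduct.map_tmul, AlgHom.id_apply, coeff_tmul, coeff_tmul, map_mul,
      g.commutes]

theorem act_specialize {l : C.Λ} (x : (C.baseChange B).Cell l) (a : B ⊗[R] A) :
    (C.baseChange B').act (C.specializeCell g x) (specialize g A a) =
      C.specializeCell g ((C.baseChange B).act x a) := by
  funext v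
  simp only [act, coeff_specialize, specializeCell_apply, map_sum, map_mul]

theorem inv_specialize (a : B ⊗[R] A) :
    (C.baseChange B').inv (specialize g A a) = specialize g A ((C.baseChange B).inv a) := by
  induction a using TensorProduct.induction_on with
  | zero => simp
  | add x y h h' => simp only [map_add, h, h']
  | tmul b a => simp

theorem bilin_specialize {l : C.Λ} (x y : (C.baseChange B).Cell l) :
    (C.baseChange B').bilin (C.specializeCell g x) (C.specializeCell g y) =
      g ((C.baseChange B).bilin x y) := by
  simp only [bilin, gram_baseChange, specializeCell_apply, map_sum, map_mul, g.commutes]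

theorem specialize_basis (i : Σ l : C.Λ, C.Tab l × C.Tab l) :
    specialize g A ((C.baseChange B).basis i) = (C.baseChange B').basis i := by
  simp [Algebra.TensorProduct.basis_apply]

theorem specialize_smul (b : B) (a : B ⊗[R] A) :
    specialize g A (b • a) = g b • specialize g A a := by
  induction a using TensorProduct.induction_on with
  | zero => simp
  | add x y h h' => simp only [smul_add, map_add, h, h']
  | tmul c a => simp [TensorProduct.smul_tmul']

theorem specialize_mem_above {l : C.Λ} {a : B ⊗[R] A} (ha : a ∈ (C.baseChange B).above l) :
    specialize g A a ∈ (C.baseChange B').above l := by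
  induction ha using Submodule.span_induction with
  | mem x hx =>
    obtain ⟨m, p, q, hm, rfl⟩ := hx
    rw [specialize_basis]
    exact (C.baseChange B').basis_mem_above hm p q
  | zero => rw [map_zero]; exact Submodule.zero_mem _
  | add x y _ _ h h' => rw [map_add]; exact Submodule.add_mem _ h h'
  | smul b x _ h => rw [specialize_smul]; exact Submodule.smul_mem _ _ h

include C in
-- The cell datum serves only to make `A` free: coordinates in the cellular basis are mapped one by
-- one by `g`.
theorem specialize_injective (hg : Function.Injective g) :
    Function.Injective (specialize g A) := by
  have h : ∀ (a : B ⊗[R] A) i, (C.baseChange B').basis.repr (specialize g A a) i =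
      g ((C.baseChange B).basis.repr a i) := by
    intro a i
    induction a using TensorProduct.induction_on with
    | zero => simp
    | add x y h h' => simp only [map_add, Finsupp.add_apply, h, h']
    | tmul b a => simp [Algebra.TensorProduct.basis_repr_tmul]
  intro a a' haa
  refine (C.baseChange B).basis.repr.injective (Finsupp.ext fun i => hg ?_)
  rw [← h, ← h, haa]

end BaseChange

/-! ### Semisimple quotients of cellular algebras -/

section Semisimple

variable {k : Type u} {A : Type v} [CommRing k] [Ring A] [Algebra k A]
  (C : CellDatum.{u, v, w} k A)

/-- If right multiplication by `e` moves each cell into strictly larger ones, descending induction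
on the poset kills everything: `φ(c) e = φ(c) e e = φ(x) e = 0` with `x` in larger cells. Finally `e
= φ(1) e`. -/
theorem eq_zero_of_idempotent {Q : Type u₁} [Ring Q] (φ : A →+* Q) {e : Q} (he : e * e = e)
    (h : ∀ (l : C.Λ) (s t : C.Tab l), ∃ x ∈ C.above l, φ (C.basis ⟨l, s, t⟩) * e = φ x) :
    e = 0 := by
  have h1 : ∀ (l : C.Λ) (s t : C.Tab l), φ (C.basis ⟨l, s, t⟩) * e = 0 := by
    intro l
    induction l using WellFoundedGT.induction with
    | ind l ih =>
      intro s t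
      obtain ⟨x, hx, hxe⟩ := h l s t
      rw [← he, ← mul_assoc, hxe]
      clear hxe
      induction hx using Submodule.span_induction with
      | mem x hx =>
        obtain ⟨m, p, q, hm, rfl⟩ := hx
        exact ih m hm p q
      | zero => simp
      | add x y _ _ h h' => rw [map_add, add_mul, h, h', add_zero]
      | smul b x _ h => rw [Algebra.smul_def, map_mul, mul_assoc, h, mul_zero]
  have h2 : ∀ x : A, φ x * e = 0 := by
    intro x
    rw [← C.basis.sum_repr x, map_sum, Finset.sum_mul]
    refine Finset.sum_eq_zero fun i _ => ?_
    rw [Algebra.smul_def, map_mul, mul_assoc, h1, mul_zero]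
  simpa using h2 1

/-- The image of `A^{⊵ l}` in a semisimple quotient of `A` has a right identity. -/
theorem exists_right_identity {Q : Type u₁} [Ring Q] [IsSemisimpleRing Q] (φ : A →+* Q)
    (hφ : Function.Surjective φ) (l : C.Λ) :
    ∃ e ∈ C.aboveEq l, ∀ x ∈ C.aboveEq l, φ (x * e) = φ x := by
  let J : Ideal Q :=
    { carrier := φ '' (C.aboveEq l : Set A)
      zero_mem' := ⟨0, Submodule.zero_mem _, map_zero _⟩
      add_mem' := by
        rintro _ _ ⟨x, hx, rfl⟩ ⟨y, hy, rfl⟩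
        exact ⟨x + y, Submodule.add_mem _ hx hy, map_add _ _ _⟩
      smul_mem' := by
        rintro c _ ⟨x, hx, rfl⟩
        obtain ⟨a, rfl⟩ := hφ c
        exact ⟨a * x, C.mul_mem_aboveEq a hx, map_mul _ _ _⟩ }
  obtain ⟨e, he, hJ⟩ := IsSemisimpleRing.ideal_eq_span_idempotent J
  have heJ : e ∈ J := hJ ▸ Ideal.subset_span rfl
  obtain ⟨a, ha, rfl⟩ := heJ
  refine ⟨a, ha, fun x hx => ?_⟩
  have hxJ : φ x ∈ J := ⟨x, hx, rfl⟩
  rw [hJ, Ideal.mem_span_singleton'] at hxJ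
  obtain ⟨q, hq⟩ := hxJ
  rw [map_mul, ← hq, mul_assoc, he.eq]

/-- The bilinear forms of a semisimple cellular algebra are non-degenerate. -/
theorem exists_bilin_ne_zero [Nontrivial k] [IsSemisimpleRing A] {l : C.Λ} {x : C.Cell l}
    (hx : x ≠ 0) : ∃ y, C.bilin x y ≠ 0 := by
  obtain ⟨e, he, hme⟩ := C.exists_right_identity (RingHom.id A) Function.surjective_id l
  refine C.exists_bilin_ne_zero_of_act_ne_zero he fun h => hx ?_
  -- Multiplying `α⁻¹(1^* ⊗ x)` by the right identity `e` replaces `x` by `x e`. Were this zero,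
  -- `α⁻¹(1^* ⊗ x)` would lie in `A^{▷ l}`, which forces `x = 0`.
  have h1 := C.mkQ_alphaInv_mul (fun _ => (1 : k)) x e
  have h2 := hme _ (C.alphaInv_mem_aboveEq (fun _ => (1 : k)) x)
  simp only [RingHom.id_apply] at h2
  rw [h2, h] at h1
  have h3 : C.alphaInv (fun _ => (1 : k)) (0 : C.Cell l) = 0 := by simp [alphaInv]
  rw [h3, map_zero] at h1
  have h4 := (C.alphaInv_mem_above_iff _ _).1 ((Submodule.Quotient.mk_eq_zero _).1 h1)
  obtain ⟨t⟩ := C.nonemptyTab l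
  funext v
  simpa using h4 t v

end Semisimple

section SemisimpleField

variable {k : Type u} {A : Type v} [Field k] [Ring A] [Algebra k A]
  (C : CellDatum.{u, v, w} k A)

open Classical in
/-- The representation on the sum of all cell modules. -/
noncomputable def repAll : A →ₐ[k] ∀ l : C.Λ, Matrix (C.Tab l) (C.Tab l) k :=
  AlgHom.pi fun l => C.rep l

/-- The kernel is generated by an idempotent `e`. Acting by zero on `Δ(l)` means `c^l_{st} e ∈ A^{▷
l}`, so `eq_zero_of_idempotent` applies. -/
theorem repAll_injective [IsSemisimpleRing A] : Function.Injective C.repAll := by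
  classical
  obtain ⟨e, he, hJ⟩ := IsSemisimpleRing.ideal_eq_span_idempotent (RingHom.ker C.repAll)
  have hek : e ∈ RingHom.ker C.repAll := hJ ▸ Ideal.subset_span rfl
  have h0 : e = 0 := by
    refine C.eq_zero_of_idempotent (RingHom.id A) he fun l s t => ⟨_, ?_, rfl⟩
    have h1 := C.mkQ_basis_mul s t e
    have h2 : ∀ v, C.coeff e t v = 0 := fun v =>
      congrFun (congrFun (congrFun ((RingHom.mem_ker).1 hek) l) t) v
    simp only [h2, zero_smul, Finset.sum_const_zero] at h1
    exact (Submodule.Quotient.mk_eq_zero _).1 h1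
  refine (RingHom.injective_iff_ker_eq_bot C.repAll.toRingHom).2 ?_
  have h3 : RingHom.ker C.repAll = ⊥ := by rw [hJ, h0]; simp
  exact h3

theorem repAll_bijective [IsSemisimpleRing A] : Function.Bijective C.repAll := by
  classical
  refine ⟨C.repAll_injective, ?_⟩
  have : Module.Finite k A := Module.Finite.of_basis C.basis
  have hdim : Module.finrank k A =
      Module.finrank k (∀ l : C.Λ, Matrix (C.Tab l) (C.Tab l) k) := by
    rw [Module.finrank_eq_card_basis C.basis, Module.finrank_pi_fintype]
    simp [Module.finrank_matrix, Fintype.card_sigma]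
  exact (LinearMap.injective_iff_surjective_of_finrank_eq_finrank (f := C.repAll.toLinearMap)
    hdim).1 C.repAll_injective

end SemisimpleField

end CellDatum

/-! ### Central idempotents in products of matrix algebras -/

section CentralIdempotents

variable {k : Type u} [Field k] {ι : Type v} [DecidableEq ι] {P : ι → Type w}
  [∀ i, Fintype (P i)] [∀ i, DecidableEq (P i)] {A : Type u₁} [Ring A]
  (ρ : A ≃+* ∀ i, Matrix (P i) (P i) k)

theorem Pi.mul_single_one {M : ι → Type*} [∀ i, Ring (M i)] (f : ∀ i, M i) (i : ι) :
    f * Pi.single i 1 = Pi.single i (f i) := by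
  funext j
  by_cases h : j = i
  · subst h; simp
  · simp [h]

theorem Pi.single_one_mul {M : ι → Type*} [∀ i, Ring (M i)] (f : ∀ i, M i) (i : ι) :
    Pi.single i 1 * f = Pi.single i (f i) := by
  funext j
  by_cases h : j = i
  · subst h; simp
  · simp [h]

theorem isMinimalCentralIdempotent_symm_single (i : ι) [Nonempty (P i)] :
    IsMinimalCentralIdempotent (ρ.symm (Pi.single i 1)) := by
  refine ⟨?_, ?_, ?_, ?_⟩
  · rw [Semigroup.mem_center_iff]
    intro g
    apply ρ.injective
    simp only [map_mul, RingEquiv.apply_symm_apply, Pi.mul_single_one, Pi.single_one_mul]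
  · rw [← map_mul, ← Pi.single_mul, one_mul]
  · rw [Ne, EmbeddingLike.map_eq_zero_iff, Pi.single_eq_zero_iff]
    exact one_ne_zero
  · intro e hc he hle
    rw [Semigroup.mem_center_iff] at hc
    have h1 : ρ e = Pi.single i (ρ e i) := by
      rw [← Pi.mul_single_one, ← ρ.apply_symm_apply (Pi.single i 1), ← map_mul, hle]
    have h2 : ρ e i ∈ Set.center (Matrix (P i) (P i) k) := by
      rw [Semigroup.mem_center_iff]
      intro M
      have h := congrFun (congrArg ρ (hc (ρ.symm (Pi.single i M)))) i
      simpa using h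
    rw [Matrix.center_eq_range] at h2
    obtain ⟨c, hcc⟩ := h2
    have h3 : c * c = c := by
      obtain ⟨p⟩ := ‹Nonempty (P i)›
      have h := congrFun (congrArg ρ he) i
      rw [map_mul, Pi.mul_apply, ← hcc, ← map_mul] at h
      simpa using congrFun (congrFun h p) p
    rcases IsIdempotentElem.iff_eq_zero_or_one.1 h3 with rfl | rfl
    · left
      apply ρ.injective
      rw [h1, ← hcc]
      simp
    · right
      apply ρ.injective
      rw [h1, ← hcc]
      simp

theorem IsMinimalCentralIdempotent.eq_of_mul_eq {e e' : A} (he : IsMinimalCentralIdempotent e)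
    (he' : IsMinimalCentralIdempotent e') (h : e' * e = e') : e' = e :=
  (he.2.2.2 e' he'.1 he'.2.1 h).resolve_left he'.2.2.1

theorem IsMinimalCentralIdempotent.eq_of_apply_eq_one {e : A} (he : IsMinimalCentralIdempotent e)
    {i : ι} [Nonempty (P i)] (h : ρ e i = 1) : e = ρ.symm (Pi.single i 1) := by
  refine (he.eq_of_mul_eq (isMinimalCentralIdempotent_symm_single ρ i) ?_).symm
  apply ρ.injective
  rw [map_mul, RingEquiv.apply_symm_apply, Pi.single_one_mul, h]

/-- Cut `e` by the unit of a block where it is nonzero: the product is a nonzero central idempotent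
below both, so minimality identifies the two. Blocks may have size zero, hence the non-emptiness in
the conclusion; later it is read as permissibility. -/
theorem IsMinimalCentralIdempotent.exists_eq_symm_single {e : A}
    (he : IsMinimalCentralIdempotent e) :
    ∃ i, Nonempty (P i) ∧ e = ρ.symm (Pi.single i 1) := by
  have h0 : ρ e ≠ 0 := fun h => he.2.2.1 (ρ.injective (h.trans (map_zero ρ).symm))
  obtain ⟨i, hi⟩ := Function.ne_iff.1 h0
  have hP : Nonempty (P i) := by
    by_contra hP
    rw [not_nonempty_iff] at hP
    exact hi (Subsingleton.elim _ _)
  have hm := isMinimalCentralIdempotent_symm_single ρ i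
  have hc := Semigroup.mem_center_iff.1 he.1
  have hc' := Semigroup.mem_center_iff.1 hm.1
  refine ⟨i, hP, ?_⟩
  have hf := hm.2.2.2 (e * ρ.symm (Pi.single i 1))
    (Semigroup.mem_center_iff.2 fun g => by
      rw [← mul_assoc, hc, mul_assoc, hc', mul_assoc])
    (by rw [mul_assoc, ← mul_assoc _ e, hc (ρ.symm _), mul_assoc e (ρ.symm _), hm.2.1,
      ← mul_assoc, he.2.1])
    (by rw [mul_assoc, hm.2.1])
  rcases hf with hf | hf
  · refine (hi ?_).elim
    have := congrFun (congrArg ρ hf) i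
    simpa using this
  · exact (he.eq_of_mul_eq hm (by rw [hc, hf])).symm

end CentralIdempotents

/-! ### Bases adapted to a cell filtration -/

namespace CellFiltration

variable {R : Type u} {A B : Type v} [CommRing R] [Ring A] [Algebra R A] [Ring B] [Algebra R B]
  {CA : CellDatum.{u, v, w} R A} {CB : CellDatum.{u, v, w} R B} {ι : A →ₐ[R] B} {m : CB.Λ}
  (Φ : CellFiltration CA CB ι m)

theorem monotone_N : Monotone Φ.N := Fin.monotone_iff_le_succ.2 Φ.N_le

variable {P : Fin Φ.n → Type u₁} (b : ∀ i, Module.Basis (P i) R (CA.Cell (Φ.label i)))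
  {g : ∀ i, P i → CB.Cell m}
  (hg : ∀ i s, ∃ h : g i s ∈ Φ.N i.succ, Φ.proj i ⟨g i s, h⟩ = b i s)

include hg

/-- Subtracting from `x` the chosen lift of its image in the layer leaves an element of the kernel
of `proj`, which is the previous step of the filtration. -/
theorem sub_constr_mem [∀ i, Fintype (P i)] (i : Fin Φ.n) (x : CB.Cell m) (hx : x ∈ Φ.N i.succ) :
    x - (b i).constr R (g i) (Φ.proj i ⟨x, hx⟩) ∈ Φ.N i.castSucc := by
  choose h h' using hg
  have h1 : (b i).constr R (g i) (Φ.proj i ⟨x, hx⟩) =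
      ((∑ s, (b i).repr (Φ.proj i ⟨x, hx⟩) s • (⟨g i s, h i s⟩ : Φ.N i.succ) : Φ.N i.succ) :
        CB.Cell m) := by
    rw [Module.Basis.constr_apply_fintype]
    simp
  rw [h1]
  have h2 := (Φ.proj_eq_zero i (⟨x, hx⟩ -
    ∑ s, (b i).repr (Φ.proj i ⟨x, hx⟩) s • (⟨g i s, h i s⟩ : Φ.N i.succ))).1 (by
      rw [map_sub, map_sum]
      simp only [map_smul, h', Module.Basis.sum_repr, sub_self])
  exact h2

theorem le_span [∀ i, Fintype (P i)] (k : Fin (Φ.n + 1)) :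
    Φ.N k ≤ Submodule.span R {x | ∃ i s, i.castSucc < k ∧ x = g i s} := by
  induction k using Fin.induction with
  | zero => rw [Φ.N_zero]; exact bot_le
  | succ i ih =>
    intro x hx
    have h1 := Φ.sub_constr_mem b hg i x hx
    have h2 := Submodule.span_mono (R := R) (t := {x | ∃ j s, j.castSucc < i.succ ∧ x = g j s})
      (by
        rintro y ⟨j, s, hj, rfl⟩
        exact ⟨j, s, hj.trans i.castSucc_lt_succ, rfl⟩) (ih h1)
    rw [← sub_add_cancel x ((b i).constr R (g i) (Φ.proj i ⟨x, hx⟩))]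
    refine Submodule.add_mem _ h2 ?_
    rw [Module.Basis.constr_apply_fintype]
    exact Submodule.sum_mem _ fun s _ => Submodule.smul_mem _ _
      (Submodule.subset_span ⟨i, s, i.castSucc_lt_succ, rfl⟩)

theorem linearIndependent [∀ i, Fintype (P i)] :
    LinearIndependent R fun x : Σ i, P i => g x.1 x.2 := by
  classical
  rw [Fintype.linearIndependent_iff]
  intro c hc
  by_contra! hne
  obtain ⟨x₀, hx₀⟩ := hne
  -- Take the top layer `i` occurring in the relation. All other terms lie in the step below it, so
  -- projecting leaves a relation among the basis vectors of that layer alone.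
  obtain ⟨⟨i, s⟩, hx, hmax⟩ := Finset.exists_max_image
    (Finset.univ.filter fun x : Σ i, P i => c x ≠ 0) (fun x => x.1) ⟨x₀, by simpa using hx₀⟩
  simp only [Finset.mem_filter, Finset.mem_univ, true_and] at hx hmax
  choose h h' using hg
  rw [Fintype.sum_sigma, ← Finset.add_sum_erase _ _ (Finset.mem_univ i)] at hc
  have h1 : ∑ j ∈ Finset.univ.erase i, ∑ s, c ⟨j, s⟩ • g j s ∈ Φ.N i.castSucc := by
    refine Submodule.sum_mem _ fun j hj => Submodule.sum_mem _ fun s _ => ?_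
    have hji := Finset.ne_of_mem_erase hj
    by_cases hcj : c ⟨j, s⟩ = 0
    · rw [hcj, zero_smul]; exact Submodule.zero_mem _
    · have hlt : j < i := lt_of_le_of_ne (hmax _ hcj) hji
      exact Submodule.smul_mem _ _ (Φ.monotone_N (Fin.succ_le_castSucc_iff.2 hlt) (h j s))
  have h2 : ((∑ s, c ⟨i, s⟩ • (⟨g i s, h i s⟩ : Φ.N i.succ) : Φ.N i.succ) : CB.Cell m) ∈
      Φ.N i.castSucc := by
    have h3 := (Submodule.neg_mem_iff _).2 h1
    rw [← eq_neg_of_add_eq_zero_left hc] at h3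
    simpa using h3
  rw [← Φ.proj_eq_zero, map_sum] at h2
  simp only [map_smul, h'] at h2
  exact hx (Fintype.linearIndependent_iff.1 (b i).linearIndependent (fun s => c ⟨i, s⟩) h2 s)

end CellFiltration

/-- The basis of `κ → B` obtained from a basis of `κ → R` by extension of scalars. -/
noncomputable def Module.Basis.extendPi {R : Type*} [CommRing R] {ι κ : Type*} [Fintype κ]
    (b : Module.Basis ι R (κ → R)) (B : Type*) [CommRing B] [Algebra R B] :
    Module.Basis ι B (κ → B) := by
  classical
  exact (Algebra.TensorProduct.basis B b).map (TensorProduct.piScalarRight R B B κ)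

theorem Module.Basis.extendPi_apply {R : Type*} [CommRing R] {ι κ : Type*} [Fintype κ]
    (b : Module.Basis ι R (κ → R)) (B : Type*) [CommRing B] [Algebra R B] (i : ι) (v : κ) :
    b.extendPi B i v = algebraMap R B (b i v) := by
  simp [extendPi, Algebra.TensorProduct.basis_apply, Algebra.smul_def]

/-! ### Paths and Murphy bases -/

namespace DiagramTower

variable {R : Type u} {F : Type u₁} [CommRing R] [IsDomain R] [Field F] [Algebra R F]
  [IsFractionRing R F] (T : DiagramTower.{u, v, w, u₁} R F)

variable {T} in
theorem Path.snoc_edge {r : ℕ} {m : T.Λ (r + 1)} (i : Fin (T.filtration r m).n)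
    (s : T.Std r ((T.filtration r m).label i)) (k : Fin (r + 1)) :
    T.Edge k (Fin.snoc (α := fun k : Fin (r + 2) => T.Λ k) s.1.1 m k.castSucc)
      (Fin.snoc (α := fun k : Fin (r + 2) => T.Λ k) s.1.1 m k.succ) := by
  induction k using Fin.lastCases with
  | last =>
    rw [Fin.snoc_castSucc]
    change T.Edge r _ (Fin.snoc (α := fun k : Fin (r + 2) => T.Λ k) s.1.1 m (Fin.last (r + 1)))
    rw [Fin.snoc_last]
    exact ⟨i, s.2.symm⟩
  | cast j =>
    rw [Fin.snoc_castSucc]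
    change T.Edge j _
      (Fin.snoc (α := fun k : Fin (r + 2) => T.Λ k) s.1.1 m (j.succ).castSucc)
    rw [Fin.snoc_castSucc]
    exact s.1.2 j

variable {T} in
/-- Extension of a path by an edge of the branching diagram. -/
def snoc {r : ℕ} {m : T.Λ (r + 1)} (i : Fin (T.filtration r m).n)
    (s : T.Std r ((T.filtration r m).label i)) : T.Std (r + 1) m :=
  ⟨⟨Fin.snoc (α := fun k : Fin (r + 2) => T.Λ k) s.1.1 m, Path.snoc_edge i s⟩,
    Fin.snoc_last (α := fun k : Fin (r + 2) => T.Λ k) _ _⟩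

section

variable {T}

theorem snoc_castSucc {r : ℕ} {m : T.Λ (r + 1)} (i : Fin (T.filtration r m).n)
    (s : T.Std r ((T.filtration r m).label i)) (k : Fin (r + 1)) :
    (snoc i s).1.1 k.castSucc = s.1.1 k :=
  Fin.snoc_castSucc (α := fun k : Fin (r + 2) => T.Λ k) _ _ _

/-- Labels of a filtration are strictly decreasing, so branching is multiplicity free and a path
determines the index of its last edge. -/
theorem snoc_bijective (r : ℕ) (m : T.Λ (r + 1)) : Function.Bijective
    fun x : Σ i, T.Std r ((T.filtration r m).label i) => snoc x.1 x.2 := by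
  constructor
  · rintro ⟨i, s⟩ ⟨j, u⟩ h
    have h1 : s.1.1 = u.1.1 := by
      funext k
      have h2 : (snoc i s).1.1 k.castSucc = (snoc j u).1.1 k.castSucc := by
        have h3 : snoc i s = snoc j u := h
        rw [h3]
      rwa [snoc_castSucc, snoc_castSucc] at h2
    have h2 : i = j := (T.filtration r m).label_anti.injective (by rw [← s.2, ← u.2, h1])
    subst h2
    have h3 : s = u := Subtype.ext (Subtype.ext h1)
    rw [h3]
  · rintro ⟨⟨t, ht⟩, rfl⟩
    obtain ⟨i, hi⟩ := ht (Fin.last r)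
    refine ⟨⟨i, ⟨⟨fun k => t k.castSucc, fun k => ht k.castSucc⟩, hi.symm⟩⟩, ?_⟩
    refine Subtype.ext (Subtype.ext ?_)
    exact Fin.snoc_init_self (α := fun k : Fin (r + 2) => T.Λ k) t

theorem exists_eq_snoc {r : ℕ} {m : T.Λ (r + 1)} (t : T.Std (r + 1) m) :
    ∃ i s, t = snoc i s := by
  obtain ⟨⟨i, s⟩, h⟩ := (snoc_bijective r m).2 t
  exact ⟨i, s, h.symm⟩

theorem snoc_ne_of_ne {r : ℕ} {m : T.Λ (r + 1)} {i : Fin (T.filtration r m).n}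
    {s u : T.Std r ((T.filtration r m).label i)} : snoc i s ≠ snoc i u ↔ s ≠ u := by
  refine not_congr ⟨fun h => ?_, fun h => h ▸ rfl⟩
  have := (snoc_bijective r m).1 (a₁ := ⟨i, s⟩) (a₂ := ⟨i, u⟩) h
  simpa using this

variable (T) in
/-- The paths to `m` decomposed according to their last edge. -/
noncomputable def snocEquiv (r : ℕ) (m : T.Λ (r + 1)) :
    (Σ i, T.Std r ((T.filtration r m).label i)) ≃ T.Std (r + 1) m :=
  Equiv.ofBijective _ (snoc_bijective r m)

theorem snocEquiv_symm_snoc {r : ℕ} {m : T.Λ (r + 1)} (i : Fin (T.filtration r m).n)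
    (s : T.Std r ((T.filtration r m).label i)) : (T.snocEquiv r m).symm (snoc i s) = ⟨i, s⟩ :=
  (T.snocEquiv r m).symm_apply_apply ⟨i, s⟩

variable (T) in
/-- The path of length zero. -/
def nil (l : T.Λ 0) : T.Std 0 l :=
  ⟨⟨fun k => match k with | ⟨0, _⟩ => l, fun k => k.elim0⟩, rfl⟩

theorem eq_nil {l : T.Λ 0} (t : T.Std 0 l) : t = T.nil l := by
  refine Subtype.ext (Subtype.ext (funext fun k => ?_))
  obtain rfl : k = Fin.last 0 := Fin.eq_zero k
  exact t.2

theorem dPath_nil (l : T.Λ 0) : T.dPath (T.nil l) = 1 := rfl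

theorem dPath_snoc {r : ℕ} {m : T.Λ (r + 1)} (i : Fin (T.filtration r m).n)
    (s : T.Std r ((T.filtration r m).label i)) :
    T.dPath (snoc i s) = T.d r ((T.filtration r m).label i) m * T.ι r (T.dPath s) := by
  have h1 : (snoc i s).1.1 (Fin.last r).castSucc = (T.filtration r m).label i := by
    rw [snoc_castSucc]; exact s.2
  have h2 : (snoc i s).1.1 (Fin.last (r + 1)) = m := (snoc i s).2
  have h3 : (fun k : Fin (r + 1) => (snoc i s).1.1 k.castSucc) = s.1.1 :=
    funext fun k => snoc_castSucc i s k
  change T.d r _ _ * T.ι r (T.dSeq r fun k => (snoc i s).1.1 k.castSucc) = _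
  rw [h1, h2, h3]
  rfl

theorem gz_nil (l : T.Λ 0) : T.gz (T.nil l) = T.z 0 l := rfl

theorem gz_snoc {r : ℕ} {m : T.Λ (r + 1)} (i : Fin (T.filtration r m).n)
    (s : T.Std r ((T.filtration r m).label i)) :
    T.gz (snoc i s) = T.ιBase F r (T.gz s) * T.z (r + 1) m := by
  have h2 : (snoc i s).1.1 (Fin.last (r + 1)) = m := (snoc i s).2
  have h3 : (fun k : Fin (r + 1) => (snoc i s).1.1 k.castSucc) = s.1.1 :=
    funext fun k => snoc_castSucc i s k
  change T.ιBase F r (towerProd (fun r => (T.ιBase F r).toRingHom) T.z r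
    fun k => (snoc i s).1.1 k.castSucc) * T.z (r + 1) _ = _
  rw [h2, h3]
  rfl

variable (T) in
/-- The last edge of a path together with the truncated path. -/
noncomputable def lastStep (r : ℕ) (m : T.Λ (r + 1)) (t : T.Std (r + 1) m) :
    Σ' i, T.Std r ((T.filtration r m).label i) :=
  (Equiv.psigmaEquivSigma _).symm ((T.snocEquiv r m).symm t)

theorem lastStep_snoc {r : ℕ} {m : T.Λ (r + 1)} (i : Fin (T.filtration r m).n)
    (s : T.Std r ((T.filtration r m).label i)) : T.lastStep r m (snoc i s) = ⟨i, s⟩ := by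
  rw [lastStep, snocEquiv_symm_snoc]
  rfl

/-- A path precedes another one of the same shape if, at the last vertex where they differ, it is
larger. -/
def precedes : ∀ (r : ℕ) (l : T.Λ r), T.Std r l → T.Std r l → Prop
  | 0, _ => fun _ _ => False
  | r + 1, m => InvImage
      (PSigma.Lex (· < ·) fun i => precedes r ((T.filtration r m).label i)) (T.lastStep r m)

theorem precedes_wf (r : ℕ) (l : T.Λ r) : WellFounded (precedes r l) := by
  induction r with
  | zero => exact ⟨fun a => ⟨a, fun _ h => h.elim⟩⟩
  | succ r ih => exact InvImage.wf _ (WellFounded.psigma_lex wellFounded_lt fun i => ih _)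

theorem precedes_snoc_of_lt {r : ℕ} {m : T.Λ (r + 1)} {i j : Fin (T.filtration r m).n}
    (h : i < j) (s : T.Std r ((T.filtration r m).label i))
    (u : T.Std r ((T.filtration r m).label j)) : precedes (r + 1) m (snoc i s) (snoc j u) := by
  unfold precedes InvImage
  rw [lastStep_snoc, lastStep_snoc]
  exact PSigma.Lex.left _ _ h

theorem precedes_snoc {r : ℕ} {m : T.Λ (r + 1)} {i : Fin (T.filtration r m).n}
    {s u : T.Std r ((T.filtration r m).label i)} (h : precedes r _ s u) :
    precedes (r + 1) m (snoc i s) (snoc i u) := by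
  unfold precedes InvImage
  rw [lastStep_snoc, lastStep_snoc]
  exact PSigma.Lex.right _ h

/-- `δ(m) d` lifts the generator of the layer and `proj` is linear over `A_r`, so acting by `d_s`
lifts `m_s`. Hence the Murphy vectors of level `r + 1` lift those of level `r` layer by layer. -/
theorem murphyCell_snoc_mem {r : ℕ} {m : T.Λ (r + 1)} (i : Fin (T.filtration r m).n)
    (s : T.Std r ((T.filtration r m).label i)) :
    ∃ h : T.murphyCell (snoc i s) ∈ (T.filtration r m).N i.succ,
      (T.filtration r m).proj i ⟨_, h⟩ = T.murphyCell s := by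
  obtain ⟨h, h'⟩ := T.d_spec r m i
  have h1 : T.murphyCell (snoc i s) = (T.C (r + 1)).act
      ((T.C (r + 1)).act (T.δ (r + 1) m) (T.d r ((T.filtration r m).label i) m))
      (T.ι r (T.dPath s)) := by
    rw [murphyCell, dPath_snoc, CellDatum.act_mul]
  refine ⟨h1 ▸ (T.filtration r m).N_act i.succ _ _ h, ?_⟩
  simp only [h1]
  have h2 := (T.filtration r m).proj_act i ⟨_, h⟩ (T.dPath s)
  rw [h'] at h2
  exact h2

variable (T) in
theorem exists_murphyBasis (r : ℕ) (l : T.Λ r) :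
    ∃ b : Module.Basis (T.Std r l) R ((T.C r).Cell l), ∀ t, b t = T.murphyCell t := by
  induction r with
  | zero =>
    have hli : LinearIndependent R fun t : T.Std 0 l => T.murphyCell t := by
      rw [Fintype.linearIndependent_iff]
      intro c hc t
      have hu : (Finset.univ : Finset (T.Std 0 l)) = {T.nil l} :=
        Finset.eq_singleton_iff_unique_mem.2 ⟨Finset.mem_univ _, fun t _ => eq_nil t⟩
      rw [hu, Finset.sum_singleton, murphyCell, dPath_nil, CellDatum.act_one] at hc
      rw [eq_nil t]
      obtain ⟨v⟩ := (T.C 0).nonemptyTab l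
      -- In level zero only `c δ = 0` has to be excluded; moving `δ` to the constant vector 1
      -- exhibits `c` as a coordinate.
      obtain ⟨a, ha⟩ := T.δ_generates 0 l (fun _ => 1)
      have h1 := congrArg (fun x => (T.C 0).act x a) hc
      simp only [CellDatum.smul_act, ha] at h1
      have h2 := congrFun h1 v
      simpa [CellDatum.act] using h2
    refine ⟨Module.Basis.mk hli ?_, fun t => Module.Basis.mk_apply _ _ _⟩
    intro x _
    obtain ⟨a, rfl⟩ := T.δ_generates 0 l x
    obtain ⟨c, rfl⟩ := T.zero_bijective.2 a
    rw [Algebra.algebraMap_eq_smul_one, CellDatum.act_smul]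
    exact Submodule.smul_mem _ _ (Submodule.subset_span ⟨T.nil l, rfl⟩)
  | succ r ih =>
    choose b hb using ih
    have hg : ∀ i s, ∃ h : T.murphyCell (snoc (m := l) i s) ∈ (T.filtration r l).N i.succ,
        (T.filtration r l).proj i ⟨_, h⟩ = b _ s := fun i s => by
      obtain ⟨h, h'⟩ := murphyCell_snoc_mem i s
      exact ⟨h, h'.trans (hb _ s).symm⟩
    have hli := (T.filtration r l).linearIndependent (fun i => b _)
      (g := fun i s => T.murphyCell (snoc i s)) hg
    have hli' : LinearIndependent R fun t : T.Std (r + 1) l => T.murphyCell t :=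
      (linearIndependent_equiv (T.snocEquiv r l)).1 hli
    refine ⟨Module.Basis.mk hli' ?_, fun t => Module.Basis.mk_apply _ _ _⟩
    have h := (T.filtration r l).le_span (fun i => b _)
      (g := fun i s => T.murphyCell (snoc i s)) hg (Fin.last _)
    rw [(T.filtration r l).N_last] at h
    refine h.trans (Submodule.span_mono ?_)
    rintro x ⟨i, s, -, rfl⟩
    exact ⟨_, rfl⟩

variable (T) in
/-- The Murphy basis of a cell module. -/
noncomputable def murphyBasis (r : ℕ) (l : T.Λ r) :
    Module.Basis (T.Std r l) R ((T.C r).Cell l) := (T.exists_murphyBasis r l).choose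

theorem murphyBasis_apply {r : ℕ} {l : T.Λ r} (t : T.Std r l) :
    T.murphyBasis r l t = T.murphyCell t := (T.exists_murphyBasis r l).choose_spec t

variable (T) in
/-- The Murphy basis of a specialization of a cell module. -/
noncomputable def murphyBase (B : Type u₂) [CommRing B] [Algebra R B] (r : ℕ) (l : T.Λ r) :
    Module.Basis (T.Std r l) B (((T.C r).baseChange B).Cell l) :=
  (T.murphyBasis r l).extendPi B

section

variable (B : Type u₂) [CommRing B] [Algebra R B]

theorem murphyBase_apply {r : ℕ} {l : T.Λ r} (t : T.Std r l) :
    T.murphyBase B r l t = (T.C r).extend B (T.murphyCell t) := by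
  funext v
  rw [← murphyBasis_apply]
  exact Module.Basis.extendPi_apply _ _ _ _

theorem murphyBase_eq_act {r : ℕ} {l : T.Λ r} (t : T.Std r l) :
    T.murphyBase B r l t =
      ((T.C r).baseChange B).act ((T.C r).extend B (T.δ r l)) (1 ⊗ₜ[R] T.dPath t) := by
  rw [murphyBase_apply, CellDatum.act_extend_tmul, murphyCell]

variable {B} {B' : Type u₃} [CommRing B'] [Algebra R B'] (g : B →ₐ[R] B')

theorem specializeCell_murphyBase {r : ℕ} {l : T.Λ r} (t : T.Std r l) :
    (T.C r).specializeCell g (T.murphyBase B r l t) = T.murphyBase B' r l t := by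
  rw [murphyBase_apply, murphyBase_apply, CellDatum.specializeCell_extend]

theorem repr_specializeCell {r : ℕ} {l : T.Λ r} (x : ((T.C r).baseChange B).Cell l)
    (t : T.Std r l) : (T.murphyBase B' r l).repr ((T.C r).specializeCell g x) t =
      g ((T.murphyBase B r l).repr x t) := by
  conv_lhs => rw [← (T.murphyBase B r l).sum_repr x]
  rw [CellDatum.specializeCell_sum]
  simp only [CellDatum.specializeCell_smul, specializeCell_murphyBase]
  rw [Module.Basis.repr_sum_self]

end

/-! ### Triangular congruences along an edge -/

section

variable (B : Type u₂) [CommRing B] [Algebra R B]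

variable (T) in
/-- The map `m_s ↦ m_{s → m}` of cell modules. -/
noncomputable def murphyLift {r : ℕ} (m : T.Λ (r + 1)) (i : Fin (T.filtration r m).n) :
    ((T.C r).baseChange B).Cell ((T.filtration r m).label i) →ₗ[B]
      ((T.C (r + 1)).baseChange B).Cell m :=
  (T.murphyBase B r ((T.filtration r m).label i)).constr B
    fun s => T.murphyBase B (r + 1) m (snoc i s)

theorem murphyLift_murphyBase {r : ℕ} {m : T.Λ (r + 1)} (i : Fin (T.filtration r m).n)
    (s : T.Std r ((T.filtration r m).label i)) :
    T.murphyLift B m i (T.murphyBase B r _ s) = T.murphyBase B (r + 1) m (snoc i s) :=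
  Module.Basis.constr_basis _ _ _ _

/-- By linearity it suffices to take `a` in `A_r`. There, `proj` sends `δ(m) d a` to `δ(l) a`, so it
differs from the Murphy lift only by terms in earlier layers. -/
theorem act_d_mul_sub_mem {r : ℕ} {m : T.Λ (r + 1)} (i : Fin (T.filtration r m).n)
    (a : B ⊗[R] T.A r) :
    ((T.C (r + 1)).baseChange B).act ((T.C (r + 1)).extend B (T.δ (r + 1) m))
        ((1 ⊗ₜ[R] T.d r ((T.filtration r m).label i) m) * T.ιBase B r a) -
      T.murphyLift B m i (((T.C r).baseChange B).act
        ((T.C r).extend B (T.δ r ((T.filtration r m).label i))) a) ∈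
      Submodule.span B {x | ∃ j s, j < i ∧ x = T.murphyBase B (r + 1) m (snoc j s)} := by
  induction a using TensorProduct.induction_on with
  | zero =>
    rw [map_zero, mul_zero, CellDatum.act_zero, CellDatum.act_zero, map_zero, sub_zero]
    exact Submodule.zero_mem _
  | add x y hx hy =>
    rw [map_add, mul_add, CellDatum.act_add, CellDatum.act_add, map_add, add_sub_add_comm]
    exact Submodule.add_mem _ hx hy
  | tmul b a =>
    obtain ⟨h, h'⟩ := T.d_spec r m i
    have h1 := (T.filtration r m).proj_act i ⟨_, h⟩ a
    rw [h'] at h1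
    have hg : ∀ i s, ∃ h : T.murphyCell (snoc (m := m) i s) ∈ (T.filtration r m).N i.succ,
        (T.filtration r m).proj i ⟨_, h⟩ = T.murphyBasis r _ s := fun i s => by
      obtain ⟨h, h'⟩ := murphyCell_snoc_mem i s
      exact ⟨h, h'.trans (murphyBasis_apply s).symm⟩
    have h2 := (T.filtration r m).le_span (fun i => T.murphyBasis r _)
      (g := fun i s => T.murphyCell (snoc i s)) hg _
      ((T.filtration r m).sub_constr_mem (fun i => T.murphyBasis r _)
      (g := fun i s => T.murphyCell (snoc i s)) hg i _ ((T.filtration r m).N_act i.succ _ a h))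
    rw [h1, ← CellDatum.act_mul] at h2
    -- The congruence is known over `R`. It remains that extension of scalars preserves the span of
    -- earlier layers and commutes with the Murphy lift (`h5`).
    have h3 : ∀ x ∈ Submodule.span R {x | ∃ j s, j.castSucc < i.castSucc ∧
          x = T.murphyCell (snoc (m := m) j s)},
        (T.C (r + 1)).extend B x ∈ Submodule.span B
          {x | ∃ j s, j < i ∧ x = T.murphyBase B (r + 1) m (snoc j s)} := by
      intro x hx
      induction hx using Submodule.span_induction with
      | mem x hx =>
        obtain ⟨j, s, hj, rfl⟩ := hx
        rw [← murphyBase_apply]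
        exact Submodule.subset_span ⟨j, s, Fin.castSucc_lt_castSucc_iff.1 hj, rfl⟩
      | zero => rw [CellDatum.extend_zero]; exact Submodule.zero_mem _
      | add x y _ _ hx hy => rw [CellDatum.extend_add]; exact Submodule.add_mem _ hx hy
      | smul c x _ hx => rw [CellDatum.extend_smul]; exact Submodule.smul_mem _ _ hx
    have h4 := h3 _ h2
    have h5 : ∀ y : (T.C r).Cell ((T.filtration r m).label i),
        (T.C (r + 1)).extend B ((T.murphyBasis r _).constr R
          (fun s => T.murphyCell (snoc i s)) y) = T.murphyLift B m i ((T.C r).extend B y) := by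
      intro y
      conv_rhs => rw [← (T.murphyBasis r _).sum_repr y]
      rw [Module.Basis.constr_apply_fintype, CellDatum.extend_sum, CellDatum.extend_sum, map_sum]
      refine Finset.sum_congr rfl fun s _ => ?_
      rw [CellDatum.extend_smul, CellDatum.extend_smul, map_smul, murphyBasis_apply,
        ← murphyBase_apply, ← murphyBase_apply, murphyLift_murphyBase]
      simp
    rw [CellDatum.extend_sub, h5] at h4
    have h6 : (b ⊗ₜ[R] a : B ⊗[R] T.A r) = b • (1 ⊗ₜ[R] a) := by
      rw [TensorProduct.smul_tmul', smul_eq_mul, mul_one]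
    rw [h6, map_smul, mul_smul_comm, CellDatum.act_smul, CellDatum.act_smul, map_smul, ← smul_sub]
    refine Submodule.smul_mem _ _ ?_
    rw [CellDatum.act_extend_tmul, Algebra.TensorProduct.map_tmul, AlgHom.id_apply,
      Algebra.TensorProduct.tmul_mul_tmul, mul_one, CellDatum.act_extend_tmul]
    exact h4

variable (T) in
/-- The span of the Murphy basis elements preceding a given one. -/
noncomputable def higher {r : ℕ} {l : T.Λ r} (t : T.Std r l) :
    Submodule B (((T.C r).baseChange B).Cell l) :=
  Submodule.span B {x | ∃ s, precedes r l s t ∧ x = T.murphyBase B r l s}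

theorem murphyLift_mem_higher {r : ℕ} {m : T.Λ (r + 1)} (i : Fin (T.filtration r m).n)
    (s : T.Std r ((T.filtration r m).label i)) {x : ((T.C r).baseChange B).Cell _}
    (hx : x ∈ T.higher B s) : T.murphyLift B m i x ∈ T.higher B (snoc i s) := by
  induction hx using Submodule.span_induction with
  | mem x hx =>
    obtain ⟨u, hu, rfl⟩ := hx
    rw [murphyLift_murphyBase]
    exact Submodule.subset_span ⟨_, precedes_snoc hu, rfl⟩
  | zero => rw [map_zero]; exact Submodule.zero_mem _
  | add x y _ _ hx hy => rw [map_add]; exact Submodule.add_mem _ hx hy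
  | smul c x _ hx => rw [map_smul]; exact Submodule.smul_mem _ _ hx

/-- The inductive step behind every triangularity statement. Errors from earlier layers precede
`snoc i s` by their last edge, and errors within layer `i` precede it because they do so at level
`r`. The case `c = 1` gives the seminormal vectors, `c = 0` the reduction of non-permissible paths.
-/
theorem act_d_mul_sub_mem_higher {r : ℕ} {m : T.Λ (r + 1)} (i : Fin (T.filtration r m).n)
    (s : T.Std r ((T.filtration r m).label i)) (a : B ⊗[R] T.A r) (c : B)
    (h : ((T.C r).baseChange B).act ((T.C r).extend B (T.δ r ((T.filtration r m).label i))) a -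
      c • T.murphyBase B r _ s ∈ T.higher B s) :
    ((T.C (r + 1)).baseChange B).act ((T.C (r + 1)).extend B (T.δ (r + 1) m))
        ((1 ⊗ₜ[R] T.d r ((T.filtration r m).label i) m) * T.ιBase B r a) -
      c • T.murphyBase B (r + 1) m (snoc i s) ∈ T.higher B (snoc i s) := by
  have h1 := act_d_mul_sub_mem B i a
  have h2 := murphyLift_mem_higher B i s h
  rw [map_sub, map_smul, murphyLift_murphyBase] at h2
  have h3 : Submodule.span B {x | ∃ j s, j < i ∧ x = T.murphyBase B (r + 1) m (snoc j s)} ≤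
      T.higher B (snoc i s) := by
    refine Submodule.span_mono ?_
    rintro x ⟨j, u, hj, rfl⟩
    exact ⟨_, precedes_snoc_of_lt hj u s, rfl⟩
  have h4 := Submodule.add_mem _ (h3 h1) h2
  rwa [sub_add_sub_cancel] at h4

end

end

end DiagramTower

theorem IsSplitSemisimple.isSemisimpleRing {k : Type u} {A : Type v} [Field k] [Ring A]
    [Algebra k A] (h : IsSplitSemisimple k A) : IsSemisimpleRing A := by
  obtain ⟨n, d, -, ⟨e⟩⟩ := h
  exact e.symm.toRingEquiv.isSemisimpleRing

/-! ### Separation by cell modules and central idempotents -/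

namespace CellDatum

section

variable {k : Type u} {A : Type v} [CommRing k] [Ring A] [Algebra k A]
  (C : CellDatum.{u, v, w} k A)

theorem rep_ext {l : C.Λ} {a b : A} (h : ∀ x : C.Cell l, C.act x a = C.act x b) :
    C.rep l a = C.rep l b := by
  classical
  ext t v
  have h1 := congrFun (h (Pi.single t 1)) v
  simpa [act, Pi.single_apply, rep_apply] using h1

open Classical in
theorem act_of_rep_eq_one {l : C.Λ} {a : A} (h : C.rep l a = 1) (x : C.Cell l) :
    C.act x a = x := by
  rw [act_eq_vecMul, h, Matrix.vecMul_one]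

theorem bilin_sub_left {l : C.Λ} (x y z : C.Cell l) :
    C.bilin (x - y) z = C.bilin x z - C.bilin y z := by
  simp [bilin, sub_mul, Finset.sum_sub_distrib]

theorem bilin_act_right {l : C.Λ} (x y : C.Cell l) (a : A) :
    C.bilin x (C.act y a) = C.bilin (C.act x (C.inv a)) y := by
  rw [bilin_act_left, C.inv_inv]

end

section

variable {k : Type u} {A : Type v} [Field k] [Ring A] [Algebra k A]
  (C : CellDatum.{u, v, w} k A) [IsSemisimpleRing A]

include C in
theorem eq_of_act_eq {a b : A} (h : ∀ (l : C.Λ) (x : C.Cell l), C.act x a = C.act x b) :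
    a = b :=
  C.repAll_injective (funext fun l => C.rep_ext (h l))

theorem eq_of_bilin_eq {l : C.Λ} {x y : C.Cell l} (h : ∀ z, C.bilin x z = C.bilin y z) :
    x = y := by
  by_contra hne
  obtain ⟨z, hz⟩ := C.exists_bilin_ne_zero (sub_ne_zero.2 hne)
  rw [bilin_sub_left, h, sub_self] at hz
  exact hz rfl

open Classical in
/-- The isomorphism of a semisimple cellular algebra with a product of matrix algebras. -/
noncomputable def repEquiv : A ≃+* ∀ l : C.Λ, Matrix (C.Tab l) (C.Tab l) k :=
  RingEquiv.ofBijective C.repAll C.repAll_bijective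

theorem exists_isMinimalCentralIdempotent (l : C.Λ) :
    ∃ e : A, IsMinimalCentralIdempotent e ∧ ∀ x : C.Cell l, C.act x e = x := by
  classical
  refine ⟨C.repEquiv.symm (Pi.single l 1), isMinimalCentralIdempotent_symm_single _ l,
    C.act_of_rep_eq_one ?_⟩
  have h := congrFun (C.repEquiv.apply_symm_apply (Pi.single l 1)) l
  rw [Pi.single_eq_same] at h
  exact h

theorem act_of_ne_of_isMinimalCentralIdempotent {l m : C.Λ} (hlm : m ≠ l) {e : A}
    (he : IsMinimalCentralIdempotent e) (h : ∀ x : C.Cell l, C.act x e = x) (x : C.Cell m) :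
    C.act x e = 0 := by
  classical
  have h1 : C.rep l e = 1 := by
    rw [← map_one (C.rep l)]
    exact C.rep_ext fun x => by rw [h, act_one]
  have h2 := he.eq_of_apply_eq_one C.repEquiv (i := l) h1
  have h3 : C.rep m e = 0 := by
    have h4 := congrFun (C.repEquiv.apply_symm_apply (Pi.single l 1)) m
    rw [← h2, Pi.single_eq_of_ne hlm] at h4
    exact h4
  rw [act_eq_vecMul, h3, Matrix.vecMul_zero]

end

end CellDatum

/-! ### Central and Gelfand-Zeitlin idempotents over the fraction field -/

namespace DiagramTower

variable {R : Type u} {F : Type u₁} [CommRing R] [IsDomain R] [Field F] [Algebra R F]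
  [IsFractionRing R F] {T : DiagramTower.{u, v, w, u₁} R F}

instance (r : ℕ) : IsSemisimpleRing (F ⊗[R] T.A r) := (T.semisimple r).isSemisimpleRing

section CentralIdempotents

theorem z_spec (r : ℕ) (l : T.Λ r) : IsMinimalCentralIdempotent (T.z r l) ∧
    ∀ x : (T.CF r).Cell l, (T.CF r).act x (T.z r l) = x :=
  Classical.epsilon_spec (p := fun e : F ⊗[R] T.A r => IsMinimalCentralIdempotent e ∧
    ∀ x : (T.CF r).Cell l, (T.CF r).act x e = x) ((T.CF r).exists_isMinimalCentralIdempotent l)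

variable {r : ℕ} {l m : T.Λ r}

theorem act_z (x : (T.CF r).Cell l) : (T.CF r).act x (T.z r l) = x := (z_spec r l).2 x

theorem act_z_of_ne (h : m ≠ l) (x : (T.CF r).Cell m) : (T.CF r).act x (T.z r l) = 0 :=
  (T.CF r).act_of_ne_of_isMinimalCentralIdempotent h (z_spec r l).1 (z_spec r l).2 x

theorem mul_z_comm (a : F ⊗[R] T.A r) : a * T.z r l = T.z r l * a :=
  Semigroup.mem_center_iff.1 (z_spec r l).1.1 a

theorem z_mul_self : T.z r l * T.z r l = T.z r l := (z_spec r l).1.2.1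

theorem z_mul_z_of_ne (h : l ≠ m) : T.z r l * T.z r m = 0 := by
  refine (T.CF r).eq_of_act_eq fun n x => ?_
  rw [CellDatum.act_mul, CellDatum.act_zero]
  by_cases hn : n = l
  · subst hn; rw [act_z, act_z_of_ne h]
  · rw [act_z_of_ne hn, (T.CF r).act_eq_vecMul, Matrix.zero_vecMul]

/-- `z` acts on each cell module by 0 or 1, hence is self-adjoint, and the adjoint of an element is
its image under `*`. Non-degeneracy and faithfulness conclude. -/
theorem inv_z : (T.CF r).inv (T.z r l) = T.z r l := by
  refine (T.CF r).eq_of_act_eq fun n x => (T.CF r).eq_of_bilin_eq fun y => ?_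
  rw [CellDatum.bilin_act_left, CellDatum.inv_inv]
  by_cases hn : n = l
  · subst hn; rw [act_z, act_z]
  · rw [act_z_of_ne hn, act_z_of_ne hn, CellDatum.bilin_zero_right]
    simp [CellDatum.bilin]

end CentralIdempotents

section GelfandZeitlin

theorem inv_ιBase (B : Type u₂) [CommRing B] [Algebra R B] (r : ℕ) (a : B ⊗[R] T.A r) :
    ((T.C (r + 1)).baseChange B).inv (T.ιBase B r a) =
      T.ιBase B r (((T.C r).baseChange B).inv a) := by
  induction a using TensorProduct.induction_on with
  | zero => simp
  | add x y h h' => simp only [map_add, h, h']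
  | tmul b a => simp [T.ι_inv]

variable {r : ℕ} {l m : T.Λ r}

theorem gz_mul_z (t : T.Std r l) : T.gz t * T.z r l = T.gz t := by
  cases r with
  | zero => rw [eq_nil t, gz_nil, z_mul_self]
  | succ r =>
    obtain ⟨i, s, rfl⟩ := exists_eq_snoc t
    rw [gz_snoc, mul_assoc, z_mul_self]

theorem z_mul_gz (t : T.Std r l) : T.z r l * T.gz t = T.gz t := by
  rw [← mul_z_comm, gz_mul_z]

theorem gz_mul_self (t : T.Std r l) : T.gz t * T.gz t = T.gz t := by
  induction r with
  | zero => rw [eq_nil t, gz_nil, z_mul_self]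
  | succ r ih =>
    obtain ⟨i, s, rfl⟩ := exists_eq_snoc t
    rw [gz_snoc, mul_assoc, ← mul_assoc (T.z _ _), ← mul_z_comm, mul_assoc, z_mul_self,
      ← mul_assoc, ← map_mul, ih]

theorem gz_mul_gz_of_shape_ne (h : l ≠ m) (s : T.Std r l) (t : T.Std r m) :
    T.gz s * T.gz t = 0 := by
  rw [← gz_mul_z s, ← z_mul_gz t, mul_assoc, ← mul_assoc (T.z _ _), z_mul_z_of_ne h, zero_mul,
    mul_zero]

theorem ιBase_gz_mul_gz_snoc {m : T.Λ (r + 1)} (s : T.Std r l) (i : Fin (T.filtration r m).n)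
    (u : T.Std r ((T.filtration r m).label i)) :
    T.ιBase F r (T.gz s) * T.gz (snoc i u) =
      T.ιBase F r (T.gz s * T.gz u) * T.z (r + 1) m := by
  rw [gz_snoc, ← mul_assoc, map_mul]

/-- Central factors pull out and leave the product for the truncated paths. These either have
different shapes, so that their central idempotents are orthogonal, or are distinct of the same
shape, where induction applies. -/
theorem gz_mul_gz_of_ne {s t : T.Std r l} (h : s ≠ t) : T.gz s * T.gz t = 0 := by
  induction r with
  | zero => exact (h ((eq_nil s).trans (eq_nil t).symm)).elim
  | succ r ih =>
    obtain ⟨i, s, rfl⟩ := exists_eq_snoc s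
    obtain ⟨j, t, rfl⟩ := exists_eq_snoc t
    rw [gz_snoc, mul_assoc, ← mul_z_comm, ← mul_assoc, ιBase_gz_mul_gz_snoc]
    suffices hst : T.gz s * T.gz t = 0 by rw [hst, map_zero, zero_mul, zero_mul]
    by_cases hij : i = j
    · subst hij
      exact ih (snoc_ne_of_ne.1 h)
    · exact gz_mul_gz_of_shape_ne (fun h => hij ((T.filtration r l).label_anti.injective h)) s t

theorem inv_gz (t : T.Std r l) : (T.CF r).inv (T.gz t) = T.gz t := by
  induction r with
  | zero => rw [eq_nil t, gz_nil, inv_z]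
  | succ r ih =>
    obtain ⟨i, s, rfl⟩ := exists_eq_snoc t
    rw [gz_snoc, CellDatum.inv_mul, inv_z, inv_ιBase, ih, ← mul_z_comm]

theorem act_gz_of_ne (h : m ≠ l) (x : (T.CF r).Cell m) (t : T.Std r l) :
    (T.CF r).act x (T.gz t) = 0 := by
  rw [← z_mul_gz, CellDatum.act_mul, act_z_of_ne h, (T.CF r).act_eq_vecMul, Matrix.zero_vecMul]

theorem act_gzUnit_of_ne (h : m ≠ l) (x : (T.CF r).Cell m) (s t : T.Std r l) :
    (T.CF r).act x (T.gzUnit s t) = 0 := by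
  rw [gzUnit, CellDatum.act_mul, act_gz_of_ne h]

end GelfandZeitlin

section Triangularity

variable (B : Type u₂) [CommRing B] [Algebra R B] {r : ℕ} {l : T.Λ r}

theorem repr_eq_zero_of_mem_higher {t : T.Std r l} {x : ((T.C r).baseChange B).Cell l}
    (hx : x ∈ T.higher B t) : (T.murphyBase B r l).repr x t = 0 := by
  induction hx using Submodule.span_induction with
  | mem x hx =>
    obtain ⟨s, hs, rfl⟩ := hx
    rw [Module.Basis.repr_self, Finsupp.single_eq_of_ne]
    rintro rfl
    exact (precedes_wf r l).irrefl.irrefl _ hs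
  | zero => simp
  | add x y _ _ hx hy => simp [hx, hy]
  | smul c x _ hx => simp [hx]

/-- Well-founded induction on paths in the form used for all spanning statements: it is enough to
obtain each Murphy vector from the preceding ones. -/
theorem eq_top_of_higher_le (V : Submodule B (((T.C r).baseChange B).Cell l))
    (h : ∀ t : T.Std r l, T.higher B t ≤ V → T.murphyBase B r l t ∈ V) : V = ⊤ := by
  have h1 : ∀ t : T.Std r l, T.murphyBase B r l t ∈ V := by
    intro t
    induction t using (precedes_wf r l).induction with
    | _ t ih =>
      refine h t (Submodule.span_le.2 ?_)
      rintro x ⟨s, hs, rfl⟩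
      exact ih s hs
  rw [eq_top_iff, ← (T.murphyBase B r l).span_eq, Submodule.span_le]
  rintro x ⟨t, rfl⟩
  exact h1 t

theorem one_tmul_dPath_snoc {m : T.Λ (r + 1)} (i : Fin (T.filtration r m).n)
    (s : T.Std r ((T.filtration r m).label i)) :
    (1 ⊗ₜ[R] T.dPath (snoc i s) : B ⊗[R] T.A (r + 1)) =
      (1 ⊗ₜ[R] T.d r ((T.filtration r m).label i) m) * T.ιBase B r (1 ⊗ₜ[R] T.dPath s) := by
  simp [dPath_snoc]

/-- Modulo `A^{▷ l}`, which acts by zero, `m_l` is `α⁻¹(δ^* ⊗ δ)`, a rank-one operator. The elements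
`m_{st}` inherit this. -/
theorem act_M (x : ((T.C r).baseChange B).Cell l) :
    ((T.C r).baseChange B).act x (1 ⊗ₜ[R] T.M r l) =
      ((T.C r).baseChange B).bilin x ((T.C r).extend B (T.δ r l)) •
        (T.C r).extend B (T.δ r l) := by
  rw [← CellDatum.act_alphaInv, CellDatum.alphaInv_extend]
  refine CellDatum.act_congr _ x (CellDatum.mkQ_eq _ |>.2 ?_)
  rw [← TensorProduct.tmul_sub]
  exact (T.C r).tmul_mem_above B 1 (T.M_lift r l)

theorem act_murphy (x : ((T.C r).baseChange B).Cell l) (s t : T.Std r l) :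
    ((T.C r).baseChange B).act x (1 ⊗ₜ[R] T.murphy s t) =
      ((T.C r).baseChange B).bilin x (T.murphyBase B r l s) • T.murphyBase B r l t := by
  have h : (1 ⊗ₜ[R] T.murphy s t : B ⊗[R] T.A r) =
      ((T.C r).baseChange B).inv (1 ⊗ₜ[R] T.dPath s) * (1 ⊗ₜ[R] T.M r l) *
        (1 ⊗ₜ[R] T.dPath t) := by
    simp [murphy]
  rw [h, CellDatum.act_mul, CellDatum.act_mul, act_M, CellDatum.smul_act, ← murphyBase_eq_act,
    CellDatum.bilin_act_left, CellDatum.inv_inv, ← murphyBase_eq_act]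

end Triangularity

/-! ### Seminormal bases over the fraction field -/

section Seminormal

variable {r : ℕ} {l m : T.Λ r}

theorem seminormal_eq_act (t : T.Std r l) :
    T.seminormal t = (T.CF r).act (T.murphyBase F r l t) (T.gz t) := by
  rw [murphyBase_apply]
  rfl

theorem seminormal_eq_act_δ (t : T.Std r l) :
    T.seminormal t = (T.CF r).act ((T.C r).extend F (T.δ r l)) ((1 ⊗ₜ[R] T.dPath t) * T.gz t) := by
  rw [seminormal_eq_act, murphyBase_eq_act, CellDatum.act_mul]

theorem seminormal_sub_mem_higher (t : T.Std r l) :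
    T.seminormal t - T.murphyBase F r l t ∈ T.higher F t := by
  induction r with
  | zero =>
    obtain rfl := eq_nil t
    rw [seminormal_eq_act, gz_nil, act_z, sub_self]
    exact Submodule.zero_mem _
  | succ r ih =>
    obtain ⟨i, s, rfl⟩ := exists_eq_snoc t
    -- The last factor `z` of `F_t` is the identity on `Δ(m)`, so `f_{s → m} = δ(m) d (d_s F_s)`, to
    -- which the triangular congruence applies.
    have h := ih s
    rw [← one_smul F (T.murphyBase F r _ s), seminormal_eq_act_δ] at h
    have h1 := act_d_mul_sub_mem_higher F i s _ 1 h
    rw [one_smul] at h1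
    rw [seminormal_eq_act_δ, gz_snoc, ← mul_assoc, CellDatum.act_mul, act_z]
    rwa [one_tmul_dPath_snoc, mul_assoc, ← map_mul]

theorem repr_seminormal_self (t : T.Std r l) :
    (T.murphyBase F r l).repr (T.seminormal t) t = 1 := by
  have h := repr_eq_zero_of_mem_higher F (seminormal_sub_mem_higher t)
  rw [map_sub, Finsupp.sub_apply, Module.Basis.repr_self, Finsupp.single_eq_same] at h
  exact sub_eq_zero.1 h

theorem span_seminormal (r : ℕ) (l : T.Λ r) :
    Submodule.span F (Set.range fun t : T.Std r l => T.seminormal t) = ⊤ := by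
  refine eq_top_of_higher_le F _ fun t ht => ?_
  have hm : T.seminormal t ∈ Submodule.span F (Set.range fun t : T.Std r l => T.seminormal t) :=
    Submodule.subset_span ⟨t, rfl⟩
  have h := Submodule.sub_mem _ hm (ht (seminormal_sub_mem_higher t))
  rwa [sub_sub_cancel] at h

theorem act_seminormal_gz_self (t : T.Std r l) :
    (T.CF r).act (T.seminormal t) (T.gz t) = T.seminormal t := by
  rw [seminormal_eq_act, ← CellDatum.act_mul, gz_mul_self]

theorem act_seminormal_gz_of_ne {s t : T.Std r l} (h : s ≠ t) :
    (T.CF r).act (T.seminormal s) (T.gz t) = 0 := by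
  rw [seminormal_eq_act, ← CellDatum.act_mul, gz_mul_gz_of_ne h, CellDatum.act_zero]

/-- Orthogonality makes `F_t` a projection onto the line of `f_t`. The scalar is written as the
Murphy coordinate at `t`, where `f_t` has coefficient 1; in this form it is visibly evaluable when
the vector is. -/
theorem act_gz (x : (T.CF r).Cell l) (t : T.Std r l) : (T.CF r).act x (T.gz t) =
    (T.murphyBase F r l).repr ((T.CF r).act x (T.gz t)) t • T.seminormal t := by
  have h : ∃ c : F, (T.CF r).act x (T.gz t) = c • T.seminormal t := by
    have hx : x ∈ Submodule.span F (Set.range fun t : T.Std r l => T.seminormal t) := by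
      rw [span_seminormal]; trivial
    induction hx using Submodule.span_induction with
    | mem x hx =>
      obtain ⟨s, rfl⟩ := hx
      by_cases hst : s = t
      · subst hst
        exact ⟨1, by rw [one_smul]; exact act_seminormal_gz_self s⟩
      · exact ⟨0, by rw [zero_smul]; exact act_seminormal_gz_of_ne hst⟩
    | zero => exact ⟨0, by rw [zero_smul]; exact ((T.CF r).actₗ l _).map_zero⟩
    | add x y _ _ hx hy =>
      obtain ⟨c, hc⟩ := hx
      obtain ⟨c', hc'⟩ := hy
      exact ⟨c + c', by rw [CellDatum.add_act, hc, hc', add_smul]⟩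
    | smul b x _ hx =>
      obtain ⟨c, hc⟩ := hx
      exact ⟨b * c, by rw [CellDatum.smul_act, hc, mul_smul]⟩
  obtain ⟨c, hc⟩ := h
  rw [hc, map_smul, Finsupp.smul_apply, repr_seminormal_self, smul_eq_mul, mul_one]

theorem bilin_seminormal_of_ne {s t : T.Std r l} (h : s ≠ t) :
    (T.CF r).bilin (T.seminormal s) (T.seminormal t) = 0 := by
  rw [← act_seminormal_gz_self t, CellDatum.bilin_act_right, inv_gz, act_seminormal_gz_of_ne h]
  simp [CellDatum.bilin]

theorem bilin_seminormal_murphyBase (s : T.Std r l) :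
    (T.CF r).bilin (T.seminormal s) (T.murphyBase F r l s) =
      (T.CF r).bilin (T.seminormal s) (T.seminormal s) := by
  conv_rhs => rw [seminormal_eq_act s, CellDatum.bilin_act_right, inv_gz, ← seminormal_eq_act,
    act_seminormal_gz_self]

/-- `F_s` fixes `f_s`, the rank-one operator `m_{st}` yields `⟨f_s, m_s⟩ m_t`, and self-adjointness
of `F_s` turns `⟨f_s, m_s⟩` into `⟨f_s, f_s⟩`. -/
theorem act_seminormal_gzUnit_self (s t : T.Std r l) :
    (T.CF r).act (T.seminormal s) (T.gzUnit s t) =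
      (T.CF r).bilin (T.seminormal s) (T.seminormal s) • T.seminormal t := by
  rw [gzUnit, CellDatum.act_mul, CellDatum.act_mul, act_seminormal_gz_self, act_murphy,
    CellDatum.smul_act, bilin_seminormal_murphyBase, ← seminormal_eq_act]

theorem act_seminormal_gzUnit_of_ne {u s : T.Std r l} (h : u ≠ s) (t : T.Std r l) :
    (T.CF r).act (T.seminormal u) (T.gzUnit s t) = 0 := by
  rw [gzUnit, CellDatum.act_mul, CellDatum.act_mul, act_seminormal_gz_of_ne h]
  simp [CellDatum.act_eq_vecMul]

end Seminormal

end DiagramTower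

/-! ### Evaluation of scalars and algebra elements -/

section Evaluation

variable {R : Type u} {F : Type u₁} {S : Type u₂} {K : Type u₃} [CommRing R] [IsDomain R] [Field F]
  [Algebra R F] [IsFractionRing R F] [CommRing S] [IsDomain S] [Algebra R S] [Field K] [Algebra S K]
  [IsFractionRing S K] [Algebra R K] [IsScalarTower R S K]

variable (R F S) in
theorem localToFrac_injective : Function.Injective (localToFrac R F S) := by
  rw [injective_iff_map_eq_zero]
  intro x hx
  obtain ⟨a, s, rfl⟩ := IsLocalization.exists_mk'_eq (kerPrime R S).primeCompl x
  have h1 : localToFrac R F S (algebraMap R (LocalR R S) a) = 0 := by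
    rw [← IsLocalization.mk'_spec (LocalR R S) a s, map_mul, hx, zero_mul]
  rw [AlgHom.commutes] at h1
  have h2 : a = 0 := (IsFractionRing.injective R F) (by rw [h1, map_zero])
  rw [h2, IsLocalization.mk'_zero]

theorem evalScalar_localToFrac (y : LocalR R S) :
    evalScalar R F S K (localToFrac R F S y) = localToResidue R S K y := by
  have h : EvaluableScalar R F S (localToFrac R F S y) := ⟨y, rfl⟩
  rw [evalScalar, dif_pos h, localToFrac_injective R F S h.choose_spec]

variable {A : Type v} [Ring A] [Algebra R A]

/-- The preimage chosen in `evalAlg` is the only one, since `A^{R_𝔭}` embeds in `A^F`. Evaluation is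
then computed on any lift. -/
theorem evalAlg_specialize (C : CellDatum.{u, v, w} R A) (y : LocalR R S ⊗[R] A) :
    evalAlg R F S K A (specialize (localToFrac R F S) A y) =
      specialize (localToResidue R S K) A y := by
  have h : Evaluable R F S A (specialize (localToFrac R F S) A y) := ⟨y, rfl⟩
  rw [evalAlg, dif_pos h,
    C.specialize_injective (localToFrac R F S) (localToFrac_injective R F S) h.choose_spec]

theorem evalAlg_mul (C : CellDatum.{u, v, w} R A) {x y : F ⊗[R] A} (hx : Evaluable R F S A x)
    (hy : Evaluable R F S A y) :
    evalAlg R F S K A (x * y) = evalAlg R F S K A x * evalAlg R F S K A y := by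
  obtain ⟨x, rfl⟩ := hx
  obtain ⟨y, rfl⟩ := hy
  rw [← map_mul, evalAlg_specialize C, evalAlg_specialize C, evalAlg_specialize C, map_mul]

theorem Evaluable.mul {x y : F ⊗[R] A} (hx : Evaluable R F S A x)
    (hy : Evaluable R F S A y) : Evaluable R F S A (x * y) := by
  obtain ⟨x, rfl⟩ := hx
  obtain ⟨y, rfl⟩ := hy
  exact ⟨x * y, map_mul _ _ _⟩

variable (F S) in
theorem evaluable_tmul (a : A) : Evaluable R F S A (1 ⊗ₜ[R] a) := ⟨1 ⊗ₜ[R] a, by simp⟩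

variable (F S K) in
theorem evalAlg_tmul (C : CellDatum.{u, v, w} R A) (a : A) :
    evalAlg R F S K A (1 ⊗ₜ[R] a) = 1 ⊗ₜ[R] a := by
  have h := evalAlg_specialize (F := F) (S := S) (K := K) C (1 ⊗ₜ[R] a)
  simpa using h

theorem evalAlg_zero (C : CellDatum.{u, v, w} R A) : evalAlg R F S K A 0 = 0 := by
  have h := evalAlg_specialize (F := F) (S := S) (K := K) C 0
  simpa using h

theorem evalAlg_inv (C : CellDatum.{u, v, w} R A) {x : F ⊗[R] A} (hx : Evaluable R F S A x) :
    (C.baseChange K).inv (evalAlg R F S K A x) =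
      evalAlg R F S K A ((C.baseChange F).inv x) := by
  obtain ⟨x, rfl⟩ := hx
  rw [C.inv_specialize, evalAlg_specialize C, evalAlg_specialize C, C.inv_specialize]

end Evaluation

/-! ### Evaluation of idempotents and seminormal vectors -/

namespace DiagramTower

variable {R : Type u} {F : Type u₁} {S : Type u₂} {K : Type u₃} [CommRing R] [IsDomain R] [Field F]
  [Algebra R F] [IsFractionRing R F] [CommRing S] [IsDomain S] [Algebra R S] [Field K] [Algebra S K]
  [IsFractionRing S K] [Algebra R K] [IsScalarTower R S K]
  {T : DiagramTower.{u, v, w, u₁} R F}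

theorem ιBase_specialize {B : Type*} {B' : Type*} [CommRing B] [Algebra R B] [CommRing B']
    [Algebra R B'] (g : B →ₐ[R] B') (r : ℕ) (a : B ⊗[R] T.A r) :
    T.ιBase B' r (specialize g (T.A r) a) = specialize g (T.A (r + 1)) (T.ιBase B r a) := by
  induction a using TensorProduct.induction_on with
  | zero => simp
  | add x y h h' => simp only [map_add, h, h']
  | tmul b a => simp

theorem evaluable_ιBase {r : ℕ} {x : F ⊗[R] T.A r} (hx : Evaluable R F S (T.A r) x) :
    Evaluable R F S (T.A (r + 1)) (T.ιBase F r x) := by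
  obtain ⟨x, rfl⟩ := hx
  exact ⟨T.ιBase _ r x, (ιBase_specialize _ r x).symm⟩

theorem evalAlg_ιBase {r : ℕ} {x : F ⊗[R] T.A r} (hx : Evaluable R F S (T.A r) x) :
    evalAlg R F S K (T.A (r + 1)) (T.ιBase F r x) =
      T.ιBase K r (evalAlg R F S K (T.A r) x) := by
  obtain ⟨x, rfl⟩ := hx
  rw [ιBase_specialize, evalAlg_specialize (T.C r), evalAlg_specialize (T.C (r + 1)),
    ιBase_specialize]

variable (S K) in
/-- The evaluation of a Gelfand-Zeitlin idempotent. -/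
noncomputable def gzEval {r : ℕ} {l : T.Λ r} (t : T.Std r l) : K ⊗[R] T.A r :=
  evalAlg R F S K (T.A r) (T.gz t)

variable (S K) in
/-- The evaluation of a seminormal basis element. -/
noncomputable def seminormalEval {r : ℕ} {l : T.Λ r} (t : T.Std r l) :
    ((T.C r).baseChange K).Cell l :=
  ((T.C r).baseChange K).act (T.murphyBase K r l t) (T.gzEval S K t)

variable {r : ℕ} {l m : T.Λ r}

theorem specializeCell_act_murphyBase {B : Type*} {B' : Type*} [CommRing B] [Algebra R B]
    [CommRing B'] [Algebra R B'] (g : B →ₐ[R] B') (t : T.Std r l) (a : B ⊗[R] T.A r) :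
    (T.C r).specializeCell g (((T.C r).baseChange B).act (T.murphyBase B r l t) a) =
      ((T.C r).baseChange B').act (T.murphyBase B' r l t) (specialize g (T.A r) a) := by
  rw [← CellDatum.act_specialize, specializeCell_murphyBase]

/-- A common lift over `R_𝔭` is the bridge: identities over `F` descend to it by injectivity and are
then pushed to `K`. -/
theorem exists_seminormal_lift {t : T.Std r l} (ht : Evaluable R F S (T.A r) (T.gz t)) :
    ∃ x : ((T.C r).baseChange (LocalR R S)).Cell l,
      (T.C r).specializeCell (localToFrac R F S) x = T.seminormal t ∧
      (T.C r).specializeCell (localToResidue R S K) x = T.seminormalEval S K t := by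
  obtain ⟨y, hy⟩ := ht
  refine ⟨((T.C r).baseChange _).act (T.murphyBase _ r l t) y, ?_, ?_⟩
  · rw [specializeCell_act_murphyBase, hy, seminormal_eq_act]
  · rw [specializeCell_act_murphyBase, seminormalEval, gzEval, ← hy, evalAlg_specialize (T.C r)]

/-- Identities in cell modules over `F` between evaluable vectors can be evaluated. -/
theorem specializeCell_eq_of_eq {x y : ((T.C r).baseChange (LocalR R S)).Cell l}
    (h : (T.C r).specializeCell (localToFrac R F S) x =
      (T.C r).specializeCell (localToFrac R F S) y) :
    (T.C r).specializeCell (localToResidue R S K) x =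
      (T.C r).specializeCell (localToResidue R S K) y := by
  rw [(T.C r).specializeCell_injective (localToFrac R F S) (localToFrac_injective R F S) h]

/-- Evaluation of a relation `f_s a = c f_t`. -/
theorem act_seminormalEval_of_act_seminormal {s t : T.Std r l}
    (hs : Evaluable R F S (T.A r) (T.gz s)) (ht : Evaluable R F S (T.A r) (T.gz t))
    {a : F ⊗[R] T.A r} (ha : Evaluable R F S (T.A r) a) {c : F}
    (h : (T.CF r).act (T.seminormal s) a = c • T.seminormal t) :
    EvaluableScalar R F S c ∧
    ((T.C r).baseChange K).act (T.seminormalEval S K s) (evalAlg R F S K (T.A r) a) =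
      evalScalar R F S K c • T.seminormalEval S K t := by
  obtain ⟨x, hx, hx'⟩ := exists_seminormal_lift (K := K) hs
  obtain ⟨y, hy, hy'⟩ := exists_seminormal_lift (K := K) ht
  obtain ⟨a, rfl⟩ := ha
  -- Since `f_t` has coordinate 1 at `t`, the scalar `c` is the coordinate of `f_s a` at `t`, which
  -- is computed over `R_𝔭`.
  have hc : c = localToFrac R F S ((T.murphyBase (LocalR R S) r l).repr
      (((T.C r).baseChange (LocalR R S)).act x a) t) := by
    rw [← repr_specializeCell, ← CellDatum.act_specialize, hx]
    change c = (T.murphyBase F r l).repr ((T.CF r).act (T.seminormal s) _) t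
    rw [h, map_smul, Finsupp.smul_apply, repr_seminormal_self, smul_eq_mul, mul_one]
  rw [hc] at h ⊢
  refine ⟨⟨_, rfl⟩, ?_⟩
  change (T.CF r).act _ (specialize (localToFrac R F S) (T.A r) a) = _ at h
  rw [← hx, ← hy, CellDatum.act_specialize, ← CellDatum.specializeCell_smul] at h
  have h1 := specializeCell_eq_of_eq (K := K) h
  change ((T.C r).baseChange K).act _ (evalAlg R F S K _
    (specialize (localToFrac R F S) (T.A r) a)) = _
  rw [evalAlg_specialize (T.C r), ← hx', ← hy', CellDatum.act_specialize, h1,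
    CellDatum.specializeCell_smul, evalScalar_localToFrac]

theorem act_seminormalEval_eq_zero {s : T.Std r l}
    (hs : Evaluable R F S (T.A r) (T.gz s))
    {a : F ⊗[R] T.A r} (ha : Evaluable R F S (T.A r) a)
    (h : (T.CF r).act (T.seminormal s) a = 0) :
    ((T.C r).baseChange K).act (T.seminormalEval S K s) (evalAlg R F S K (T.A r) a) = 0 := by
  have h1 := (act_seminormalEval_of_act_seminormal (K := K) hs hs ha
    (h.trans (zero_smul F (T.seminormal s)).symm)).2
  have h2 : evalScalar R F S K 0 = 0 := by
    rw [← map_zero (localToFrac R F S), evalScalar_localToFrac, map_zero]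
  rw [h1, h2, zero_smul]

theorem act_seminormalEval_gzEval_self {t : T.Std r l} (ht : Evaluable R F S (T.A r) (T.gz t)) :
    ((T.C r).baseChange K).act (T.seminormalEval S K t) (T.gzEval S K t) =
      T.seminormalEval S K t := by
  have h1 := (act_seminormalEval_of_act_seminormal (K := K) ht ht ht
    ((act_seminormal_gz_self t).trans (one_smul F (T.seminormal t)).symm)).2
  have h2 : evalScalar R F S K 1 = 1 := by
    rw [← map_one (localToFrac R F S), evalScalar_localToFrac, map_one]
  rw [h2, one_smul] at h1
  exact h1

theorem mem_higher_iff (B : Type*) [CommRing B] [Algebra R B] {t : T.Std r l}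
    {x : ((T.C r).baseChange B).Cell l} :
    x ∈ T.higher B t ↔ ∀ s, ¬ precedes r l s t → (T.murphyBase B r l).repr x s = 0 := by
  constructor
  · intro hx s hs
    induction hx using Submodule.span_induction with
    | mem x hx =>
      obtain ⟨u, hu, rfl⟩ := hx
      rw [Module.Basis.repr_self, Finsupp.single_eq_of_ne]
      rintro rfl
      exact hs hu
    | zero => simp
    | add x y _ _ hx hy => simp [hx, hy]
    | smul c x _ hx => simp [hx]
  · intro h
    rw [← (T.murphyBase B r l).sum_repr x]
    refine Submodule.sum_mem _ fun s _ => ?_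
    by_cases hs : precedes r l s t
    · exact Submodule.smul_mem _ _ (Submodule.subset_span ⟨s, hs, rfl⟩)
    · rw [h s hs, zero_smul]; exact Submodule.zero_mem _

/-- Phrased as vanishing of Murphy coordinates, triangularity passes through `R_𝔭`. -/
theorem seminormalEval_sub_mem_higher {t : T.Std r l} (ht : Evaluable R F S (T.A r) (T.gz t)) :
    T.seminormalEval S K t - T.murphyBase K r l t ∈ T.higher K t := by
  obtain ⟨x, hx, hx'⟩ := exists_seminormal_lift (K := K) ht
  rw [mem_higher_iff]
  intro s hs
  have h1 := (mem_higher_iff F).1 (seminormal_sub_mem_higher t) s hs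
  rw [map_sub, Finsupp.sub_apply, sub_eq_zero, ← hx, repr_specializeCell,
    ← specializeCell_murphyBase (localToFrac R F S), repr_specializeCell] at h1
  have h2 := localToFrac_injective R F S h1
  rw [map_sub, Finsupp.sub_apply, sub_eq_zero, ← hx', repr_specializeCell,
    ← specializeCell_murphyBase (localToResidue R S K), repr_specializeCell, h2]

/-- The evaluation of a Gelfand-Zeitlin idempotent is a projection onto the line spanned by the
evaluated seminormal vector. -/
theorem exists_act_gzEval_eq_smul {t : T.Std r l} (ht : Evaluable R F S (T.A r) (T.gz t))
    (x : ((T.C r).baseChange K).Cell l) : ∃ c : K,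
    ((T.C r).baseChange K).act x (T.gzEval S K t) = c • T.seminormalEval S K t := by
  have hx : x ∈ Submodule.span K (Set.range (T.murphyBase K r l)) := by
    rw [Module.Basis.span_eq]; trivial
  induction hx using Submodule.span_induction with
  | mem x hx =>
    obtain ⟨s, rfl⟩ := hx
    obtain ⟨x, hx, hx'⟩ := exists_seminormal_lift (K := K) ht
    have h1 := act_gz (T.murphyBase F r l s) t
    obtain ⟨y, hy⟩ := ht
    change specialize (localToFrac R F S) (T.A r) y = _ at hy
    rw [← hy, ← hx, ← specializeCell_act_murphyBase, repr_specializeCell,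
      ← CellDatum.specializeCell_smul] at h1
    have h2 := specializeCell_eq_of_eq (K := K) h1
    rw [CellDatum.specializeCell_smul, hx', specializeCell_act_murphyBase,
      ← evalAlg_specialize (F := F) (T.C r), hy] at h2
    exact ⟨_, h2⟩
  | zero => exact ⟨0, by rw [zero_smul]; exact (((T.C r).baseChange K).actₗ l _).map_zero⟩
  | add x y _ _ hx hy =>
    obtain ⟨c, hc⟩ := hx
    obtain ⟨c', hc'⟩ := hy
    exact ⟨c + c', by rw [CellDatum.add_act, hc, hc', add_smul]⟩
  | smul b x _ hx =>
    obtain ⟨c, hc⟩ := hx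
    exact ⟨b * c, by rw [CellDatum.smul_act, hc, mul_smul]⟩

theorem inv_gzEval {t : T.Std r l} (ht : Evaluable R F S (T.A r) (T.gz t)) :
    ((T.C r).baseChange K).inv (T.gzEval S K t) = T.gzEval S K t := by
  rw [gzEval, evalAlg_inv (T.C r) ht]
  congr 1
  exact inv_gz t

theorem evaluable_form_seminormal {s t : T.Std r l} (hs : Evaluable R F S (T.A r) (T.gz s))
    (ht : Evaluable R F S (T.A r) (T.gz t)) :
    EvaluableScalar R F S ((T.CF r).form (l := l) (T.seminormal s) (T.seminormal t)) ∧
    evalScalar R F S K ((T.CF r).form (l := l) (T.seminormal s) (T.seminormal t)) =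
      ((T.C r).baseChange K).bilin (T.seminormalEval S K s) (T.seminormalEval S K t) := by
  obtain ⟨x, hx, hx'⟩ := exists_seminormal_lift (K := K) hs
  obtain ⟨y, hy, hy'⟩ := exists_seminormal_lift (K := K) ht
  rw [CellDatum.form_eq_bilin, ← hx, ← hy, CellDatum.bilin_specialize, ← hx', ← hy',
    CellDatum.bilin_specialize, evalScalar_localToFrac]
  exact ⟨⟨_, rfl⟩, rfl⟩

theorem evaluable_gzUnit {s t : T.Std r l} (hs : Evaluable R F S (T.A r) (T.gz s))
    (ht : Evaluable R F S (T.A r) (T.gz t)) : Evaluable R F S (T.A r) (T.gzUnit s t) :=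
  (hs.mul (evaluable_tmul F S _)).mul ht

theorem bilin_seminormalEval_of_ne {s t : T.Std r l} (hs : Evaluable R F S (T.A r) (T.gz s))
    (ht : Evaluable R F S (T.A r) (T.gz t)) (h : s ≠ t) :
    ((T.C r).baseChange K).bilin (T.seminormalEval S K s) (T.seminormalEval S K t) = 0 := by
  rw [← (evaluable_form_seminormal hs ht).2, CellDatum.form_eq_bilin, bilin_seminormal_of_ne h,
    ← map_zero (localToFrac R F S), evalScalar_localToFrac, map_zero]

/-- If the evaluated seminormal vector is not in the radical of the bilinear form, then it is not
isotropic. -/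
theorem bilin_seminormalEval_self_ne_zero {t : T.Std r l}
    (ht : Evaluable R F S (T.A r) (T.gz t)) {y : ((T.C r).baseChange K).Cell l}
    (h : ((T.C r).baseChange K).bilin (T.seminormalEval S K t) y ≠ 0) :
    ((T.C r).baseChange K).bilin (T.seminormalEval S K t) (T.seminormalEval S K t) ≠ 0 := by
  intro h0
  apply h
  -- `⟨f, y⟩ = ⟨f F_t, y⟩ = ⟨f, y F_t⟩ = c ⟨f, f⟩` after evaluation.
  obtain ⟨c, hc⟩ := exists_act_gzEval_eq_smul ht y
  rw [← act_seminormalEval_gzEval_self ht, CellDatum.bilin_act_left, inv_gzEval ht, hc,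
    CellDatum.bilin_smul_right, h0, mul_zero]

end DiagramTower

/-! ### Cell modules of the quotient algebras -/

namespace QuotientTower

variable {R : Type u} {F : Type u₁} [CommRing R] [IsDomain R] [Field F] [Algebra R F]
  [IsFractionRing R F] {T : DiagramTower.{u, v, w, u₁} R F} {S : Type u₂} {K : Type u₃}
  [CommRing S] [IsDomain S] [Algebra R S] [Field K] [Algebra S K] [IsFractionRing S K]
  [Algebra R K] [IsScalarTower R S K] (X : QuotientTower.{u, v, w, u₁, u₂, u₃, u₄} T S K)

open DiagramTower MulOpposite

section CellMap

variable {r : ℕ} {l : T.Λ r}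

theorem toQuot_eq_zero {x : X.Q r} : X.toQuot l x = 0 ↔
    ∃ a ∈ ((T.C r).baseChange K).above l, X.φ r a = x := Submodule.Quotient.mk_eq_zero _

theorem toQuot_surjective (x : X.Q r ⧸ X.above r l) : ∃ y, X.toQuot l y = x :=
  Submodule.Quotient.mk_surjective _ x

theorem op_smul_toQuot (q x : X.Q r) : op q • X.toQuot l x = X.toQuot l (x * q) := rfl

theorem toQuot_smul (c : K) (x : X.Q r) : X.toQuot l (c • x) = c • X.toQuot l x := rfl

theorem toQuot_add (x y : X.Q r) : X.toQuot l (x + y) = X.toQuot l x + X.toQuot l y := rfl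

theorem op_smul_smul (q : X.Q r) (c : K) (x : X.Q r ⧸ X.above r l) :
    op q • c • x = c • op q • x := by
  obtain ⟨y, rfl⟩ := X.toQuot_surjective x
  rw [← toQuot_smul, op_smul_toQuot, op_smul_toQuot, ← toQuot_smul, smul_mul_assoc]

theorem op_smul_eq_smul (q : X.Q r) (c : K) (x : X.Q r ⧸ X.above r l) :
    op (c • q) • x = c • op q • x := by
  obtain ⟨y, rfl⟩ := X.toQuot_surjective x
  rw [op_smul_toQuot, op_smul_toQuot, ← toQuot_smul, mul_smul_comm]

theorem op_mul_smul (q q' : X.Q r) (x : X.Q r ⧸ X.above r l) :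
    op (q * q') • x = op q' • op q • x := by
  rw [op_mul, mul_smul]

/-- `m_l ≡ α_l⁻¹(δ^* ⊗ δ)` in a specialization of `A_r`. -/
theorem mkQ_M_mul (B : Type*) [CommRing B] [Algebra R B] (a : B ⊗[R] T.A r) :
    (((T.C r).baseChange B).above l).mkQ ((1 ⊗ₜ[R] T.M r l) * a) =
      (((T.C r).baseChange B).above l).mkQ (((T.C r).baseChange B).alphaInv (l := l)
        ((T.C r).extend B (T.δ r l))
        (((T.C r).baseChange B).act ((T.C r).extend B (T.δ r l)) a)) := by
  rw [← CellDatum.mkQ_alphaInv_mul, CellDatum.alphaInv_extend]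
  refine CellDatum.mkQ_mul_right _ ((CellDatum.mkQ_eq _).2 ?_) a
  rw [← TensorProduct.tmul_sub]
  exact (T.C r).tmul_mem_above B 1 (T.M_lift r l)

variable (r l) in
/-- The map of cell modules `Δ_{A_r}^K(l) → Q_r / Q_r^{▷ l}`, `δ(l) a ↦ φ(m_l a) + Q_r^{▷ l}`. -/
noncomputable def cellMap : ((T.C r).baseChange K).Cell l →ₗ[K] X.Q r ⧸ X.above r l :=
  (T.murphyBase K r l).constr K fun t => X.toQuot l (X.φ r (1 ⊗ₜ[R] (T.M r l * T.dPath t)))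

theorem cellMap_murphyBase (t : T.Std r l) : X.cellMap r l (T.murphyBase K r l t) =
    X.toQuot l (X.φ r (1 ⊗ₜ[R] (T.M r l * T.dPath t))) :=
  Module.Basis.constr_basis _ _ _ _

/-- Independence of the choice of `a`: replace it by a combination `a'` of the `d_t` with `δ a' = δ
a`. Then `m_l a` and `m_l a'` agree modulo `A^{▷ l}`, both being determined by `δ a`. -/
theorem cellMap_act_δ (a : K ⊗[R] T.A r) :
    X.cellMap r l (((T.C r).baseChange K).act ((T.C r).extend K (T.δ r l)) a) =
      X.toQuot l (X.φ r ((1 ⊗ₜ[R] T.M r l) * a)) := by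
  let x := ((T.C r).baseChange K).act ((T.C r).extend K (T.δ r l)) a
  let a' : K ⊗[R] T.A r := ∑ t, (T.murphyBase K r l).repr x t • (1 ⊗ₜ[R] T.dPath t)
  have h1 : ((T.C r).baseChange K).act ((T.C r).extend K (T.δ r l)) a' = x := by
    rw [CellDatum.act_sum]
    simp only [CellDatum.act_smul, ← murphyBase_eq_act]
    exact (T.murphyBase K r l).sum_repr x
  have h2 : X.cellMap r l x = X.toQuot l (X.φ r ((1 ⊗ₜ[R] T.M r l) * a')) := by
    rw [cellMap, Module.Basis.constr_apply_fintype]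
    simp only [a', Finset.mul_sum, mul_smul_comm, map_sum, map_smul,
      Algebra.TensorProduct.tmul_mul_tmul, mul_one, Module.Basis.equivFun_apply]
    exact (map_sum (((X.above r l).mkQ).restrictScalars K) _ _).symm
  have h3 : ((1 ⊗ₜ[R] T.M r l) * a : K ⊗[R] T.A r) - (1 ⊗ₜ[R] T.M r l) * a' ∈
      ((T.C r).baseChange K).above l := by
    rw [← CellDatum.mkQ_eq, mkQ_M_mul, mkQ_M_mul, h1]
  change X.cellMap r l x = _
  rw [h2]
  have h4 : X.φ r ((1 ⊗ₜ[R] T.M r l) * a) - X.φ r ((1 ⊗ₜ[R] T.M r l) * a') ∈ X.above r l :=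
    ⟨_, h3, map_sub _ _ _⟩
  exact ((Submodule.Quotient.eq _).2 h4).symm

theorem cellMap_act (x : ((T.C r).baseChange K).Cell l) (a : K ⊗[R] T.A r) :
    X.cellMap r l (((T.C r).baseChange K).act x a) = op (X.φ r a) • X.cellMap r l x := by
  obtain ⟨b, rfl⟩ := (T.C r).exists_act_extend K (T.δ_generates r l) x
  rw [← CellDatum.act_mul, cellMap_act_δ, cellMap_act_δ, op_smul_toQuot, ← map_mul, mul_assoc]

end CellMap

section Permissible

variable {r : ℕ}

/-- A path is permissible if all its vertices are. -/
def IsPerm {l : T.Λ r} (t : T.Std r l) : Prop := ∀ k : Fin (r + 1), t.1.1 k ∈ X.perm k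

theorem isPerm_snoc {m : T.Λ (r + 1)} (i : Fin (T.filtration r m).n)
    (s : T.Std r ((T.filtration r m).label i)) :
    X.IsPerm (snoc i s) ↔ X.IsPerm s ∧ m ∈ X.perm (r + 1) := by
  have hl : (snoc i s).1.1 (Fin.last (r + 1)) = m := (snoc i s).2
  constructor
  · intro h
    refine ⟨fun k => ?_, ?_⟩
    · have h1 := h k.castSucc
      rwa [snoc_castSucc] at h1
    · have h1 := h (Fin.last (r + 1))
      rwa [hl] at h1
  · rintro ⟨h, hm⟩ k
    induction k using Fin.lastCases with
    | last => rw [hl]; exact hm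
    | cast j => rw [snoc_castSucc]; exact h j

theorem mem_perm_of_isPerm {l : T.Λ r} {t : T.Std r l} (h : X.IsPerm t) : l ∈ X.perm r := by
  have h1 := h (Fin.last r)
  rwa [t.2] at h1

theorem isPerm_nil (l : T.Λ 0) : X.IsPerm (T.nil l) := by
  intro k
  obtain rfl := Fin.eq_zero k
  exact X.perm_zero _

theorem exists_isPerm {l : T.Λ r} (hl : l ∈ X.perm r) : ∃ t : T.Std r l, X.IsPerm t := by
  induction r with
  | zero => exact ⟨_, X.isPerm_nil l⟩
  | succ r ih =>
    obtain ⟨m, hm, i, rfl⟩ := X.perm_pred r l hl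
    obtain ⟨s, hs⟩ := ih hm
    exact ⟨snoc i s, (X.isPerm_snoc i s).2 ⟨hs, hl⟩⟩

theorem exists_permStd {l : T.Λ r} {t : T.Std r l} (h : X.IsPerm t) :
    ∃ t' : X.PermStd r l, t'.1 = t := ⟨⟨t, h⟩, rfl⟩

theorem nonempty_permStd {l : T.Λ r} (hl : l ∈ X.perm r) : Nonempty (X.PermStd r l) := by
  obtain ⟨t, ht⟩ := X.exists_isPerm hl
  exact ⟨⟨t, ht⟩⟩

theorem mem_perm_of_permStd {l : T.Λ r} (t : X.PermStd r l) : l ∈ X.perm r :=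
  X.mem_perm_of_isPerm t.2

theorem extend_δ_ne_zero (l : T.Λ r) : (T.C r).extend K (T.δ r l) ≠ 0 := by
  intro h
  obtain ⟨v⟩ := (T.C r).nonemptyTab l
  obtain ⟨a, ha⟩ := (T.C r).exists_act_extend K (T.δ_generates r l) (fun _ => 1)
  rw [h] at ha
  have h1 := congrFun ha v
  simp [CellDatum.act] at h1

/-- `m_l a ≡ α⁻¹(δ^* ⊗ δ a)`, and over the field `K` this tensor vanishes only if `δ a` does,
because `δ` stays nonzero. -/
theorem act_δ_eq_zero {l : T.Λ r} {a : K ⊗[R] T.A r}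
    (h : (1 ⊗ₜ[R] T.M r l) * a ∈ ((T.C r).baseChange K).above l) :
    ((T.C r).baseChange K).act ((T.C r).extend K (T.δ r l)) a = 0 := by
  have h1 := (Submodule.Quotient.mk_eq_zero _).2 h
  rw [← Submodule.mkQ_apply, mkQ_M_mul, Submodule.mkQ_apply, Submodule.Quotient.mk_eq_zero,
    CellDatum.alphaInv_mem_above_iff] at h1
  obtain ⟨s, hs⟩ := Function.ne_iff.1 (extend_δ_ne_zero (K := K) l)
  funext t
  exact (mul_eq_zero.1 (h1 s t)).resolve_left hs

/-- Modulo the kernel of `φ`, the Murphy basis element of a non-permissible path is a combination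
of elements attached to preceding paths. -/
theorem exists_reduction {l : T.Λ r} (t : T.Std r l) (ht : ¬ X.IsPerm t) :
    ∃ x : K ⊗[R] T.A r,
      X.φ r (1 ⊗ₜ[R] (T.M r l * T.dPath t) + (1 ⊗ₜ[R] T.M r l) * x) = 0 ∧
      ((T.C r).baseChange K).act ((T.C r).extend K (T.δ r l)) x ∈ T.higher K t := by
  induction r with
  | zero => exact (ht (eq_nil t ▸ X.isPerm_nil l)).elim
  | succ r ih =>
    obtain ⟨i, s, rfl⟩ := exists_eq_snoc t
    by_cases hs : X.IsPerm s
    -- Here `l` is the first non-permissible vertex of the path, so the marginal decomposition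
    -- applies at `l` itself.
    · have hl : l ∉ X.perm (r + 1) := fun hl => ht ((X.isPerm_snoc i s).2 ⟨hs, hl⟩)
      obtain ⟨b, b', h1, h2, h3, β, h4⟩ := X.marginal (r + 1) l hl ⟨snoc i s, fun j hj => by
        induction j using Fin.lastCases with
        | last => exact (hj rfl).elim
        | cast j => rw [snoc_castSucc]; exact hs j⟩
      have h5 := congrArg (specialize (IsScalarTower.toAlgHom R S K) (T.A (r + 1))) h1
      have h6 := (T.C (r + 1)).specialize_mem_above (IsScalarTower.toAlgHom R S K) h3
      have h0 : ((T.C (r + 1)).baseChange K).act ((T.C (r + 1)).extend K (T.δ (r + 1) l)) β = 0 :=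
        act_δ_eq_zero (h4 ▸ h6)
      -- With `b' = m_l β`, the sum `m_l d_t + m_l β d_t` is `b d_t`, killed by `φ`; and `δ β = 0`
      -- makes the correction term vanish in the cell module.
      refine ⟨β * (1 ⊗ₜ[R] T.dPath (snoc i s)), ?_, ?_⟩
      · have h7 : (1 ⊗ₜ[R] (T.M (r + 1) l * T.dPath (snoc i s)) : K ⊗[R] T.A (r + 1)) +
            (1 ⊗ₜ[R] T.M (r + 1) l) * (β * (1 ⊗ₜ[R] T.dPath (snoc i s))) =
            specialize (IsScalarTower.toAlgHom R S K) (T.A (r + 1)) b *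
              (1 ⊗ₜ[R] T.dPath (snoc i s)) := by
          rw [map_sub, h4] at h5
          simp only [Algebra.TensorProduct.map_tmul, map_one, AlgHom.id_apply] at h5
          have h8 : (1 ⊗ₜ[R] (T.M (r + 1) l * T.dPath (snoc i s)) : K ⊗[R] T.A (r + 1)) =
              (1 ⊗ₜ[R] T.M (r + 1) l) * (1 ⊗ₜ[R] T.dPath (snoc i s)) := by simp
          rw [h8, ← mul_assoc, ← add_mul, ← sub_eq_iff_eq_add.1 h5.symm]
        rw [h7, map_mul, h2, zero_mul]
      · rw [CellDatum.act_mul, h0, CellDatum.act_eq_vecMul, Matrix.zero_vecMul]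
        exact Submodule.zero_mem _
    · obtain ⟨y, hy, hy'⟩ := ih s hs
      -- The defect occurs earlier. Left multiplication by `u^*` carries the relation for `s` to one
      -- for `t`, since `m_l d = u^* m_{l'}` with `l'` the shape of `s`.
      refine ⟨(1 ⊗ₜ[R] T.d r ((T.filtration r l).label i) l) * T.ιBase K r y, ?_, ?_⟩
      · have h1 : (1 ⊗ₜ[R] (T.M (r + 1) l * T.dPath (snoc i s)) : K ⊗[R] T.A (r + 1)) +
            (1 ⊗ₜ[R] T.M (r + 1) l) *
              ((1 ⊗ₜ[R] T.d r ((T.filtration r l).label i) l) * T.ιBase K r y) =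
            (1 ⊗ₜ[R] (T.C (r + 1)).inv (T.u r ((T.filtration r l).label i) l)) *
              T.ιBase K r (1 ⊗ₜ[R] (T.M r ((T.filtration r l).label i) * T.dPath s) +
                (1 ⊗ₜ[R] T.M r ((T.filtration r l).label i)) * y) := by
          rw [dPath_snoc, ← mul_assoc, T.u_compat, map_add, mul_add, map_mul, ← mul_assoc,
            ← mul_assoc]
          simp only [Algebra.TensorProduct.map_tmul, Algebra.TensorProduct.tmul_mul_tmul, map_mul,
            mul_one, T.u_compat, mul_assoc, map_one]
        rw [h1, map_mul, X.φ_ι, hy, map_zero, mul_zero]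
      · have h1 := act_d_mul_sub_mem_higher K i s y 0 (by rwa [zero_smul, sub_zero])
        rwa [zero_smul, sub_zero] at h1

theorem cellMap_mem_of_not_isPerm {l : T.Λ r} (t : T.Std r l) (ht : ¬ X.IsPerm t)
    {V : Submodule K (X.Q r ⧸ X.above r l)} (hV : T.higher K t ≤ V.comap (X.cellMap r l)) :
    X.cellMap r l (T.murphyBase K r l t) ∈ V := by
  obtain ⟨x, hx, hx'⟩ := X.exists_reduction t ht
  have h1 : X.cellMap r l (T.murphyBase K r l t) +
      X.cellMap r l (((T.C r).baseChange K).act ((T.C r).extend K (T.δ r l)) x) = 0 := by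
    rw [cellMap_murphyBase, cellMap_act_δ, ← toQuot_add, ← map_add, hx]
    rfl
  rw [eq_neg_of_add_eq_zero_left h1]
  exact Submodule.neg_mem _ (hV hx')

theorem range_cellMap (l : T.Λ r) : LinearMap.range (X.cellMap r l) = X.cellQ r l := by
  apply le_antisymm
  · rw [LinearMap.range_le_iff_comap]
    refine eq_top_of_higher_le K _ fun t ht => ?_
    by_cases hp : X.IsPerm t
    · rw [Submodule.mem_comap, cellMap_murphyBase]
      exact Submodule.subset_span ⟨⟨t, hp⟩, rfl⟩
    · exact X.cellMap_mem_of_not_isPerm t hp ht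
  · refine Submodule.span_le.2 ?_
    rintro _ ⟨t, rfl⟩
    exact ⟨T.murphyBase K r l t.1, X.cellMap_murphyBase t.1⟩

theorem cellMap_mem (l : T.Λ r) (x : ((T.C r).baseChange K).Cell l) :
    X.cellMap r l x ∈ X.cellQ r l := X.range_cellMap l ▸ ⟨x, rfl⟩

theorem op_smul_mem_cellQ {l : T.Λ r} (q : X.Q r) {x : X.Q r ⧸ X.above r l}
    (hx : x ∈ X.cellQ r l) : op q • x ∈ X.cellQ r l := by
  rw [← range_cellMap] at hx
  obtain ⟨y, rfl⟩ := hx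
  obtain ⟨a, rfl⟩ := X.φ_surjective r q
  rw [← cellMap_act]
  exact X.cellMap_mem l _

/-- A semisimple `Q_r` acts faithfully on the sum of its cell modules. -/
theorem eq_zero_of_op_smul_eq_zero [IsSemisimpleRing (X.Q r)] {q : X.Q r}
    (hq : ∀ (l : T.Λ r), ∀ x ∈ X.cellQ r l, op q • x = 0) : q = 0 := by
  classical
  -- The common annihilator is a left ideal because cell modules are stable under `Q_r`;
  -- semisimplicity supplies an idempotent generator `e`.
  let J : Ideal (X.Q r) :=
    { carrier := {q | ∀ (l : T.Λ r), ∀ x ∈ X.cellQ r l, op q • x = 0}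
      zero_mem' := fun l x _ => zero_smul _ x
      add_mem' := fun {p q} hp hq l x hx => by
        rw [op_add, add_smul, hp l x hx, hq l x hx, add_zero]
      smul_mem' := fun c q hq l x hx => by
        rw [smul_eq_mul, op_mul_smul, hq l _ (X.op_smul_mem_cellQ c hx)] }
  obtain ⟨e, he, hJ⟩ := IsSemisimpleRing.ideal_eq_span_idempotent J
  have heJ : e ∈ J := hJ ▸ Ideal.subset_span rfl
  have h0 : e = 0 := by
    refine ((T.C r).baseChange K).eq_zero_of_idempotent (X.φ r).toRingHom he fun l s t => ?_
    -- With `δ a` and `δ b` the coordinate vectors at `s` and `t`, `c_{st} ≡ a^* m_l b`. As `e`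
    -- kills the class of `φ(m_l b)`, it sends `φ(c_{st})` into `φ(A^{▷ l})`.
    obtain ⟨a, ha⟩ := (T.C r).exists_act_extend K (T.δ_generates r l) (Pi.single s 1)
    obtain ⟨b, hb⟩ := (T.C r).exists_act_extend K (T.δ_generates r l) (Pi.single t 1)
    have h1 := heJ l _ (X.cellMap_mem l (((T.C r).baseChange K).act
      ((T.C r).extend K (T.δ r l)) b))
    rw [cellMap_act_δ, op_smul_toQuot, toQuot_eq_zero] at h1
    obtain ⟨x, hx, hxe⟩ := h1
    have h2 : ((T.C r).baseChange K).basis ⟨l, s, t⟩ -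
        ((T.C r).baseChange K).inv a * ((1 ⊗ₜ[R] T.M r l) * b) ∈
        ((T.C r).baseChange K).above l := by
      rw [← CellDatum.mkQ_eq, CellDatum.mkQ_mul_left _ (mkQ_M_mul K b),
        CellDatum.mkQ_mul_alphaInv, CellDatum.inv_inv, ha, hb]
      simp [CellDatum.alphaInv, Pi.single_apply, ite_smul]
    obtain ⟨ε, rfl⟩ := X.φ_surjective r e
    refine ⟨_, Submodule.add_mem _ (CellDatum.above_mul_mem _ h2 ε)
      (CellDatum.mul_mem_above _ (((T.C r).baseChange K).inv a) hx), ?_⟩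
    change X.φ r _ * X.φ r ε = X.φ r _
    rw [map_add, map_mul, map_mul (X.φ r) _ x, hxe, map_sub, sub_mul, map_mul, ← mul_assoc,
      sub_add_cancel]
  have hqJ : q ∈ J := hq
  rw [hJ, h0] at hqJ
  simpa using hqJ

instance : Module.Finite K (X.Q r) :=
  have : Module.Finite K (K ⊗[R] T.A r) :=
    Module.Finite.of_basis ((T.C r).baseChange K).basis
  Module.Finite.of_surjective (X.φ r).toLinearMap (X.φ_surjective r)

theorem finrank_Q : Module.finrank K (X.Q r) =
    ∑ l : T.Λ r, Fintype.card (X.PermStd r l) ^ 2 := by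
  classical
  rw [← Module.finrank_baseChange (R := AlgebraicClosure K) (S := K) (M' := X.Q r), X.dim_eq r, finsum_mem_def,
    finsum_eq_sum_of_fintype]
  refine Finset.sum_congr rfl fun l _ => ?_
  by_cases hl : l ∈ X.perm r
  · rw [Set.indicator_of_mem hl, ← Nat.card_eq_fintype_card]
    rfl
  · rw [Set.indicator_of_notMem hl]
    have : IsEmpty (X.PermStd r l) := ⟨fun t => hl (X.mem_perm_of_permStd t)⟩
    simp

theorem finrank_cellQ_le (l : T.Λ r) :
    Module.finrank K (X.cellQ r l) ≤ Fintype.card (X.PermStd r l) := finrank_range_le_card _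

instance (l : T.Λ r) : Module.Finite K (X.cellQ r l) :=
  Module.Finite.span_of_finite K (Set.finite_range _)

/-- The action on a cell module of `Q_r`. -/
noncomputable def actQ (l : T.Λ r) : X.Q r →ₗ[K] Module.End K (X.cellQ r l) where
  toFun q :=
    { toFun := fun x => ⟨op q • x.1, X.op_smul_mem_cellQ q x.2⟩
      map_add' := fun x y => Subtype.ext (smul_add _ _ _)
      map_smul' := fun c x => Subtype.ext (X.op_smul_smul q c x.1) }
  map_add' p q := LinearMap.ext fun x => Subtype.ext (by
    change op (p + q) • x.1 = op p • x.1 + op q • x.1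
    rw [op_add, add_smul])
  map_smul' c q := LinearMap.ext fun x => Subtype.ext (X.op_smul_eq_smul q c x.1)

/-- Faithfulness gives `∑ p_l² = dim Q_r ≤ ∑ (dim Δ_{Q_r}(l))²`, where `p_l` counts permissible
paths. Since `dim Δ_{Q_r}(l) ≤ p_l`, equality holds term by term. -/
theorem finrank_cellQ [IsSemisimpleRing (X.Q r)] (l : T.Λ r) :
    Module.finrank K (X.cellQ r l) = Fintype.card (X.PermStd r l) := by
  have hinj : Function.Injective (LinearMap.pi fun l : T.Λ r => X.actQ l) := by
    rw [injective_iff_map_eq_zero]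
    intro q hq
    refine X.eq_zero_of_op_smul_eq_zero fun l x hx => ?_
    have h1 := congrArg (fun f => f ⟨x, hx⟩) (congrFun hq l)
    exact congrArg Subtype.val h1
  have hfree : ∀ l : T.Λ r, Module.Free K (Module.End K (X.cellQ r l)) :=
    fun l => Module.Free.linearMap ..
  have h1 := LinearMap.finrank_le_finrank_of_injective hinj
  rw [finrank_Q, Module.finrank_pi_fintype] at h1
  simp only [Module.finrank_linearMap, ← sq] at h1
  have h2 : ∀ l ∈ (Finset.univ : Finset (T.Λ r)), Module.finrank K (X.cellQ r l) ^ 2 ≤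
      Fintype.card (X.PermStd r l) ^ 2 := fun l _ => Nat.pow_le_pow_left (X.finrank_cellQ_le l) 2
  have h3 := (Finset.sum_eq_sum_iff_of_le h2).1 (le_antisymm (Finset.sum_le_sum h2) h1) l
    (Finset.mem_univ l)
  exact Nat.pow_left_injective two_ne_zero h3

end Permissible

end QuotientTower

/-! ### Seminormal bases of the quotient algebras -/

namespace QuotientTower

variable {R : Type u} {F : Type u₁} [CommRing R] [IsDomain R] [Field F] [Algebra R F]
  [IsFractionRing R F] {T : DiagramTower.{u, v, w, u₁} R F} {S : Type u₂} {K : Type u₃}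
  [CommRing S] [IsDomain S] [Algebra R S] [Field K] [Algebra S K] [IsFractionRing S K]
  [Algebra R K] [IsScalarTower R S K] {X : QuotientTower.{u, v, w, u₁, u₂, u₃, u₄} T S K}

open DiagramTower MulOpposite

section SeminormalBasis

variable {r : ℕ} {l m : T.Λ r}

theorem seminormalBar_eq (t : X.PermStd r l) :
    X.seminormalBar t = X.cellMap r l (T.seminormalEval S K t.1) := by
  rw [seminormalEval, cellMap_act, cellMap_murphyBase, op_smul_toQuot, ← map_mul]
  rfl

theorem gzBar_eq (t : X.PermStd r l) : X.gzBar t = X.φ r (T.gzEval S K t.1) := rfl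

variable (hSN : ∀ (r : ℕ) (l : T.Λ r) (t : X.PermStd r l), Evaluable R F S (T.A r) (T.gz t.1))

include hSN

/-- Induction along `precedes`: a permissible `m_t` is replaced by `f̄_t` through unitriangularity,
a non-permissible one reduces to preceding terms. -/
theorem span_seminormalBar (l : T.Λ r) :
    Submodule.span K (Set.range fun t : X.PermStd r l => X.seminormalBar t) = X.cellQ r l := by
  apply le_antisymm
  · refine Submodule.span_le.2 ?_
    rintro _ ⟨t, rfl⟩
    change X.seminormalBar t ∈ X.cellQ r l
    rw [seminormalBar_eq]
    exact X.cellMap_mem l _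
  · rw [← range_cellMap, LinearMap.range_le_iff_comap]
    refine eq_top_of_higher_le K _ fun t ht => ?_
    by_cases hp : X.IsPerm t
    · obtain ⟨t, rfl⟩ := X.exists_permStd hp
      have h1 := ht (seminormalEval_sub_mem_higher (K := K) (hSN r l t))
      have h2 : X.seminormalBar t ∈ Submodule.span K
          (Set.range fun t : X.PermStd r l => X.seminormalBar t) := Submodule.subset_span ⟨_, rfl⟩
      rw [seminormalBar_eq] at h2
      rw [Submodule.mem_comap, map_sub] at h1
      have h3 := Submodule.sub_mem _ h2 h1
      rwa [sub_sub_cancel] at h3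
    · exact X.cellMap_mem_of_not_isPerm t hp ht

theorem linearIndependent_seminormalBar [IsSemisimpleRing (X.Q r)] (l : T.Λ r) :
    LinearIndependent K fun t : X.PermStd r l => X.seminormalBar t := by
  rw [linearIndependent_iff_card_eq_finrank_span, ← finrank_cellQ, Set.finrank,
    span_seminormalBar hSN]

/-- The isomorphism of `Q_r` with a product of matrix algebras given by the bases `f̄_t` of the
cell modules. -/
theorem exists_matrixEquiv (r : ℕ) [IsSemisimpleRing (X.Q r)]
    [∀ l : T.Λ r, DecidableEq (X.PermStd r l)] :
    ∃ θ : X.Q r ≃ₐ[K] ∀ l : T.Λ r, Matrix (X.PermStd r l) (X.PermStd r l) K,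
      ∀ (q : X.Q r) (l : T.Λ r) (t : X.PermStd r l),
        op q • X.seminormalBar t = ∑ s, θ q l t s • X.seminormalBar s := by
  have hex : ∀ (q : X.Q r) (l : T.Λ r) (t : X.PermStd r l), ∃ c : X.PermStd r l → K,
      op q • X.seminormalBar t = ∑ s, c s • X.seminormalBar s := by
    intro q l t
    have h1 : op q • X.seminormalBar t ∈ X.cellQ r l :=
      X.op_smul_mem_cellQ q (span_seminormalBar hSN l ▸ Submodule.subset_span ⟨t, rfl⟩)
    rw [← span_seminormalBar hSN, Submodule.mem_span_range_iff_exists_fun] at h1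
    obtain ⟨c, hc⟩ := h1
    exact ⟨c, hc.symm⟩
  choose c hc using hex
  have huniq : ∀ (l : T.Λ r) (g g' : X.PermStd r l → K),
      ∑ s, g s • X.seminormalBar s = ∑ s, g' s • X.seminormalBar s → g = g' := by
    intro l g g' h
    funext s
    have h1 := Fintype.linearIndependent_iff.1 (linearIndependent_seminormalBar hSN l)
      (fun s => g s - g' s) (by simp only [sub_smul, Finset.sum_sub_distrib, h, sub_self]) s
    exact sub_eq_zero.1 h1
  let θ₀ : X.Q r →ₗ[K] ∀ l : T.Λ r, Matrix (X.PermStd r l) (X.PermStd r l) K :=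
    { toFun := fun q l => Matrix.of fun t s => c q l t s
      map_add' := fun p q => by
        funext l
        ext t s
        refine congrFun (huniq l (c (p + q) l t) (fun s => c p l t s + c q l t s) ?_) s
        simp only [add_smul, Finset.sum_add_distrib, ← hc, op_add]
      map_smul' := fun a q => by
        funext l
        ext t s
        refine congrFun (huniq l (c (a • q) l t) (fun s => a * c q l t s) ?_) s
        simp only [mul_smul, ← Finset.smul_sum, ← hc, X.op_smul_eq_smul] }
  let θ₁ : X.Q r →ₐ[K] ∀ l : T.Λ r, Matrix (X.PermStd r l) (X.PermStd r l) K :=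
    AlgHom.ofLinearMap θ₀
      (by
        funext l
        ext t s
        refine congrFun (huniq l (c 1 l t) (fun s => (1 : Matrix _ _ K) t s) ?_) s
        simp [← hc, Matrix.one_apply, ite_smul])
      -- The coefficients of `f̄_t q` form row `t` of the matrix of `q`, so a right action gives a
      -- homomorphism and not an anti-homomorphism.
      (fun p q => by
        funext l
        ext t s
        refine congrFun (huniq l (c (p * q) l t) (fun s => ∑ u, c p l t u * c q l u s) ?_) s
        rw [← hc, op_mul_smul, hc p]
        simp only [Finset.smul_sum, X.op_smul_smul, hc q, Finset.sum_smul, mul_smul]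
        exact Finset.sum_comm)
  have hinj : Function.Injective θ₁ := by
    rw [injective_iff_map_eq_zero]
    intro q hq
    refine X.eq_zero_of_op_smul_eq_zero fun l x hx => ?_
    rw [← span_seminormalBar hSN] at hx
    induction hx using Submodule.span_induction with
    | mem x hx =>
      obtain ⟨t, rfl⟩ := hx
      change op q • X.seminormalBar t = 0
      rw [hc]
      refine Finset.sum_eq_zero fun s _ => ?_
      have h1 : c q l t s = 0 := congrFun (congrFun (congrFun hq l) t) s
      rw [h1, zero_smul]
    | zero => exact smul_zero _
    | add x y _ _ hx hy => rw [smul_add, hx, hy, add_zero]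
    | smul a x _ hx => rw [X.op_smul_smul, hx, smul_zero]
  have hdim : Module.finrank K (X.Q r) =
      Module.finrank K (∀ l : T.Λ r, Matrix (X.PermStd r l) (X.PermStd r l) K) := by
    rw [finrank_Q, Module.finrank_pi_fintype]
    simp [Module.finrank_matrix, sq]
  have hsurj : Function.Surjective θ₁ :=
    (LinearMap.injective_iff_surjective_of_finrank_eq_finrank (f := θ₁.toLinearMap) hdim).1 hinj
  exact ⟨AlgEquiv.ofBijective θ₁ ⟨hinj, hsurj⟩, fun q l t => hc q l t⟩

theorem formBar_eq (s t : X.PermStd r l) : X.formBar s t =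
    ((T.C r).baseChange K).bilin (T.seminormalEval S K s.1) (T.seminormalEval S K t.1) :=
  (evaluable_form_seminormal (hSN r l s) (hSN r l t)).2

theorem formBar_of_ne {s t : X.PermStd r l} (h : s ≠ t) : X.formBar s t = 0 := by
  rw [formBar_eq hSN]
  exact bilin_seminormalEval_of_ne (hSN r l s) (hSN r l t) fun h' => h (Subtype.ext h')

theorem formBar_self_ne_zero [IsSemisimpleRing (X.Q r)] (t : X.PermStd r l) :
    X.formBar t t ≠ 0 := by
  rw [formBar_eq hSN]
  -- As `φ(m_l a ε) = φ(m_l a)`, the vector `f̄_t ≠ 0` is fixed by `φ(ε)`; so `ε` does not kill the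
  -- evaluated `f_t`. Since `ε` lies in `A^{⊵ l}`, that vector is not in the radical.
  obtain ⟨ε, hε, hmul⟩ := ((T.C r).baseChange K).exists_right_identity (X.φ r).toRingHom
    (X.φ_surjective r) l
  have h0 : X.seminormalBar t ≠ 0 := (linearIndependent_seminormalBar hSN l).ne_zero t
  have h1 : ((T.C r).baseChange K).act (T.seminormalEval S K t.1) ε ≠ 0 := by
    intro h
    apply h0
    let a : K ⊗[R] T.A r := (1 ⊗ₜ[R] T.dPath t.1) * T.gzEval S K t.1
    have h2 : T.seminormalEval S K t.1 =
        ((T.C r).baseChange K).act ((T.C r).extend K (T.δ r l)) a := by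
      rw [CellDatum.act_mul, ← murphyBase_eq_act]
      rfl
    have h3 : X.φ r ((1 ⊗ₜ[R] T.M r l) * a * ε) = X.φ r ((1 ⊗ₜ[R] T.M r l) * a) :=
      hmul _ (CellDatum.mem_aboveEq_of_mkQ_eq _ (mkQ_M_mul K a)
        (CellDatum.alphaInv_mem_aboveEq _ _ _))
    rw [seminormalBar_eq, h2, cellMap_act_δ, ← h3, mul_assoc, ← cellMap_act_δ,
      CellDatum.act_mul, ← h2, h, map_zero]
  obtain ⟨y, hy⟩ := CellDatum.exists_bilin_ne_zero_of_act_ne_zero _ hε h1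
  exact bilin_seminormalEval_self_ne_zero (hSN r l t) hy

theorem op_gzBar_smul_self (t : X.PermStd r l) :
    op (X.gzBar t) • X.seminormalBar t = X.seminormalBar t := by
  rw [seminormalBar_eq, gzBar_eq, ← cellMap_act, act_seminormalEval_gzEval_self (hSN r l t)]

theorem op_gzBar_smul_of_ne {s t : X.PermStd r l} (h : s ≠ t) :
    op (X.gzBar t) • X.seminormalBar s = 0 := by
  rw [seminormalBar_eq, gzBar_eq, ← cellMap_act, gzEval,
    act_seminormalEval_eq_zero (hSN r l s) (hSN r l t)
      (act_seminormal_gz_of_ne fun h' => h (Subtype.ext h')), map_zero]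

theorem op_gzBar_smul_of_shape_ne (h : l ≠ m) (s : X.PermStd r l) (t : X.PermStd r m) :
    op (X.gzBar t) • X.seminormalBar s = 0 := by
  rw [seminormalBar_eq, gzBar_eq, ← cellMap_act, gzEval,
    act_seminormalEval_eq_zero (hSN r l s) (hSN r m t) (act_gz_of_ne h _ _), map_zero]

theorem op_gzUnitBar_smul_self (s t : X.PermStd r l) :
    op (X.gzUnitBar s t) • X.seminormalBar s = X.formBar s s • X.seminormalBar t := by
  have h := (act_seminormalEval_of_act_seminormal (K := K) (hSN r l s) (hSN r l t)
    (evaluable_gzUnit (hSN r l s) (hSN r l t)) (act_seminormal_gzUnit_self s.1 t.1)).2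
  rw [← CellDatum.form_eq_bilin] at h
  rw [seminormalBar_eq, gzUnitBar, ← cellMap_act, h, map_smul, ← seminormalBar_eq]
  rfl

theorem op_gzUnitBar_smul_of_ne {u s : X.PermStd r l} (h : u ≠ s) (t : X.PermStd r l) :
    op (X.gzUnitBar s t) • X.seminormalBar u = 0 := by
  rw [seminormalBar_eq, gzUnitBar, ← cellMap_act, act_seminormalEval_eq_zero (hSN r l u)
    (evaluable_gzUnit (hSN r l s) (hSN r l t))
    (act_seminormal_gzUnit_of_ne (fun h' => h (Subtype.ext h')) _), map_zero]

theorem op_gzUnitBar_smul_of_shape_ne (h : l ≠ m) (u : X.PermStd r l) (s t : X.PermStd r m) :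
    op (X.gzUnitBar s t) • X.seminormalBar u = 0 := by
  rw [seminormalBar_eq, gzUnitBar, ← cellMap_act, act_seminormalEval_eq_zero (hSN r l u)
    (evaluable_gzUnit (hSN r m s) (hSN r m t)) (act_gzUnit_of_ne h _ _ _), map_zero]

/-- Products of Gelfand-Zeitlin idempotents of consecutive levels. -/
theorem ι_gzBar_mul_gzBar {m : T.Λ (r + 1)} (s : X.PermStd r l) (t : X.PermStd (r + 1) m) :
    X.ι r (X.gzBar s) * X.gzBar t =
      X.φ (r + 1) (evalAlg R F S K (T.A (r + 1)) (T.ιBase F r (T.gz s.1) * T.gz t.1)) := by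
  rw [gzBar_eq, gzBar_eq, ← X.φ_ι, ← map_mul, gzEval, gzEval, ← evalAlg_ιBase (hSN r l s),
    ← evalAlg_mul (T.C (r + 1)) (evaluable_ιBase (hSN r l s)) (hSN _ m t)]

theorem ι_gzBar_mul_gzBar_eq_zero {m : T.Λ (r + 1)} (s : X.PermStd r l)
    (t : X.PermStd (r + 1) m) (i : Fin (T.filtration r m).n)
    (u : T.Std r ((T.filtration r m).label i)) (ht : t.1 = snoc i u)
    (h : T.gz s.1 * T.gz u = 0) : X.ι r (X.gzBar s) * X.gzBar t = 0 := by
  rw [ι_gzBar_mul_gzBar hSN, ht, ιBase_gz_mul_gz_snoc, h, map_zero, zero_mul,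
    evalAlg_zero (T.C (r + 1)), map_zero]

theorem ι_gzBar_mul_gzBar_snoc {m : T.Λ (r + 1)} (i : Fin (T.filtration r m).n)
    (s : X.PermStd r ((T.filtration r m).label i)) (t : X.PermStd (r + 1) m)
    (ht : t.1 = snoc i s.1) : X.ι r (X.gzBar s) * X.gzBar t = X.gzBar t := by
  rw [ι_gzBar_mul_gzBar hSN, ht, ιBase_gz_mul_gz_snoc, gz_mul_self, ← gz_snoc, ← ht]
  rfl

end SeminormalBasis

end QuotientTower

/-! ### Matrix units and matrix coefficients -/

namespace QuotientTower

variable {R : Type u} {F : Type u₁} [CommRing R] [IsDomain R] [Field F] [Algebra R F]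
  [IsFractionRing R F] {T : DiagramTower.{u, v, w, u₁} R F} {S : Type u₂} {K : Type u₃}
  [CommRing S] [IsDomain S] [Algebra R S] [Field K] [Algebra S K] [IsFractionRing S K]
  [Algebra R K] [IsScalarTower R S K] {X : QuotientTower.{u, v, w, u₁, u₂, u₃, u₄} T S K}

open DiagramTower MulOpposite

section MatrixUnits

variable (hSN : ∀ (r : ℕ) (l : T.Λ r) (t : X.PermStd r l), Evaluable R F S (T.A r) (T.gz t.1))
  {r : ℕ}

open Classical in
include hSN in
/-- The matrix units attached to the seminormal bases, together with the values of the defining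
isomorphism of `Q_r` with a product of matrix algebras. -/
theorem exists_matrixEquiv_spec (r : ℕ) [IsSemisimpleRing (X.Q r)] :
    ∃ θ : X.Q r ≃ₐ[K] ∀ l : T.Λ r, Matrix (X.PermStd r l) (X.PermStd r l) K,
      (∀ (q : X.Q r) (l : T.Λ r) (t : X.PermStd r l),
        op q • X.seminormalBar t = ∑ s, θ q l t s • X.seminormalBar s) ∧
      (∀ (l : T.Λ r) (t : X.PermStd r l), θ (X.gzBar t) = Pi.single l (Matrix.single t t 1)) ∧
      (∀ (l : T.Λ r) (s t : X.PermStd r l),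
        θ (X.gzUnitBar s t) = Pi.single l (Matrix.single s t (X.formBar s s))) ∧
      (∀ (l : T.Λ r) (s t : X.PermStd r l),
        θ (X.matrixUnit s t) = Pi.single l (Matrix.single s t 1)) ∧
      (∀ l ∈ X.perm r, IsMinimalCentralIdempotent (X.z r l) ∧
        (∀ x ∈ X.cellQ r l, op (X.z r l) • x = x) ∧ θ (X.z r l) = Pi.single l 1) := by
  obtain ⟨θ, hθ⟩ := exists_matrixEquiv hSN r
  have huniq : ∀ (q : X.Q r) (M : ∀ l : T.Λ r, Matrix (X.PermStd r l) (X.PermStd r l) K),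
      (∀ l t, op q • X.seminormalBar t = ∑ s, M l t s • X.seminormalBar s) → θ q = M := by
    intro q M h
    funext l
    ext t s
    have h1 := (hθ q l t).symm.trans (h l t)
    rw [← sub_eq_zero, ← Finset.sum_sub_distrib] at h1
    simp only [← sub_smul] at h1
    exact sub_eq_zero.1
      (Fintype.linearIndependent_iff.1 (linearIndependent_seminormalBar hSN l) _ h1 s)
  -- An element moving one seminormal vector to a multiple of another and killing all the rest is a
  -- scaled elementary matrix.
  have hsingle : ∀ (q : X.Q r) (l : T.Λ r) (s t : X.PermStd r l) (c : K),
      (op q • X.seminormalBar s = c • X.seminormalBar t) →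
      (∀ u, u ≠ s → op q • X.seminormalBar u = 0) →
      (∀ (m : T.Λ r) (u : X.PermStd r m), m ≠ l → op q • X.seminormalBar u = 0) →
      θ q = Pi.single l (Matrix.single s t c) := by
    intro q l s t c h1 h2 h3
    refine huniq q _ fun m u => ?_
    by_cases hm : m = l
    · subst hm
      by_cases hu : u = s
      · subst hu
        rw [h1, Pi.single_eq_same, Finset.sum_eq_single t]
        · rw [Matrix.single_apply_same]
        · intro v _ hv
          rw [Matrix.single_apply_of_ne (h := fun h => hv h.2.symm), zero_smul]
        · intro h; exact (h (Finset.mem_univ _)).elim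
      · rw [h2 u hu, Pi.single_eq_same, Finset.sum_eq_zero]
        intro v _
        rw [Matrix.single_apply_of_ne (h := fun h => hu h.1.symm), zero_smul]
    · rw [h3 m u hm, Pi.single_eq_of_ne hm, Finset.sum_eq_zero]
      intro v _
      rw [Matrix.zero_apply, zero_smul]
  have hunit : ∀ (l : T.Λ r) (s t : X.PermStd r l),
      θ (X.gzUnitBar s t) = Pi.single l (Matrix.single s t (X.formBar s s)) := fun l s t =>
    hsingle _ l s t _ (op_gzUnitBar_smul_self hSN s t)
      (fun u hu => op_gzUnitBar_smul_of_ne hSN hu t)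
      (fun m u hm => op_gzUnitBar_smul_of_shape_ne hSN hm u s t)
  have hact : ∀ (q : X.Q r) (l : T.Λ r), θ q l = 1 ↔ ∀ x ∈ X.cellQ r l, op q • x = x := by
    intro q l
    constructor
    · intro h x hx
      rw [← span_seminormalBar hSN] at hx
      induction hx using Submodule.span_induction with
      | mem x hx =>
        obtain ⟨t, rfl⟩ := hx
        change op q • X.seminormalBar t = X.seminormalBar t
        rw [hθ, h]
        simp [Matrix.one_apply, ite_smul]
      | zero => exact smul_zero _
      | add x y _ _ hx hy => rw [smul_add, hx, hy]
      | smul a x _ hx => rw [X.op_smul_smul, hx]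
    · intro h
      ext t s
      have h1 : op q • X.seminormalBar t = X.seminormalBar t :=
        h _ (span_seminormalBar hSN l ▸ Submodule.subset_span ⟨t, rfl⟩)
      have h2 : ∑ s, (θ q l t s - (1 : Matrix _ _ K) t s) • X.seminormalBar s = 0 := by
        simp only [sub_smul, Finset.sum_sub_distrib]
        rw [← hθ, h1]
        simp [Matrix.one_apply, ite_smul]
      exact sub_eq_zero.1
        (Fintype.linearIndependent_iff.1 (linearIndependent_seminormalBar hSN l) _ h2 s)
  refine ⟨θ, hθ, ?_, hunit, ?_, ?_⟩
  · intro l t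
    exact hsingle _ l t t 1 (by rw [one_smul, op_gzBar_smul_self hSN])
      (fun u hu => op_gzBar_smul_of_ne hSN hu)
      (fun m u hm => op_gzBar_smul_of_shape_ne hSN hm u t)
  · intro l s t
    rw [matrixUnit, map_smul, hunit, ← Pi.single_smul, Matrix.smul_single, smul_eq_mul,
      inv_mul_cancel₀ (formBar_self_ne_zero hSN s)]
  · intro l hl
    have := X.nonempty_permStd hl
    have hex : ∃ e : X.Q r, IsMinimalCentralIdempotent e ∧ ∀ x ∈ X.cellQ r l, op e • x = x := by
      refine ⟨_, isMinimalCentralIdempotent_symm_single θ.toRingEquiv l, (hact _ l).1 ?_⟩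
      have h := congrFun (θ.toRingEquiv.apply_symm_apply (Pi.single l 1)) l
      rw [Pi.single_eq_same] at h
      exact h
    have hz : IsMinimalCentralIdempotent (X.z r l) ∧ ∀ x ∈ X.cellQ r l, op (X.z r l) • x = x :=
      Classical.epsilon_spec hex
    refine ⟨hz.1, hz.2, ?_⟩
    -- The epsilon choice is harmless: a minimal central idempotent equal to 1 in block `l` must be
    -- the unit of that block.
    rw [hz.1.eq_of_apply_eq_one θ.toRingEquiv ((hact _ l).2 hz.2)]
    exact θ.toRingEquiv.apply_symm_apply _

include hSN in
theorem sum_gzBar_smul {l : T.Λ r} {x : X.Q r ⧸ X.above r l} (hx : x ∈ X.cellQ r l) :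
    ∑ s : X.PermStd r l, op (X.gzBar s) • x = x := by
  rw [← span_seminormalBar hSN] at hx
  induction hx using Submodule.span_induction with
  | mem x hx =>
    obtain ⟨t, rfl⟩ := hx
    change ∑ s : X.PermStd r l, op (X.gzBar s) • X.seminormalBar t = X.seminormalBar t
    rw [Finset.sum_eq_single t, op_gzBar_smul_self hSN]
    · intro s _ hs
      exact op_gzBar_smul_of_ne hSN hs.symm
    · intro h; exact (h (Finset.mem_univ _)).elim
  | zero => simp
  | add x y _ _ hx hy => simp only [smul_add, Finset.sum_add_distrib, hx, hy]
  | smul a x _ hx => simp only [X.op_smul_smul, ← Finset.smul_sum, hx]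

include hSN in
/-- The seminormal matrix coefficients of `Q_r` are evaluations of those of `A_r`. -/
theorem seminormalBar_matrix_coefficients {l : T.Λ r} (a : T.A r)
    {c : T.Std r l → T.Std r l → F}
    (hc : ∀ t : T.Std r l, (T.CF r).act (l := l) (T.seminormal t) (1 ⊗ₜ[R] a) =
      ∑ s : T.Std r l, c s t • T.seminormal s) (t : X.PermStd r l) :
    (∀ s : X.PermStd r l, EvaluableScalar R F S (c s.1 t.1)) ∧
      op (X.φ r (1 ⊗ₜ[R] a)) • X.seminormalBar t =
        ∑ s : X.PermStd r l, evalScalar R F S K (c s.1 t.1) • X.seminormalBar s := by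
  -- Right multiplication by `F_s` isolates a single coefficient. Only permissible `s` are used, so
  -- coefficients at other paths need not be evaluable.
  have h1 : ∀ s : X.PermStd r l, (T.CF r).act (T.seminormal t.1) ((1 ⊗ₜ[R] a) * T.gz s.1) =
      c s.1 t.1 • T.seminormal s.1 := by
    intro s
    rw [CellDatum.act_mul, hc, ← CellDatum.actₗ_apply, map_sum,
      Finset.sum_eq_single (s.1 : T.Std r l), map_smul, CellDatum.actₗ_apply,
      act_seminormal_gz_self]
    · intro u _ hu
      rw [map_smul, CellDatum.actₗ_apply, act_seminormal_gz_of_ne hu, smul_zero]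
    · intro h; exact (h (Finset.mem_univ _)).elim
  have h2 := fun s : X.PermStd r l => act_seminormalEval_of_act_seminormal (K := K) (hSN r l t)
    (hSN r l s) ((evaluable_tmul F S a).mul (hSN r l s)) (h1 s)
  refine ⟨fun s => (h2 s).1, ?_⟩
  have h3 : op (X.φ r (1 ⊗ₜ[R] a)) • X.seminormalBar t ∈ X.cellQ r l :=
    X.op_smul_mem_cellQ _ (span_seminormalBar hSN l ▸ Submodule.subset_span ⟨t, rfl⟩)
  -- Inserting the sum of the permissible `F̄_s`, which is the identity on `Δ_{Q_r}(l)`, truncates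
  -- the expansion to permissible paths.
  rw [← sum_gzBar_smul hSN h3]
  refine Finset.sum_congr rfl fun s _ => ?_
  have h4 := (h2 s).2
  rw [evalAlg_mul (T.C r) (evaluable_tmul F S a) (hSN r l s), evalAlg_tmul F S K (T.C r)] at h4
  rw [← op_mul_smul, gzBar_eq, ← map_mul, seminormalBar_eq, ← cellMap_act, seminormalBar_eq,
    ← map_smul, ← h4]
  rfl

end MatrixUnits

theorem _root_.Pi.single_injective_of_ne_zero {ι : Type*} [DecidableEq ι] {M : ι → Type*}
    [∀ i, Zero (M i)] {i j : ι} {x : M i} {y : M j} (hx : x ≠ 0)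
    (h : Pi.single i x = Pi.single j y) : i = j := by
  by_contra hij
  have h1 := congrFun h i
  rw [Pi.single_eq_same, Pi.single_eq_of_ne hij] at h1
  exact hx h1

/-! ### Gelfand-Zeitlin idempotents and branching of the quotient tower -/

section Tower

variable (hSN : ∀ (r : ℕ) (l : T.Λ r) (t : X.PermStd r l), Evaluable R F S (T.A r) (T.gz t.1))
  (hss : ∀ r, IsSemisimpleRing (X.Q r)) {r : ℕ}

include hSN hss

theorem z_eq_sum_gzBar {l : T.Λ r} (hl : l ∈ X.perm r) :
    X.z r l = ∑ t : X.PermStd r l, X.gzBar t := by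
  classical
  obtain ⟨θ, -, hgz, -, -, hz⟩ := exists_matrixEquiv_spec hSN r
  apply θ.injective
  rw [(hz l hl).2.2, map_sum]
  simp only [hgz]
  rw [← Matrix.sum_single_one]
  exact map_sum (AddMonoidHom.single (fun l : T.Λ r => Matrix (X.PermStd r l) (X.PermStd r l) K) l)
    _ _

theorem gzBar_mul_z {l : T.Λ r} (t : X.PermStd r l) : X.gzBar t * X.z r l = X.gzBar t := by
  classical
  obtain ⟨θ, -, hgz, -, -, hz⟩ := exists_matrixEquiv_spec hSN r
  apply θ.injective
  rw [map_mul, (hz l (X.mem_perm_of_permStd t)).2.2, hgz, ← Pi.single_mul, mul_one]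

theorem gzBar_ne_zero {l : T.Λ r} (t : X.PermStd r l) : X.gzBar t ≠ 0 := by
  intro h
  have h1 := op_gzBar_smul_self hSN t
  rw [h, op_zero, zero_smul] at h1
  exact (linearIndependent_seminormalBar hSN l).ne_zero t h1.symm

/-- Write `z̄_m` as the sum of all `F̄_u` of shape `m`. Already over `F`, `F_s F_u = 0` unless `u`
truncates to `s`, so one term is left. -/
theorem ι_gzBar_mul_z {m : T.Λ (r + 1)} (i : Fin (T.filtration r m).n)
    (s : X.PermStd r ((T.filtration r m).label i)) (t : X.PermStd (r + 1) m)
    (ht : t.1 = snoc i s.1) : X.ι r (X.gzBar s) * X.z (r + 1) m = X.gzBar t := by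
  rw [z_eq_sum_gzBar hSN hss (X.mem_perm_of_permStd t), Finset.mul_sum,
    Finset.sum_eq_single t, ι_gzBar_mul_gzBar_snoc hSN i s t ht]
  · intro u _ hu
    obtain ⟨j, u', hu'⟩ := exists_eq_snoc u.1
    refine ι_gzBar_mul_gzBar_eq_zero hSN s u j u' hu' ?_
    by_cases hij : i = j
    · subst hij
      refine gz_mul_gz_of_ne fun h => hu (Subtype.ext ?_)
      rw [hu', ht, h]
    · exact gz_mul_gz_of_shape_ne
        (fun h => hij ((T.filtration r m).label_anti.injective h)) _ _
  · intro h; exact (h (Finset.mem_univ _)).elim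

theorem gzBar_eq_gzQ {l : T.Λ r} (t : X.PermStd r l) : X.gzBar t = X.gzQ t := by
  induction r with
  | zero =>
    have h0 : X.gzQ t = X.z 0 l := by
      change X.z 0 (t.1.1.1 (Fin.last 0)) = _
      rw [t.1.2]
    have h1 : (Finset.univ : Finset (X.PermStd 0 l)) = {t} :=
      Finset.eq_singleton_iff_unique_mem.2 ⟨Finset.mem_univ _, fun u _ =>
        Subtype.ext ((eq_nil u.1).trans (eq_nil t.1).symm)⟩
    rw [h0, z_eq_sum_gzBar hSN hss (X.mem_perm_of_permStd t), h1, Finset.sum_singleton]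
  | succ r ih =>
    obtain ⟨i, s', hs'⟩ := exists_eq_snoc t.1
    have hp : X.IsPerm (snoc i s') := hs' ▸ t.2
    obtain ⟨s, rfl⟩ := X.exists_permStd ((X.isPerm_snoc i s').1 hp).1
    rw [← ι_gzBar_mul_z hSN hss i s t hs', ih s]
    have h2 : t.1.1.1 (Fin.last (r + 1)) = l := t.1.2
    have h3 : (fun k : Fin (r + 1) => t.1.1.1 k.castSucc) = s.1.1.1 := by
      rw [hs']
      exact funext fun k => snoc_castSucc i s.1 k
    change _ = X.ι r (towerProd (fun r => (X.ι r).toRingHom) X.z r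
      fun k => t.1.1.1 k.castSucc) * X.z (r + 1) (t.1.1.1 (Fin.last (r + 1)))
    rw [h2, h3]
    rfl

/-- Along an edge, a permissible path to `l` extends to one to `m`, whose nonzero idempotent factors
through `z̄_l z̄_m`. Without an edge, no path to `m` truncates to a path to `l`, so every term of
the expanded product vanishes. -/
theorem edge_iff {l : T.Λ r} (hl : l ∈ X.perm r) {m : T.Λ (r + 1)} (hm : m ∈ X.perm (r + 1)) :
    T.Edge r l m ↔ X.ι r (X.z r l) * X.z (r + 1) m ≠ 0 := by
  constructor
  · rintro ⟨i, rfl⟩ h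
    obtain ⟨s⟩ := X.nonempty_permStd hl
    obtain ⟨t, ht⟩ := X.exists_permStd ((X.isPerm_snoc i s.1).2 ⟨s.2, hm⟩)
    have h1 := ι_gzBar_mul_z hSN hss i s t ht
    rw [← gzBar_mul_z hSN hss s, map_mul, mul_assoc, h, mul_zero] at h1
    exact gzBar_ne_zero hSN hss t h1.symm
  · intro h
    by_contra hE
    apply h
    rw [z_eq_sum_gzBar hSN hss hl, z_eq_sum_gzBar hSN hss hm, map_sum, Finset.sum_mul_sum]
    refine Finset.sum_eq_zero fun s _ => Finset.sum_eq_zero fun t _ => ?_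
    obtain ⟨i, u, hu⟩ := exists_eq_snoc t.1
    exact ι_gzBar_mul_gzBar_eq_zero hSN s t i u hu
      (gz_mul_gz_of_shape_ne (fun h => hE ⟨i, h.symm⟩) _ _)

end Tower

end QuotientTower

/-! ### The main theorem, read off from the matrix picture -/

open Classical TensorProduct in
theorem mainTheorem9 {R : Type u} {F : Type u₁} {S : Type u₂} {K : Type u₃}
    [CommRing R] [IsDomain R] [Field F] [Algebra R F] [IsFractionRing R F]
    [CommRing S] [IsDomain S] [Algebra R S] [Field K] [Algebra S K] [IsFractionRing S K]
    [Algebra R K] [IsScalarTower R S K]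
    (hπ : Function.Surjective (algebraMap R S))
    (T : DiagramTower.{u, v, w, u₁} R F)
    (X : QuotientTower.{u, v, w, u₁, u₂, u₃, u₄} T S K)
    (hQ : ∀ r, IsSplitSemisimple K (X.Q r))
    (hJM : T.HasSeparatingAdditiveJM ∨ T.HasSeparatingMultiplicativeJM)
    (hSN : ∀ (r : ℕ) (l : T.Λ r) (t : X.PermStd r l), Evaluable R F S (T.A r) (T.gz t.1)) :
    -- the permissible points of level `r` label the minimal central idempotents of `Q_r`
    (∀ r : ℕ, (∀ l ∈ X.perm r, IsMinimalCentralIdempotent (X.z r l) ∧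
          ∀ x ∈ X.cellQ r l, MulOpposite.op (X.z r l) • x = x) ∧
        Set.InjOn (X.z r) (X.perm r) ∧
        ∀ e : X.Q r, IsMinimalCentralIdempotent e → ∃ l ∈ X.perm r, X.z r l = e) ∧
    -- the branching diagram of `(Q_r)` is the permissible part of that of the tower `T`
    (∀ (r : ℕ), ∀ l ∈ X.perm r, ∀ m ∈ X.perm (r + 1),
        (T.Edge r l m ↔ X.ι r (X.z r l) * X.z (r + 1) m ≠ 0)) ∧
    -- the `F̄_t` are the Gelfand-Zeitlin idempotents of `(Q_r)`
    (∀ (r : ℕ) (l : T.Λ r) (t : X.PermStd r l), X.gzBar t = X.gzQ t) ∧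
    -- the elements `F^l_{st}` and the scalars `⟨f^l_s, f^l_t⟩` are evaluable
    (∀ (r : ℕ) (l : T.Λ r) (s t : X.PermStd r l),
        Evaluable R F S (T.A r) (T.gzUnit s.1 t.1) ∧
        EvaluableScalar R F S
          ((T.CF r).form (l := l) (T.seminormal s.1) (T.seminormal t.1))) ∧
    -- multiplication rules
    (∀ (r : ℕ) (l : T.Λ r) (t u v : X.PermStd r l),
        MulOpposite.op (X.gzUnitBar u v) • X.seminormalBar t =
          if t = u then X.formBar t t • X.seminormalBar v else 0) ∧
    (∀ (r : ℕ) (l m : T.Λ r) (t : X.PermStd r l) (u v : X.PermStd r m), l ≠ m →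
        MulOpposite.op (X.gzUnitBar u v) • X.seminormalBar t = 0) ∧
    (∀ (r : ℕ) (l : T.Λ r) (s t u v : X.PermStd r l),
        X.gzUnitBar s t * X.gzUnitBar u v =
          if t = u then X.formBar t t • X.gzUnitBar s v else 0) ∧
    (∀ (r : ℕ) (l m : T.Λ r) (s t : X.PermStd r l) (u v : X.PermStd r m), l ≠ m →
        X.gzUnitBar s t * X.gzUnitBar u v = 0) ∧
    -- `π(⟨f_t, f_s⟩) ≠ 0` exactly when `t = s`
    (∀ (r : ℕ) (l : T.Λ r) (s t : X.PermStd r l), X.formBar t s ≠ 0 ↔ t = s) ∧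
    -- normalization
    (∀ (r : ℕ) (l : T.Λ r) (t : X.PermStd r l),
        (X.formBar t t)⁻¹ • X.gzUnitBar t t = X.gzBar t) ∧
    -- the `Ē^l_{st}` are a complete family of matrix units
    (∀ (r : ℕ) (l : T.Λ r) (s t u v : X.PermStd r l),
        X.matrixUnit s t * X.matrixUnit u v = if t = u then X.matrixUnit s v else 0) ∧
    (∀ (r : ℕ) (l m : T.Λ r) (s t : X.PermStd r l) (u v : X.PermStd r m), l ≠ m →
        X.matrixUnit s t * X.matrixUnit u v = 0) ∧
    (∀ (r : ℕ) (l : T.Λ r) (s : X.PermStd r l), X.matrixUnit s s = X.gzBar s) ∧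
    (∀ r : ℕ, ∑ l : T.Λ r, ∑ s : X.PermStd r l, X.matrixUnit s s = 1) ∧
    (∀ r : ℕ,
        LinearIndependent K (fun i : Σ l : T.Λ r, X.PermStd r l × X.PermStd r l =>
          X.matrixUnit i.2.1 i.2.2) ∧
        Submodule.span K (Set.range fun i : Σ l : T.Λ r, X.PermStd r l × X.PermStd r l =>
          X.matrixUnit i.2.1 i.2.2) = ⊤) ∧
    -- the `f̄^l_t` are a basis of the cell module of `Q_r`
    (∀ (r : ℕ), ∀ l ∈ X.perm r,
        LinearIndependent K (fun t : X.PermStd r l => X.seminormalBar t) ∧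
        Submodule.span K (Set.range fun t : X.PermStd r l => X.seminormalBar t) = X.cellQ r l) ∧
    -- the seminormal matrix coefficients of `Q_r` are truncations of those of `A_r`
    (∀ (r : ℕ) (l : T.Λ r) (a : T.A r) (c : T.Std r l → T.Std r l → F),
        (∀ t : T.Std r l, (T.CF r).act (l := l) (T.seminormal t) (1 ⊗ₜ[R] a) =
          ∑ s : T.Std r l, c s t • T.seminormal s) →
        ∀ t : X.PermStd r l,
          (∀ s : X.PermStd r l, EvaluableScalar R F S (c s.1 t.1)) ∧
          MulOpposite.op (X.φ r (1 ⊗ₜ[R] a)) • X.seminormalBar t =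
            ∑ s : X.PermStd r l, evalScalar R F S K (c s.1 t.1) • X.seminormalBar s) := by
  have hss : ∀ r, IsSemisimpleRing (X.Q r) := fun r => (hQ r).isSemisimpleRing
  choose θ hθ hgz hgu hmu hz using fun r => QuotientTower.exists_matrixEquiv_spec hSN r
  have hne : ∀ (r : ℕ) (l : T.Λ r) (t : X.PermStd r l), X.formBar t t ≠ 0 :=
    fun r l t => QuotientTower.formBar_self_ne_zero hSN t
  have hone : ∀ r, ∀ l ∈ X.perm r, (1 : Matrix (X.PermStd r l) (X.PermStd r l) K) ≠ 0 := by
    intro r l hl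
    have := X.nonempty_permStd hl
    exact one_ne_zero
  have hbasis : ∀ r, ∃ b : Module.Basis (Σ l : T.Λ r, X.PermStd r l × X.PermStd r l) K (X.Q r),
      ⇑b = fun i => X.matrixUnit i.2.1 i.2.2 := by
    intro r
    refine ⟨(Pi.basis fun l => Matrix.stdBasis K (X.PermStd r l) (X.PermStd r l)).map
      (θ r).symm.toLinearEquiv, funext fun i => (θ r).injective ?_⟩
    rw [hmu, Module.Basis.map_apply, Pi.basis_apply, ← Matrix.stdBasis_eq_single]
    exact (θ r).apply_symm_apply _
  have hunit : ∀ (r : ℕ) (l : T.Λ r) (s t u v : X.PermStd r l),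
      X.matrixUnit s t * X.matrixUnit u v = if t = u then X.matrixUnit s v else 0 := by
    intro r l s t u v
    apply (θ r).injective
    rw [map_mul, hmu, hmu, ← Pi.single_mul]
    split_ifs with h
    · rw [h, Matrix.single_mul_single_same, hmu, mul_one]
    · rw [Matrix.single_mul_single_of_ne (h := h), Pi.single_zero, map_zero]
  have hcross : ∀ (r : ℕ) (l m : T.Λ r), l ≠ m →
      ∀ (x : Matrix (X.PermStd r l) (X.PermStd r l) K)
        (y : Matrix (X.PermStd r m) (X.PermStd r m) K),
      (Pi.single l x * Pi.single m y : ∀ l : T.Λ r, Matrix (X.PermStd r l) (X.PermStd r l) K) =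
        0 := by
    intro r l m h x y
    funext n
    by_cases hn : n = l
    · subst hn; rw [Pi.mul_apply, Pi.single_eq_of_ne h, mul_zero, Pi.zero_apply]
    · rw [Pi.mul_apply, Pi.single_eq_of_ne hn, zero_mul, Pi.zero_apply]
  refine ⟨fun r => ⟨fun l hl => ⟨(hz r l hl).1, (hz r l hl).2.1⟩, ?_, ?_⟩,
    fun r l hl m hm => QuotientTower.edge_iff hSN hss hl hm,
    fun r l t => QuotientTower.gzBar_eq_gzQ hSN hss t,
    fun r l s t => ⟨DiagramTower.evaluable_gzUnit (hSN r l s) (hSN r l t),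
      (DiagramTower.evaluable_form_seminormal (K := K) (hSN r l s) (hSN r l t)).1⟩,
    ?_, fun r l m t u v h => QuotientTower.op_gzUnitBar_smul_of_shape_ne hSN h t u v,
    ?_, ?_, ?_, ?_, hunit, ?_, ?_, ?_, ?_, ?_,
    fun r l a c hc t => QuotientTower.seminormalBar_matrix_coefficients hSN a hc t⟩
  · intro l hl m hm h
    have h1 := congrArg (θ r) h
    rw [(hz r l hl).2.2, (hz r m hm).2.2] at h1
    exact Pi.single_injective_of_ne_zero (hone r l hl) h1
  · intro e he
    -- The block of `e` is non-empty, so it is indexed by a shape that admits a permissible path and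
    -- is therefore permissible.
    obtain ⟨l, ⟨t⟩, hl⟩ := he.exists_eq_symm_single (θ r).toRingEquiv
    have hlp := X.mem_perm_of_permStd t
    refine ⟨l, hlp, (θ r).injective ?_⟩
    rw [(hz r l hlp).2.2, hl]
    exact ((θ r).toRingEquiv.apply_symm_apply _).symm
  · intro r l t u v
    split_ifs with h
    · subst h
      exact QuotientTower.op_gzUnitBar_smul_self hSN t v
    · exact QuotientTower.op_gzUnitBar_smul_of_ne hSN h v
  · intro r l s t u v
    apply (θ r).injective
    rw [map_mul, hgu, hgu, ← Pi.single_mul]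
    split_ifs with h
    · subst h
      rw [Matrix.single_mul_single_same, map_smul, hgu, ← Pi.single_smul, Matrix.smul_single,
        smul_eq_mul, mul_comm]
    · rw [Matrix.single_mul_single_of_ne (h := h), Pi.single_zero, map_zero]
  · intro r l m s t u v h
    apply (θ r).injective
    rw [map_mul, hgu, hgu, hcross r l m h, map_zero]
  · intro r l s t
    constructor
    · intro h
      by_contra hts
      exact h (QuotientTower.formBar_of_ne hSN hts)
    · rintro rfl
      exact hne r l t
  · intro r l t
    apply (θ r).injective
    rw [map_smul, hgu, hgz, ← Pi.single_smul, Matrix.smul_single, smul_eq_mul,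
      inv_mul_cancel₀ (hne r l t)]
  · intro r l m s t u v h
    apply (θ r).injective
    rw [map_mul, hmu, hmu, hcross r l m h, map_zero]
  · intro r l s
    apply (θ r).injective
    rw [hmu, hgz]
  · intro r
    apply (θ r).injective
    simp only [map_sum, hmu, map_one]
    funext l
    rw [Finset.sum_apply, Finset.sum_eq_single l]
    · rw [Finset.sum_apply, Pi.one_apply, ← Matrix.sum_single_one]
      simp only [Pi.single_eq_same]
    · intro m _ hm
      rw [Finset.sum_apply]
      exact Finset.sum_eq_zero fun s _ => Pi.single_eq_of_ne hm.symm _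
    · intro h; exact (h (Finset.mem_univ _)).elim
  · intro r
    obtain ⟨b, hb⟩ := hbasis r
    rw [← hb]
    exact ⟨b.linearIndependent, b.span_eq⟩
  · intro r l _
    exact ⟨QuotientTower.linearIndependent_seminormalBar hSN l,
      QuotientTower.span_seminormalBar hSN l⟩
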